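/- Let $N\ge 1$, $1<p<\infty$, $p'=p/(p-1)$ and $\alpha,b,c\in\mathbb{R}$. Let $\Omega=\mathbb{R}^N\setminus\{0\}$ if $N\ge 2$ and $\Omega=(0,\infty)$ if $N=1$ (in the case $N=1$, $L^p(\mathbb{R}^N)$ stands for $L^p(0,\infty)$). All function spaces are complex-valued. Consider $$L=|x|^\alpha\Delta+c|x|^{\alpha-1}\frac{x}{|x|}\cdot\nabla-b|x|^{\alpha-2}.$$ Let $L_{\min}$ be the closure in $L^p(\mathbb{R}^N)$ of $(L,C_c^\infty(\Omega))$. For $0<\varepsilon<1$ let $\Omega_\varepsilon=\{x\in\Omega:\varepsilon<|x|<\varepsilon^{-1}\}$ and let $L_\varepsilon$ be $L$ in $L^p(\Omega_\varepsilon)$ with domain $W^{2,p}(\Omega_\varepsilon)\cap W^{1,p}_0(\Omega_\varepsilon)$. Put $$f(s)=b+s(N-2+c-s),\qquad s_{1,2}=\frac{N-2+c}{2}\mp\sqrt{b+\Big(\frac{N-2+c}{2}\Big)^2},$$ where the square root is read as $0$ if its argument is negative. For a complex Banach space $X$ and $u\in X$ let $F(u)=\{\varphi\in X':\varphi(u)=\|u\|^2=\|\varphi\|^2\}$.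 A linear operator $A$ in $X$ is called dissipative if $\|\lambda u-Au\|\ge\lambda\|u\|$ for all $\lambda>0$ and $u\in D(A)$, and sectorial with constant $l\ge 0$ if $$\operatorname{Re}\varphi(-Au)\ge 0\quad\text{and}\quad |\operatorname{Im}\varphi(-Au)|\le l\,\operatorname{Re}\varphi(-Au)\qquad\text{for all } u\in D(A),\ \varphi\in F(u).$$ Then the following hold. 1. One has $$f\Big(\frac{N-2+\alpha}{p}\Big)=b+\frac{(N+\alpha-2)^2}{p'p}+\frac{(N+\alpha-2)(c-\alpha)}{p},$$ and this number is positive if and only if $s_1+\frac{2-\alpha}{p}<\frac Np<s_2+\frac{2-\alpha}{p}$. 2. If $f\big(\frac{N-2+\alpha}{p}\big)>0$, then there is $l\ge 0$ such that $L_{\min}$ in $L^p(\mathbb{R}^N)$ and, for every $0<\varepsilon<1$, $L_\varepsilon$ in $L^p(\Omega_\varepsilon)$ are sectorial with constant $l$; in particular the sectoriality constant is independent of $\varepsilon$. 3. $L_{\min}$ is dissipative in $L^p(\mathbb{R}^N)$ if and only if $$b+\frac{(N+\alpha-2)^2}{p'p}+\frac{(N+\alpha-2)(c-\alpha)}{p}\ge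 0.$$ 4. If $f\big(\frac{N-2+\alpha}{p}\big)=0$ and $\frac{N-2+\alpha}{p}=\frac{N-2+c}{2}$, then there is $l\ge 0$ such that $L_{\min}$ and all $L_\varepsilon$, $0<\varepsilon<1$, are sectorial with constant $l$. -/

import Mathlib

open MeasureTheory Filter Topology
open scoped ENNReal ContDiff

noncomputable section

namespace ScaleInvariant

/-! ### Operators on a Banach space, given by their graphs -/

section Abstract

variable {X : Type*} [NormedAddCommGroup X] [NormedSpace ℂ X]

/-- The (normalized) duality map `F(u) = {φ ∈ X' : φ(u) = ‖u‖² = ‖φ‖²}`. -/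
def dualityMap (u : X) : Set (StrongDual ℂ X) :=
  {φ | φ u = ((‖u‖ ^ 2 : ℝ) : ℂ) ∧ ‖φ‖ = ‖u‖}

/-- The operator with graph `A` is dissipative: `‖λu - Au‖ ≥ λ‖u‖` for `λ > 0`, `u ∈ D(A)`. -/
def IsDissipative (A : Set (X × X)) : Prop :=
  ∀ u w : X, (u, w) ∈ A → ∀ t : ℝ, 0 < t → t * ‖u‖ ≤ ‖(t : ℂ) • u - w‖

/-- The operator `A` (given by its graph) is sectorial with constant `l`: the numerical range of
`-A` lies in the sector `{z : 0 ≤ Re z, |Im z| ≤ l Re z}`. The sign of the real part is a separate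
condition because it does not follow from the other one when `l = 0`. -/
def IsSectorialWith (A : Set (X × X)) (l : ℝ) : Prop :=
  0 ≤ l ∧ ∀ u w : X, (u, w) ∈ A → ∀ φ ∈ dualityMap u,
    0 ≤ (φ (-w)).re ∧ |(φ (-w)).im| ≤ l * (φ (-w)).re

end Abstract

/-! ### Domains, test functions, Sobolev spaces -/

/-- `ℝ^N` with the Euclidean norm. -/
abbrev E (N : ℕ) : Type := EuclideanSpace ℝ (Fin N)

/-- `Ω = ℝ^N \ {0}` if `N ≥ 2`, and `Ω = (0, ∞)` if `N = 1`. -/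
def Omega (N : ℕ) : Set (E N) := {x | x ≠ 0 ∧ (N = 1 → ∀ i, 0 < x i)}

/-- The annulus `Ω_ε = {x ∈ Ω : ε < |x| < 1/ε}`; the interval `(ε, 1/ε)` if `N = 1`. -/
def OmegaEps (N : ℕ) (ε : ℝ) : Set (E N) := {x | x ∈ Omega N ∧ ε < ‖x‖ ∧ ‖x‖ < ε⁻¹}

/-- `φ ∈ C_c^∞(V)`, complex valued (and extended by zero to `ℝ^N`). -/
def IsTest {N : ℕ} (V : Set (E N)) (φ : E N → ℂ) : Prop :=
  ContDiff ℝ ∞ φ ∧ HasCompactSupport φ ∧ tsupport φ ⊆ V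

/-- The classical partial derivative `∂_i φ`. -/
def partialD {N : ℕ} (i : Fin N) (φ : E N → ℂ) (x : E N) : ℂ :=
  fderiv ℝ φ x (EuclideanSpace.single i 1)

/-- `L^p(V)`, complex valued. -/
abbrev LpOn {N : ℕ} (p : ℝ≥0∞) (V : Set (E N)) : Type :=
  Lp ℂ p (volume.restrict V)

/-- `g` is the weak partial derivative `∂_i u` in `V`. -/
def HasWeakPartial {N : ℕ} {p : ℝ≥0∞} {V : Set (E N)} (i : Fin N) (u g : LpOn p V) : Prop :=
  ∀ φ : E N → ℂ, IsTest V φ → ∫ x in V, u x * partialD i φ x = -∫ x in V, g x * φ x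

/-- `u ∈ W^{2,p}(V)` with gradient `g` and Hessian `h`. -/
def HasSobolevTwo {N : ℕ} {p : ℝ≥0∞} {V : Set (E N)} (u : LpOn p V)
    (g : Fin N → LpOn p V) (h : Fin N → Fin N → LpOn p V) : Prop :=
  (∀ i, HasWeakPartial i u (g i)) ∧ ∀ i j, HasWeakPartial j (g i) (h i j)

/-- `u ∈ W^{1,p}_0(V)`, the closure of `C_c^∞(V)` in `W^{1,p}(V)`. -/
def MemSobolevZero {N : ℕ} {p : ℝ≥0∞} {V : Set (E N)} (u : LpOn p V) : Prop :=
  ∃ g : Fin N → LpOn p V, (∀ i, HasWeakPartial i u (g i)) ∧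
    ∀ δ : ℝ≥0∞, 0 < δ → ∃ φ : E N → ℂ, IsTest V φ ∧
      eLpNorm (fun x => u x - φ x) p (volume.restrict V) < δ ∧
      ∀ i, eLpNorm (fun x => g i x - partialD i φ x) p (volume.restrict V) < δ

/-! ### The operator `L = |x|^α Δ + c |x|^(α-1) (x/|x|)·∇ - b |x|^(α-2)` -/

/-- `L φ` for a smooth function `φ`. -/
def opL {N : ℕ} (α b c : ℝ) (φ : E N → ℂ) (x : E N) : ℂ :=
  ((‖x‖ ^ α : ℝ) : ℂ) * Laplacian.laplacian φ x
    + ((c * ‖x‖ ^ (α - 1) : ℝ) : ℂ) * fderiv ℝ φ x (‖x‖⁻¹ • x)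
    - ((b * ‖x‖ ^ (α - 2) : ℝ) : ℂ) * φ x

/-- The graph of `L` with domain `C_c^∞(Ω)` in `L^p(Ω)`. For `N ≥ 2` the space `L^p(Ω)` is
`L^p(ℝ^N)` since the origin is a null set; for `N = 1` it is `L^p(0, ∞)`. -/
def graphTest (N : ℕ) (p : ℝ≥0∞) (α b c : ℝ) : Set (LpOn p (Omega N) × LpOn p (Omega N)) :=
  {q | ∃ φ : E N → ℂ, IsTest (Omega N) φ ∧
    q.1 =ᵐ[volume.restrict (Omega N)] φ ∧ q.2 =ᵐ[volume.restrict (Omega N)] opL α b c φ}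

/-- The (graph of the) operator `L_min`: the closure of `(L, C_c^∞(Ω))`. -/
def Lmin (N : ℕ) (p : ℝ≥0∞) [Fact (1 ≤ p)] (α b c : ℝ) :
    Set (LpOn p (Omega N) × LpOn p (Omega N)) :=
  closure (graphTest N p α b c)

/-- The (graph of the) operator `L_ε`: `L` in `L^p(Ω_ε)` with Dirichlet boundary conditions, on the
domain `W^{2,p}(Ω_ε) ∩ W^{1,p}_0(Ω_ε)`. -/
def Leps (N : ℕ) (p : ℝ≥0∞) (α b c ε : ℝ) :
    Set (LpOn p (OmegaEps N ε) × LpOn p (OmegaEps N ε)) :=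
  {q | ∃ (g : Fin N → LpOn p (OmegaEps N ε)) (h : Fin N → Fin N → LpOn p (OmegaEps N ε)),
    HasSobolevTwo q.1 g h ∧ MemSobolevZero q.1 ∧
    q.2 =ᵐ[volume.restrict (OmegaEps N ε)] fun x =>
      ((‖x‖ ^ α : ℝ) : ℂ) * ∑ i, h i i x
        + ((c * ‖x‖ ^ (α - 1) : ℝ) : ℂ) * ∑ i, ((x i / ‖x‖ : ℝ) : ℂ) * g i x
        - ((b * ‖x‖ ^ (α - 2) : ℝ) : ℂ) * q.1 x}

/-! ### The quadratic function `f` and its roots -/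

/-- `f(s) = b + s (N - 2 + c - s)`. -/
def quadF (N : ℕ) (b c s : ℝ) : ℝ := b + s * ((N : ℝ) - 2 + c - s)

/-- The smaller root of `f` (when `b + ((N-2+c)/2)² ≥ 0`). -/
def rootOne (N : ℕ) (b c : ℝ) : ℝ :=
  ((N : ℝ) - 2 + c) / 2 - Real.sqrt (b + (((N : ℝ) - 2 + c) / 2) ^ 2)

/-- The larger root of `f` (when `b + ((N-2+c)/2)² ≥ 0`). -/
def rootTwo (N : ℕ) (b c : ℝ) : ℝ :=
  ((N : ℝ) - 2 + c) / 2 + Real.sqrt (b + (((N : ℝ) - 2 + c) / 2) ^ 2)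

/-- The left-hand side `b + (N+α-2)²/(p'p) + (N+α-2)(c-α)/p` of the dissipativity condition,
with `p' = p/(p-1)`. -/
def sectQuantity (N : ℕ) (p α b c : ℝ) : ℝ :=
  b + ((N : ℝ) + α - 2) ^ 2 / (Real.conjExponent p * p) + ((N : ℝ) + α - 2) * (c - α) / p

end ScaleInvariant

end

open ScaleInvariant

noncomputable section

namespace ScaleInvariant

/-! ### The duality map of `L^p` -/

section Duality

/-! Every statement about duality functionals is first turned into one about the single number ∫ w
ū|u|^(p-2) with w = Lu. In L^p with 1 < p < ∞ each φ in F(u) satisfies ‖u‖^(p-2) φ(w) = ∫ w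
ū|u|^(p-2) (`dualityMap_apply`). Dissipativity therefore means that the real part of this integral
is nonpositive (`re_dualPairing_nonpos_iff`), and sectoriality means that its negative lies in a
closed sector. Such conditions are intersections of norm inequalities, so they survive the closure
of the graph.

For a test function u put s = (N-2+α)/p and v = |x|^s u. Integration by parts, with the smooth
multiplier v̄(|v|²+δ)^((p-2)/2), turns the integral of -Lu against it into the integral of
`formDensity` (`neg_integral_opL_mul_regDual`). With Q = (|v|²+δ)^((p-2)/2), the density consists of
a gradient term of size |x|^(2-N) Q |∇v|², a zeroth order term f(s)|x|^(-N) Q |v|², and an imaginary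
term with coefficient k = 2-N+2s-c. The other first order terms are radial derivatives against the
divergence free field x|x|^(-N) and integrate to zero.

The real part of the gradient term is at least min(1, p-1) times |x|^(2-N) Q |∇v|² and its imaginary
part at most |p-2| times that. If f(s) > 0, Cauchy–Schwarz absorbs the k-term into the gradient and
zeroth order terms. If f(s) = 0, this is still possible when k = 0, which is the case s = (N-2+c)/2.
For the sign of the real part alone, f(s) ≥ 0 suffices. The constant depends only on p, k and f(s),
so it is the same for all annuli. Letting δ → 0 and closing the graph settles `Lmin`.

Conversely, if f(s) < 0, take v to be a logarithmic cutoff at scale n. Since |x|^(-N) dx is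
invariant under dilations, the gradient term is of order n^(-2) times the measure of a logarithmic
annulus, while the zeroth order term is a fixed negative multiple of a comparable measure. Large n
makes the form negative (`exists_isTest_re_integral_opL_pos`).

The operator on the annulus is reduced to `Lmin`. For u in its domain, the cutoff η_τ u has compact
support in Ω and two weak derivatives, and mollification places it in the graph of `Lmin`. It
remains to show that the commutator of L with η_τ, paired with |u|^(p-1), disappears as τ → 0. After
Young's inequality it is at most a constant times τ^(-2) ∫ (τ^p|∇u|^p + |u|^p) over a layer of width
τ at the boundary. A Hardy inequality (`integral_bdryKernel_le_gradient`), which uses the zero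
boundary values, bounds the layer integral of |u|^p by τ^p times that of |∇u|^p. A trace estimate
(`exists_integral_bdryKernel_le`), which uses the second derivatives, bounds the latter by a
multiple of τ. The error is thus O(τ^(p-1)). Exponential weights in |x|² replace indicator functions
of the layers, so that both estimates follow from the same identity for the field x|x|^(-N) with no
boundary terms. -/

/-- The function `z ↦ z̄ |z|^(p-2)`, which represents the duality map of `L^p`. -/
def dualFun (p : ℝ) (z : ℂ) : ℂ := (starRingEnd ℂ) z * ((‖z‖ ^ (p - 2) : ℝ) : ℂ)

lemma measurable_dualFun (p : ℝ) : Measurable (dualFun p) := by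
  unfold dualFun
  have : Measurable fun z : ℂ => (starRingEnd ℂ) z := Complex.continuous_conj.measurable
  fun_prop

lemma norm_dualFun {p : ℝ} (hp : 1 < p) (z : ℂ) : ‖dualFun p z‖ = ‖z‖ ^ (p - 1) := by
  rcases eq_or_ne z 0 with rfl | hz
  · simp [dualFun, Real.zero_rpow (by linarith : p - 1 ≠ 0)]
  · have h : 0 < ‖z‖ := norm_pos_iff.2 hz
    rw [dualFun, norm_mul, RCLike.norm_conj, Complex.norm_real, Real.norm_of_nonneg (by positivity),
      show p - 1 = 1 + (p - 2) by ring, Real.rpow_add h, Real.rpow_one]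

lemma mul_dualFun {p : ℝ} (hp : 1 < p) (z : ℂ) : z * dualFun p z = ((‖z‖ ^ p : ℝ) : ℂ) := by
  rcases eq_or_ne z 0 with rfl | hz
  · simp [dualFun, Real.zero_rpow (by linarith : p ≠ 0)]
  · have h : 0 < ‖z‖ := norm_pos_iff.2 hz
    rw [dualFun, ← mul_assoc, Complex.mul_conj, Complex.normSq_eq_norm_sq, ← Complex.ofReal_mul]
    congr 1
    rw [← Real.rpow_natCast, ← Real.rpow_add h]
    congr 1
    push_cast; ring

lemma dualFun_real_smul {p : ℝ} (hp : 1 < p) {t : ℝ} (ht : 0 ≤ t) (z : ℂ) :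
    dualFun p (t * z) = ((t ^ (p - 1) : ℝ) : ℂ) * dualFun p z := by
  rcases eq_or_lt_of_le ht with rfl | h
  · simp [dualFun, Real.zero_rpow (by linarith : p - 1 ≠ 0)]
  · simp only [dualFun, map_mul, Complex.conj_ofReal, norm_mul, Complex.norm_real,
      Real.norm_of_nonneg ht]
    rw [Real.mul_rpow ht (norm_nonneg _), show p - 1 = 1 + (p - 2) by ring, Real.rpow_add h,
      Real.rpow_one]
    push_cast
    ring

lemma hasDerivAt_norm_add_mul_rpow {p : ℝ} (hp : 1 < p) (z w : ℂ) (t : ℝ) :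
    HasDerivAt (fun t : ℝ => ‖z + t * w‖ ^ p) (p * (w * dualFun p (z + t * w)).re) t := by
  have h1 : HasDerivAt (fun t : ℝ => z + t * w) w t := by
    simpa using ((hasDerivAt_id t).ofReal_comp.mul_const w).const_add z
  have h2 := (hasFDerivAt_norm_rpow (z + t * w) hp).comp_hasDerivAt t h1
  refine h2.congr_deriv ?_
  change (p * ‖z + t * w‖ ^ (p - 2)) • inner ℝ (z + t * w) w = _
  simp only [dualFun, Complex.inner, smul_eq_mul]
  rw [mul_comm ((starRingEnd ℂ) _) (((_ : ℝ) : ℂ)), mul_left_comm, Complex.re_ofReal_mul,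
    mul_comm w]
  ring

/-- The sharp constants matter: equality holds at a = b, and this contact point is what makes `0` a
minimum in `re_dualityMap_apply`. -/
lemma young_rpow {p : ℝ} (hp : 1 < p) {a b : ℝ} (ha : 0 ≤ a) (hb : 0 ≤ b) :
    a ^ (p - 1) * b ≤ b ^ p / p + (1 - 1 / p) * a ^ p := by
  have hc := Real.HolderConjugate.conjExponent hp
  have h := Real.young_inequality_of_nonneg hb (Real.rpow_nonneg ha (p - 1)) hc
  have hp0 : p ≠ 0 := by linarith
  have hp1 : p - 1 ≠ 0 := by linarith
  rw [← Real.rpow_mul ha, Real.conjExponent, mul_div_cancel₀ _ hp1] at h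
  calc _ = b * a ^ (p - 1) := mul_comm _ _
    _ ≤ _ := h
    _ = _ := by field_simp

/-- The lossy form of Young's inequality, for absorbing mixed terms where constants play no role. -/
lemma mul_rpow_le {p : ℝ} (hp : 1 < p) {a b : ℝ} (ha : 0 ≤ a) (hb : 0 ≤ b) :
    a ^ (p - 1) * b ≤ a ^ p + b ^ p := by
  have h := young_rpow hp ha hb
  have h1 : b ^ p / p ≤ b ^ p := div_le_self (by positivity) hp.le
  have h2 : (1 - 1 / p) * a ^ p ≤ a ^ p := by
    have : 0 ≤ 1 / p * a ^ p := by positivity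
    linarith
  linarith

variable {S : Type*} [MeasurableSpace S] {μ : Measure S} {p : ℝ≥0∞}

lemma integrable_norm_rpow_of_memLp (hp1 : 1 < p) (hp : p ≠ ⊤) {f : S → ℂ} (hf : MemLp f p μ) :
    Integrable (fun x => ‖f x‖ ^ p.toReal) μ :=
  hf.integrable_norm_rpow (by positivity) hp

lemma one_lt_toReal (hp1 : 1 < p) (hp : p ≠ ⊤) : 1 < p.toReal := by
  simpa using (ENNReal.toReal_lt_toReal ENNReal.one_ne_top hp).2 hp1

lemma integrable_mul_dualFun (hp1 : 1 < p) (hp : p ≠ ⊤) {u w : S → ℂ} (hu : MemLp u p μ)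
    (hw : MemLp w p μ) : Integrable (fun x => w x * dualFun p.toReal (u x)) μ := by
  have h1 := one_lt_toReal hp1 hp
  refine ((integrable_norm_rpow_of_memLp hp1 hp hu).add
    (integrable_norm_rpow_of_memLp hp1 hp hw)).mono' ?_ (Eventually.of_forall fun x => ?_)
  · exact hw.1.mul ((measurable_dualFun _).comp_aemeasurable hu.1.aemeasurable).aestronglyMeasurable
  · rw [norm_mul, norm_dualFun h1, mul_comm]
    exact mul_rpow_le h1 (norm_nonneg _) (norm_nonneg _)

/-- For |t| < 1 the derivative of the integrand is at most p(|u|+|w|)^(p-1)|w|, and Young's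
inequality turns this into an integrable bound independent of t. -/
lemma hasDerivAt_integral_norm_add_mul_rpow (hp1 : 1 < p) (hp : p ≠ ⊤) {u w : S → ℂ}
    (hu : MemLp u p μ) (hw : MemLp w p μ) :
    HasDerivAt (fun t : ℝ => ∫ x, ‖u x + t * w x‖ ^ p.toReal ∂μ)
      (p.toReal * (∫ x, w x * dualFun p.toReal (u x) ∂μ).re) 0 := by
  have h1 := one_lt_toReal hp1 hp
  have hmem : ∀ t : ℝ, MemLp (fun x => u x + t * w x) p μ := fun t => hu.add (hw.const_mul _)
  have hb : MemLp (fun x => (((‖u x‖ + ‖w x‖ : ℝ)) : ℂ)) p μ :=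
    (hu.norm.add hw.norm).ofReal
  have key := hasDerivAt_integral_of_dominated_loc_of_deriv_le (μ := μ) (𝕜 := ℝ)
    (F := fun (t : ℝ) x => ‖u x + t * w x‖ ^ p.toReal)
    (F' := fun (t : ℝ) x => p.toReal * (w x * dualFun p.toReal (u x + t * w x)).re)
    (x₀ := 0) (s := Metric.ball 0 1)
    (bound := fun x => p.toReal * (‖(((‖u x‖ + ‖w x‖ : ℝ)) : ℂ)‖ ^ p.toReal + ‖w x‖ ^ p.toReal))
    (Metric.ball_mem_nhds _ one_pos)
    (Eventually.of_forall fun t => (integrable_norm_rpow_of_memLp hp1 hp (hmem t)).1)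
    (integrable_norm_rpow_of_memLp hp1 hp (hmem 0)) ?_ ?_ ?_ ?_
  · refine key.2.congr_deriv ?_
    rw [integral_const_mul]
    simp only [Complex.ofReal_zero, zero_mul, add_zero]
    exact congrArg _ (integral_re (𝕜 := ℂ) (integrable_mul_dualFun hp1 hp hu hw))
  · refine ((Complex.measurable_re.comp_aemeasurable ?_).const_mul _).aestronglyMeasurable
    exact (integrable_mul_dualFun hp1 hp (hmem 0) hw).1.aemeasurable
  · refine Eventually.of_forall fun x t ht => ?_
    rw [norm_mul, Real.norm_of_nonneg (by linarith : (0:ℝ) ≤ p.toReal)]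
    refine mul_le_mul_of_nonneg_left ?_ (by linarith)
    refine (Complex.abs_re_le_norm _).trans ?_
    rw [norm_mul, norm_dualFun h1, mul_comm]
    refine (mul_le_mul_of_nonneg_right (Real.rpow_le_rpow (norm_nonneg _) ?_
      (by linarith : 0 ≤ p.toReal - 1)) (norm_nonneg _)).trans
      (mul_rpow_le h1 (norm_nonneg _) (norm_nonneg _))
    rw [Complex.norm_real, Real.norm_of_nonneg (by positivity)]
    refine (norm_add_le _ _).trans (add_le_add le_rfl ?_)
    rw [norm_mul, Complex.norm_real]
    have : ‖t‖ ≤ 1 := by simpa using (Metric.mem_ball.1 ht).le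
    exact mul_le_of_le_one_left (norm_nonneg _) this
  · exact ((integrable_norm_rpow_of_memLp hp1 hp hb).add
      (integrable_norm_rpow_of_memLp hp1 hp hw)).const_mul _
  · exact Eventually.of_forall fun x t _ => hasDerivAt_norm_add_mul_rpow h1 _ _ t

/-- The pairing `∫ w ū |u|^(p-2)`. -/
def dualPairing (u w : Lp ℂ p μ) : ℂ := ∫ x, w x * dualFun p.toReal (u x) ∂μ

lemma norm_rpow_eq_integral (hp1 : 1 < p) (hp : p ≠ ⊤) (u : Lp ℂ p μ) :
    ‖u‖ ^ p.toReal = ∫ x, ‖u x‖ ^ p.toReal ∂μ := by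
  have h1 := one_lt_toReal hp1 hp
  rw [Lp.norm_def, (Lp.memLp u).eLpNorm_eq_integral_rpow_norm (by positivity) hp,
    ENNReal.toReal_ofReal (by positivity), ← Real.rpow_mul (by positivity),
    inv_mul_cancel₀ (by linarith), Real.rpow_one]

lemma dualPairing_smul (u w : Lp ℂ p μ) (z : ℂ) : dualPairing u (z • w) = z * dualPairing u w := by
  rw [dualPairing, dualPairing, ← integral_const_mul]
  refine integral_congr_ae ?_
  filter_upwards [Lp.coeFn_smul z w] with x h
  rw [h]; simp [mul_assoc]

lemma norm_add_smul_rpow_eq_integral (hp1 : 1 < p) (hp : p ≠ ⊤) (u w : Lp ℂ p μ) (t : ℝ) :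
    ‖u + (t : ℂ) • w‖ ^ p.toReal = ∫ x, ‖u x + t * w x‖ ^ p.toReal ∂μ := by
  rw [norm_rpow_eq_integral hp1 hp]
  refine integral_congr_ae ?_
  filter_upwards [Lp.coeFn_add u ((t : ℂ) • w), Lp.coeFn_smul (t : ℂ) w] with x h1 h2
  rw [h1, Pi.add_apply, h2]
  simp

lemma hasDerivAt_norm_add_smul_rpow (hp1 : 1 < p) (hp : p ≠ ⊤) (u w : Lp ℂ p μ) :
    HasDerivAt (fun t : ℝ => ‖u + (t : ℂ) • w‖ ^ p.toReal) (p.toReal * (dualPairing u w).re) 0 := by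
  simp_rw [norm_add_smul_rpow_eq_integral hp1 hp]
  exact hasDerivAt_integral_norm_add_mul_rpow hp1 hp (Lp.memLp u) (Lp.memLp w)

variable [Fact (1 ≤ p)]

/-- Since |φ(u+tw)| ≤ ‖u‖‖u+tw‖, Young's inequality shows that t ↦ ‖u+tw‖^p/p - t‖u‖^(p-2) Re φ(w)
has a minimum at t = 0. Its derivative there must vanish, and this determines Re φ(w). -/
lemma re_dualityMap_apply (hp1 : 1 < p) (hp : p ≠ ⊤) {u : Lp ℂ p μ} (hu : u ≠ 0) (w : Lp ℂ p μ)
    {φ : StrongDual ℂ (Lp ℂ p μ)} (hφ : φ ∈ dualityMap u) :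
    ‖u‖ ^ (p.toReal - 2) * (φ w).re = (dualPairing u w).re := by
  have h1 := one_lt_toReal hp1 hp
  set q := p.toReal
  have hn : 0 < ‖u‖ := norm_pos_iff.2 hu
  obtain ⟨h2, h3⟩ := hφ
  have hle : ∀ t : ℝ, ‖u‖ ^ q + t * (‖u‖ ^ (q - 2) * (φ w).re) ≤
      ‖u + (t : ℂ) • w‖ ^ q / q + (1 - 1 / q) * ‖u‖ ^ q := by
    intro t
    have h4 : ‖u‖ ^ 2 + t * (φ w).re ≤ ‖u‖ * ‖u + (t : ℂ) • w‖ := by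
      have := (Complex.re_le_norm _).trans (φ.le_opNorm (u + (t : ℂ) • w))
      rw [h3, map_add, map_smul, h2, smul_eq_mul, Complex.add_re, Complex.ofReal_re,
        Complex.re_ofReal_mul] at this
      exact this
    have h5 := mul_le_mul_of_nonneg_left h4 (Real.rpow_nonneg hn.le (q - 2))
    have h6 : ‖u‖ ^ (q - 2) * ‖u‖ ^ 2 = ‖u‖ ^ q := by
      rw [← Real.rpow_natCast, ← Real.rpow_add hn]; congr 1; push_cast; ring
    have h7 : ‖u‖ ^ (q - 2) * ‖u‖ = ‖u‖ ^ (q - 1) := by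
      rw [← Real.rpow_add_one hn.ne']; congr 1; ring
    rw [mul_add, h6, ← mul_assoc _ ‖u‖, h7] at h5
    have h8 := young_rpow h1 hn.le (norm_nonneg (u + (t : ℂ) • w))
    linarith
  have hd := ((hasDerivAt_norm_add_smul_rpow hp1 hp u w).div_const q).sub
    ((hasDerivAt_id (0 : ℝ)).mul_const (‖u‖ ^ (q - 2) * (φ w).re))
  have hmin : IsLocalMin ((fun t : ℝ => ‖u + (t : ℂ) • w‖ ^ q / q) -
      fun t : ℝ => id t * (‖u‖ ^ (q - 2) * (φ w).re)) 0 := by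
    refine Eventually.of_forall fun t => ?_
    have := hle t
    simp only [Pi.sub_apply, Complex.ofReal_zero, zero_smul, add_zero, id, zero_mul, sub_zero]
    have h9 : (1 - 1 / q) * ‖u‖ ^ q = ‖u‖ ^ q - ‖u‖ ^ q / q := by ring
    linarith
  have h0 := hmin.hasDerivAt_eq_zero hd
  have hq : q ≠ 0 := by linarith
  change q * (dualPairing u w).re / q - 1 * (‖u‖ ^ (q - 2) * (φ w).re) = 0 at h0
  rw [mul_div_cancel_left₀ _ hq] at h0
  linarith

/-- The imaginary part is read off from the real part by replacing w with iw. -/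
lemma dualityMap_apply (hp1 : 1 < p) (hp : p ≠ ⊤) {u : Lp ℂ p μ} (hu : u ≠ 0) (w : Lp ℂ p μ)
    {φ : StrongDual ℂ (Lp ℂ p μ)} (hφ : φ ∈ dualityMap u) :
    ((‖u‖ ^ (p.toReal - 2) : ℝ) : ℂ) * φ w = dualPairing u w := by
  apply Complex.ext
  · rw [Complex.re_ofReal_mul]; exact re_dualityMap_apply hp1 hp hu w hφ
  · have h := re_dualityMap_apply hp1 hp hu (Complex.I • w) hφ
    rw [map_smul, dualPairing_smul, smul_eq_mul, Complex.I_mul_re, Complex.I_mul_re] at h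
    rw [Complex.im_ofReal_mul]
    linarith

/-- Forward: the tangent inequality for the convex function |·|^p, integrated, gives ‖u - w/t‖ ≥
‖u‖. Backward: this norm inequality says that τ ↦ ‖u+τw‖^p has nonpositive difference quotients for
τ < 0, so its derivative at `0` is nonpositive. -/
lemma re_dualPairing_nonpos_iff (hp1 : 1 < p) (hp : p ≠ ⊤) (u w : Lp ℂ p μ) :
    (dualPairing u w).re ≤ 0 ↔ ∀ t : ℝ, 0 < t → t * ‖u‖ ≤ ‖(t : ℂ) • u - w‖ := by
  have h1 := one_lt_toReal hp1 hp
  constructor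
  · intro h t ht
    have h2 : ‖u‖ ^ p.toReal ≤ ‖u + ((-t⁻¹ : ℝ) : ℂ) • w‖ ^ p.toReal := by
      rw [norm_add_smul_rpow_eq_integral hp1 hp, norm_rpow_eq_integral hp1 hp]
      have hi := integrable_mul_dualFun hp1 hp (Lp.memLp u) (Lp.memLp w)
      have hre : ∫ x, (w x * dualFun p.toReal (u x)).re ∂μ = (dualPairing u w).re :=
        integral_re (𝕜 := ℂ) hi
      have h3 : ∫ x, (‖u x‖ ^ p.toReal +
          (-t⁻¹ * p.toReal) * (w x * dualFun p.toReal (u x)).re) ∂μ ≤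
          ∫ x, ‖u x + ((-t⁻¹ : ℝ) : ℂ) * w x‖ ^ p.toReal ∂μ := by
        refine integral_mono ((integrable_norm_rpow_of_memLp hp1 hp (Lp.memLp u)).add
          (hi.re.const_mul _)) (integrable_norm_rpow_of_memLp hp1 hp
          ((Lp.memLp u).add ((Lp.memLp w).const_mul _))) fun x => ?_
        have h4 := young_rpow h1 (norm_nonneg (u x)) (norm_nonneg (u x + ((-t⁻¹ : ℝ) : ℂ) * w x))
        have h5 := Complex.re_le_norm ((u x + ((-t⁻¹ : ℝ) : ℂ) * w x) * dualFun p.toReal (u x))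
        rw [norm_mul, norm_dualFun h1, add_mul, mul_dualFun h1, mul_assoc, Complex.add_re,
          Complex.ofReal_re, Complex.re_ofReal_mul] at h5
        rw [mul_comm] at h4
        have h6 := h5.trans h4
        have hp0 : 0 < p.toReal := by linarith
        have h7 := mul_le_mul_of_nonneg_left h6 hp0.le
        have h8 : p.toReal * (‖u x + ((-t⁻¹ : ℝ) : ℂ) * w x‖ ^ p.toReal / p.toReal +
          (1 - 1 / p.toReal) * ‖u x‖ ^ p.toReal) = ‖u x + ((-t⁻¹ : ℝ) : ℂ) * w x‖ ^ p.toReal +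
          (p.toReal - 1) * ‖u x‖ ^ p.toReal := by field_simp
        rw [h8] at h7
        simp only
        linarith
      have hi' : Integrable (fun x => (w x * dualFun p.toReal (u x)).re) μ := hi.re
      rw [integral_add (integrable_norm_rpow_of_memLp hp1 hp (Lp.memLp u))
          (hi'.const_mul _), integral_const_mul, hre] at h3
      have h9 : 0 ≤ (-t⁻¹ * p.toReal) * (dualPairing u w).re := by
        have : 0 < t⁻¹ := by positivity
        exact mul_nonneg_of_nonpos_of_nonpos (by nlinarith) h
      linarith
    have h10 := (Real.rpow_le_rpow_iff (norm_nonneg _) (norm_nonneg _) (by linarith)).1 h2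
    have h11 : (t : ℂ) • u - w = (t : ℂ) • (u + ((-t⁻¹ : ℝ) : ℂ) • w) := by
      have : (t : ℂ) ≠ 0 := by exact_mod_cast ht.ne'
      rw [smul_add, smul_smul]
      push_cast
      rw [mul_neg, mul_inv_cancel₀ this, neg_one_smul, sub_eq_add_neg]
    rw [h11, norm_smul, Complex.norm_real, Real.norm_of_nonneg ht.le]
    exact mul_le_mul_of_nonneg_left h10 ht.le
  · intro h
    by_contra! hpos
    have hd := hasDerivAt_norm_add_smul_rpow hp1 hp u w
    have hslope := (hasDerivAt_iff_tendsto_slope.1 hd).mono_left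
      (nhdsWithin_mono (0 : ℝ) (fun t (ht : t ∈ Set.Iio (0 : ℝ)) => ht.ne))
    have hle : p.toReal * (dualPairing u w).re ≤ 0 := by
      refine le_of_tendsto hslope ?_
      filter_upwards [self_mem_nhdsWithin] with t (ht : t < 0)
      rw [slope_def_field]
      refine div_nonpos_of_nonneg_of_nonpos ?_ (by linarith)
      rw [sub_nonneg]
      refine Real.rpow_le_rpow (norm_nonneg _) ?_ (by linarith)
      have h2 := h (-t⁻¹) (by simpa using ht)
      have h3 : u + (t : ℂ) • w = ((-t : ℝ) : ℂ) • (((-t⁻¹ : ℝ) : ℂ) • u - w) := by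
        have : (t : ℂ) ≠ 0 := by exact_mod_cast ht.ne
        rw [smul_sub, smul_smul]
        push_cast
        rw [neg_mul_neg, mul_inv_cancel₀ this, one_smul, neg_smul, sub_neg_eq_add]
      rw [h3, norm_smul, Complex.norm_real, Real.norm_of_nonneg (by linarith)]
      have h4 := mul_le_mul_of_nonneg_left h2 (by linarith : 0 ≤ -t)
      have h5 : -t * (-t⁻¹ * ‖u‖) = ‖u‖ := by
        rw [← mul_assoc, neg_mul_neg, mul_inv_cancel₀ ht.ne, one_mul]
      rw [h5] at h4
      simpa using h4
    have : 0 < p.toReal * (dualPairing u w).re := by positivity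
    linarith

/-- The closed sector `{z : 0 ≤ Re z, |Im z| ≤ l Re z}`. -/
def sector (l : ℝ) : Set ℂ := {z | 0 ≤ z.re ∧ |z.im| ≤ l * z.re}

lemma isClosed_sector (l : ℝ) : IsClosed (sector l) :=
  (isClosed_le continuous_const Complex.continuous_re).inter
    (isClosed_le (Complex.continuous_im.abs) (Complex.continuous_re.const_mul l))

/-- The sector is an intersection of half planes Re(ζz) ≥ 0. This is the shape in which membership
can be expressed by dissipativity-type norm inequalities. -/
lemma mem_sector_iff {l : ℝ} {z : ℂ} : z ∈ sector l ↔
    0 ≤ z.re ∧ 0 ≤ ((l + Complex.I) * z).re ∧ 0 ≤ ((l - Complex.I) * z).re := by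
  have h1 : ((l + Complex.I) * z).re = l * z.re - z.im := by simp
  have h2 : ((l - Complex.I) * z).re = l * z.re + z.im := by simp
  rw [h1, h2, sector, Set.mem_ofPred_eq, abs_le]
  constructor <;> rintro ⟨h, h', h''⟩ <;> refine ⟨h, ?_, ?_⟩ <;> linarith

lemma real_mul_mem_sector {l t : ℝ} (ht : 0 ≤ t) {z : ℂ} (hz : z ∈ sector l) :
    (t : ℂ) * z ∈ sector l := by
  obtain ⟨h1, h2⟩ := hz
  refine ⟨?_, ?_⟩
  · rw [Complex.re_ofReal_mul]; positivity
  · rw [Complex.re_ofReal_mul, Complex.im_ofReal_mul, abs_mul, abs_of_nonneg ht]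
    nlinarith

lemma integral_mem_sector {l : ℝ} {T : S → ℂ} (hT : Integrable T μ)
    (h : ∀ x, T x ∈ sector l) : ∫ x, T x ∂μ ∈ sector l := by
  have hre : ∫ x, (T x).re ∂μ = (∫ x, T x ∂μ).re := by simpa using integral_re (𝕜 := ℂ) hT
  have him : ∫ x, (T x).im ∂μ = (∫ x, T x ∂μ).im := by simpa using integral_im (𝕜 := ℂ) hT
  refine ⟨?_, ?_⟩
  · rw [← hre]; exact integral_nonneg fun x => (h x).1
  · rw [← hre, ← him, ← integral_const_mul]
    exact abs_integral_le_integral_abs.trans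
      (integral_mono hT.im.abs (hT.re.const_mul l) fun x => (h x).2)

lemma isSectorialWith_of_dualPairing (hp1 : 1 < p) (hp : p ≠ ⊤) {A : Set (Lp ℂ p μ × Lp ℂ p μ)}
    {l : ℝ} (hl : 0 ≤ l) (h : ∀ u w, (u, w) ∈ A → -dualPairing u w ∈ sector l) :
    IsSectorialWith A l := by
  refine ⟨hl, fun u w huw φ hφ => ?_⟩
  rcases eq_or_ne u 0 with rfl | hu
  · have : φ = 0 := by simpa using hφ.2
    simp [this]
  · have hn : 0 < ‖u‖ := norm_pos_iff.2 hu
    have h1 := dualityMap_apply hp1 hp hu w hφ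
    have h2 : φ (-w) = ((‖u‖ ^ (p.toReal - 2) : ℝ)⁻¹ : ℝ) * (-dualPairing u w) := by
      have : ((‖u‖ ^ (p.toReal - 2) : ℝ) : ℂ) ≠ 0 := by
        exact_mod_cast (Real.rpow_pos_of_pos hn _).ne'
      rw [map_neg, ← h1]
      push_cast
      field_simp
    rw [h2]
    exact real_mul_mem_sector (by positivity) (h u w huw)

/-- The condition is an intersection over t > 0 of norm inequalities that are visibly closed in (u,
w), so no continuity of the nonlinear map u ↦ ū|u|^(p-2) is needed. -/
lemma isClosed_dualPairing_re_nonpos (hp1 : 1 < p) (hp : p ≠ ⊤) (z : ℂ) :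
    IsClosed {q : Lp ℂ p μ × Lp ℂ p μ | (z * dualPairing q.1 q.2).re ≤ 0} := by
  have : {q : Lp ℂ p μ × Lp ℂ p μ | (z * dualPairing q.1 q.2).re ≤ 0} =
      ⋂ t : ℝ, ⋂ _ : 0 < t, {q | t * ‖q.1‖ ≤ ‖(t : ℂ) • q.1 - z • q.2‖} := by
    ext q
    simp only [Set.mem_ofPred_eq, Set.mem_iInter, ← dualPairing_smul,
      re_dualPairing_nonpos_iff hp1 hp]
  rw [this]
  refine isClosed_iInter fun t => isClosed_iInter fun _ => ?_
  exact isClosed_le (by fun_prop) (by fun_prop)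

lemma isClosed_dualPairing_sector (hp1 : 1 < p) (hp : p ≠ ⊤) (l : ℝ) :
    IsClosed {q : Lp ℂ p μ × Lp ℂ p μ | -dualPairing q.1 q.2 ∈ sector l} := by
  have : {q : Lp ℂ p μ × Lp ℂ p μ | -dualPairing q.1 q.2 ∈ sector l} =
      {q | ((1 : ℂ) * dualPairing q.1 q.2).re ≤ 0} ∩
      ({q | ((l + Complex.I) * dualPairing q.1 q.2).re ≤ 0} ∩
      {q | ((l - Complex.I) * dualPairing q.1 q.2).re ≤ 0}) := by
    ext q
    simp only [Set.mem_ofPred_eq, mem_sector_iff, Set.mem_inter_iff, mul_neg, Complex.neg_re,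
      Left.nonneg_neg_iff, one_mul]
  rw [this]
  exact (isClosed_dualPairing_re_nonpos hp1 hp _).inter
    ((isClosed_dualPairing_re_nonpos hp1 hp _).inter (isClosed_dualPairing_re_nonpos hp1 hp _))

lemma isDissipative_iff_dualPairing (hp1 : 1 < p) (hp : p ≠ ⊤) (A : Set (Lp ℂ p μ × Lp ℂ p μ)) :
    IsDissipative A ↔ ∀ u w, (u, w) ∈ A → (dualPairing u w).re ≤ 0 := by
  simp only [IsDissipative, re_dualPairing_nonpos_iff hp1 hp]

end Duality

/-! ### Integration by parts on `ℝ^N` -/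

section Parts

variable {N : ℕ} {G : Type*} [NormedAddCommGroup G] [NormedSpace ℝ G]

lemma integrable_of_continuousOn_compact {F : Type*} [NormedAddCommGroup F] {h : E N → F}
    {K : Set (E N)} (hK : IsCompact K)
    (hc : ContinuousOn h K) (h0 : ∀ x ∉ K, h x = 0) : Integrable h := by
  rw [← integrableOn_iff_integrable_of_support_subset (s := K)]
  · exact hc.integrableOn_compact hK
  · intro x hx
    by_contra hxK
    exact hx (h0 x hxK)

lemma fderiv_eq_zero_of_notMem_tsupport {F : Type*} [NormedAddCommGroup F] [NormedSpace ℝ F]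
    {g : E N → F} {x : E N} (hx : x ∉ tsupport g) :
    fderiv ℝ g x = 0 :=
  image_eq_zero_of_notMem_tsupport fun h => hx (tsupport_fderiv_subset ℝ h)

lemma hasFDerivAt_norm_rpow_of_ne_zero {x : E N} (hx : x ≠ 0) (a : ℝ) :
    HasFDerivAt (fun y : E N => ‖y‖ ^ a) ((a * ‖x‖ ^ (a - 2)) • innerSL ℝ x) x := by
  have hn : 0 < ‖x‖ := norm_pos_iff.2 hx
  have h1 := (hasStrictFDerivAt_norm_sq x).hasFDerivAt
  have h2 := h1.rpow_const (p := a / 2) (Or.inl (by positivity))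
  have h3 : (fun y : E N => ‖y‖ ^ a) = fun y : E N => (‖y‖ ^ 2) ^ (a / 2) := by
    ext y
    rw [← Real.rpow_natCast, ← Real.rpow_mul (norm_nonneg _)]
    congr 1; push_cast; ring
  rw [h3]
  refine h2.congr_fderiv ?_
  ext y
  change (a / 2 * (‖x‖ ^ 2) ^ (a / 2 - 1)) • ((2 : ℕ) • inner ℝ x y) =
    (a * ‖x‖ ^ (a - 2)) • inner ℝ x y
  rw [← Real.rpow_natCast ‖x‖ 2, ← Real.rpow_mul (norm_nonneg _),
    show ((2 : ℕ) : ℝ) * (a / 2 - 1) = a - 2 by push_cast; ring]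
  simp only [smul_eq_mul, nsmul_eq_mul]
  push_cast; ring

lemma contDiffAt_norm_rpow {x : E N} (hx : x ≠ 0) (a : ℝ) {n : WithTop ℕ∞} :
    ContDiffAt ℝ n (fun y : E N => ‖y‖ ^ a) x :=
  (contDiffAt_norm ℝ hx).rpow_const_of_ne (norm_ne_zero_iff.2 hx)

lemma sum_coord_smul_single (x : E N) : ∑ i, x i • EuclideanSpace.single i (1 : ℝ) = x := by
  simpa using (EuclideanSpace.basisFun (Fin N) ℝ).sum_repr x

lemma sum_coord_smul_map (L : E N →L[ℝ] G) (x : E N) :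
    ∑ i, x i • L (EuclideanSpace.single i 1) = L x := by
  conv_rhs => rw [← sum_coord_smul_single x]
  simp

lemma inner_single_right (x : E N) (i : Fin N) :
    inner ℝ x (EuclideanSpace.single i (1 : ℝ)) = x i := by
  simp [EuclideanSpace.inner_single_right]

lemma sum_coord_sq (x : E N) : ∑ i, x i ^ 2 = ‖x‖ ^ 2 := by
  rw [EuclideanSpace.norm_sq_eq]; simp

/-- The field `x |x|^(-N)` is divergence free away from the origin. -/
lemma integral_norm_rpow_smul_radial_eq_zero {g : E N → G} (hg : ContDiff ℝ 1 g)
    (hc : HasCompactSupport g) (h0 : (0 : E N) ∉ tsupport g) :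
    ∫ x, ‖x‖ ^ (-(N : ℝ)) • fderiv ℝ g x x = 0 := by
  set f : Fin N → E N → ℝ := fun i x => x i * ‖x‖ ^ (-(N : ℝ))
  have hne : ∀ x ∈ tsupport g, x ≠ 0 := fun x hx h => h0 (h ▸ hx)
  have hf : ∀ i x, x ≠ 0 → HasFDerivAt (f i)
      (x i • ((-(N : ℝ) * ‖x‖ ^ (-(N : ℝ) - 2)) • innerSL ℝ x) +
        ‖x‖ ^ (-(N : ℝ)) • (EuclideanSpace.proj i : E N →L[ℝ] ℝ)) x := by
    intro i x hx
    exact ((EuclideanSpace.proj i : E N →L[ℝ] ℝ).hasFDerivAt).mul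
      (hasFDerivAt_norm_rpow_of_ne_zero hx _)
  have hfd : ∀ i x, x ≠ 0 → fderiv ℝ (f i) x (EuclideanSpace.single i 1) =
      -(N : ℝ) * ‖x‖ ^ (-(N : ℝ) - 2) * x i ^ 2 + ‖x‖ ^ (-(N : ℝ)) := by
    intro i x hx
    rw [(hf i x hx).fderiv]
    change x i • ((-(N : ℝ) * ‖x‖ ^ (-(N : ℝ) - 2)) • inner ℝ x (EuclideanSpace.single i (1 : ℝ))) +
      ‖x‖ ^ (-(N : ℝ)) • (EuclideanSpace.single i (1 : ℝ) : E N) i = _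
    rw [inner_single_right]
    simp only [smul_eq_mul, PiLp.single_apply, if_true]
    ring
  have hfc : ∀ i, ContinuousOn (f i) (tsupport g) := fun i x hx =>
    (hf i x (hne x hx)).continuousAt.continuousWithinAt
  have hdc : ∀ i, ContinuousOn (fun x => fderiv ℝ (f i) x (EuclideanSpace.single i 1))
      (tsupport g) := by
    intro i
    refine ContinuousOn.congr (f := fun x => -(N : ℝ) * ‖x‖ ^ (-(N : ℝ) - 2) * x i ^ 2 +
      ‖x‖ ^ (-(N : ℝ))) ?_ fun x hx => hfd i x (hne x hx)
    have : ∀ a : ℝ, ContinuousOn (fun x : E N => ‖x‖ ^ a) (tsupport g) := fun a =>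
      continuous_norm.continuousOn.rpow_const fun x hx => Or.inl (norm_ne_zero_iff.2 (hne x hx))
    have h2 : ContinuousOn (fun x : E N => x i ^ 2) (tsupport g) :=
      ((EuclideanSpace.proj i : E N →L[ℝ] ℝ).continuous.pow 2).continuousOn
    exact ((continuousOn_const.mul (this _)).mul h2).add (this _)
  have hgd : ∀ v, Continuous fun x => fderiv ℝ g x v := fun v =>
    (hg.continuous_fderiv one_ne_zero).clm_apply continuous_const
  have i1 : ∀ i, Integrable fun x => fderiv ℝ (f i) x (EuclideanSpace.single i 1) • g x :=
    fun i => integrable_of_continuousOn_compact hc ((hdc i).smul hg.continuous.continuousOn)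
      fun x hx => by simp [image_eq_zero_of_notMem_tsupport hx]
  have i2 : ∀ i, Integrable fun x => f i x • fderiv ℝ g x (EuclideanSpace.single i 1) :=
    fun i => integrable_of_continuousOn_compact hc ((hfc i).smul (hgd _).continuousOn)
      fun x hx => by simp [fderiv_eq_zero_of_notMem_tsupport hx]
  have i3 : ∀ i, Integrable fun x => f i x • g x :=
    fun i => integrable_of_continuousOn_compact hc ((hfc i).smul hg.continuous.continuousOn)
      fun x hx => by simp [image_eq_zero_of_notMem_tsupport hx]
  have key : ∀ i, ∫ x, f i x • fderiv ℝ g x (EuclideanSpace.single i 1) =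
      -∫ x, fderiv ℝ (f i) x (EuclideanSpace.single i 1) • g x := fun i =>
    integral_smul_fderiv_eq_neg_fderiv_smul_of_integrable (i1 i) (i2 i) (i3 i)
      (fun x hx => (hf i x (hne x hx)).differentiableAt)
      (fun x _ => (hg.differentiable one_ne_zero) x)
  calc ∫ x, ‖x‖ ^ (-(N : ℝ)) • fderiv ℝ g x x
      = ∫ x, ∑ i, f i x • fderiv ℝ g x (EuclideanSpace.single i 1) := by
        congr 1; ext x
        rw [← sum_coord_smul_map (fderiv ℝ g x) x, Finset.smul_sum]
        refine Finset.sum_congr rfl fun i _ => ?_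
        rw [smul_smul, mul_comm]
    _ = ∑ i, ∫ x, f i x • fderiv ℝ g x (EuclideanSpace.single i 1) :=
        integral_finsetSum _ fun i _ => i2 i
    _ = -∫ x, ∑ i, fderiv ℝ (f i) x (EuclideanSpace.single i 1) • g x := by
        rw [integral_finsetSum _ fun i _ => i1 i, ← Finset.sum_neg_distrib]
        exact Finset.sum_congr rfl fun i _ => key i
    _ = -∫ _ : E N, (0 : G) := by
        congr 2; ext x
        by_cases hx : x ∈ tsupport g
        · rw [← Finset.sum_smul]
          have hx0 := hne x hx
          have : ∑ i, fderiv ℝ (f i) x (EuclideanSpace.single i 1) = 0 := by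
            simp_rw [hfd _ x hx0]
            rw [Finset.sum_add_distrib, ← Finset.mul_sum, sum_coord_sq]
            have hn : 0 < ‖x‖ := norm_pos_iff.2 hx0
            rw [mul_assoc, ← Real.rpow_natCast ‖x‖ 2, ← Real.rpow_add hn]
            simp
          rw [this, zero_smul]
        · simp [image_eq_zero_of_notMem_tsupport hx]
    _ = 0 := by simp

lemma laplacian_eq_sum_partialD {u : E N → ℂ} (hu : ContDiff ℝ 2 u) (x : E N) :
    Laplacian.laplacian u x = ∑ i, partialD i (partialD i u) x := by
  rw [InnerProductSpace.laplacian_eq_iteratedFDeriv_orthonormalBasis u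
    (EuclideanSpace.basisFun (Fin N) ℝ)]
  refine Finset.sum_congr rfl fun i _ => ?_
  rw [iteratedFDeriv_two_apply]
  have hd : DifferentiableAt ℝ (fderiv ℝ u) x :=
    (hu.fderiv_right (m := 1) (by norm_num)).differentiable one_ne_zero x
  simp only [partialD, Matrix.cons_val_zero, Matrix.cons_val_one, EuclideanSpace.basisFun_apply]
  have h : partialD i u = fun y => fderiv ℝ u y (EuclideanSpace.single i 1) := rfl
  rw [h, fderiv_clm_apply hd (differentiableAt_const _)]
  simp

lemma contDiff_partialD {u : E N → ℂ} {m n : WithTop ℕ∞} (hu : ContDiff ℝ n u) (h : m + 1 ≤ n)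
    (i : Fin N) : ContDiff ℝ m (partialD i u) :=
  (hu.fderiv_right h).clm_apply contDiff_const

lemma tsupport_partialD_subset (i : Fin N) (u : E N → ℂ) : tsupport (partialD i u) ⊆ tsupport u := by
  refine closure_minimal (fun x hx => ?_) (isClosed_tsupport _)
  by_contra h
  exact hx (by simp [partialD, fderiv_eq_zero_of_notMem_tsupport h])

lemma integral_mul_partialD {f g : E N → ℂ} (hf : ContDiff ℝ 1 f) (hg : ContDiff ℝ 1 g)
    (hc : HasCompactSupport g) (i : Fin N) :
    ∫ x, f x * partialD i g x = -∫ x, partialD i f x * g x := by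
  have hfd := contDiff_partialD (m := 0) hf (by norm_num) i
  have hgd := contDiff_partialD (m := 0) hg (by norm_num) i
  refine integral_mul_fderiv_eq_neg_fderiv_mul_of_integrable ?_ ?_ ?_
    (fun x _ => hf.differentiable one_ne_zero x) (fun x _ => hg.differentiable one_ne_zero x)
  · exact integrable_of_continuousOn_compact hc (hfd.continuous.mul hg.continuous).continuousOn
      fun x hx => by simp [image_eq_zero_of_notMem_tsupport hx]
  · exact integrable_of_continuousOn_compact hc (hf.continuous.mul hgd.continuous).continuousOn
      fun x hx => by simp [fderiv_eq_zero_of_notMem_tsupport hx]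
  · exact integrable_of_continuousOn_compact hc (hf.continuous.mul hg.continuous).continuousOn
      fun x hx => by simp [image_eq_zero_of_notMem_tsupport hx]

lemma integral_laplacian_mul {u g : E N → ℂ} (hu : ContDiff ℝ 2 u) (hg : ContDiff ℝ 1 g)
    (hc : HasCompactSupport g) :
    ∫ x, Laplacian.laplacian u x * g x = -∫ x, ∑ i, partialD i u x * partialD i g x := by
  have hui : ∀ i, ContDiff ℝ 1 (partialD i u) := fun i => contDiff_partialD hu (by norm_num) i
  have hu1 : ∀ i, ContDiff ℝ 0 (partialD i (partialD i u)) := fun i =>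
    contDiff_partialD (hui i) (by norm_num) i
  have hg1 : ∀ i, ContDiff ℝ 0 (partialD i g) := fun i =>
    contDiff_partialD hg (by norm_num) i
  simp_rw [laplacian_eq_sum_partialD hu, Finset.sum_mul]
  rw [integral_finsetSum, integral_finsetSum, ← Finset.sum_neg_distrib]
  · refine Finset.sum_congr rfl fun i _ => ?_
    rw [integral_mul_partialD (hui i) hg hc i, neg_neg]
  · intro i _
    exact integrable_of_continuousOn_compact hc ((hui i).continuous.mul (hg1 i).continuous).continuousOn
      fun x hx => by simp [partialD, fderiv_eq_zero_of_notMem_tsupport hx]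
  · intro i _
    exact integrable_of_continuousOn_compact hc ((hu1 i).continuous.mul hg.continuous).continuousOn
      fun x hx => by simp [image_eq_zero_of_notMem_tsupport hx]

end Parts

/-! ### The regularized form of the operator on test functions -/

section Form

/-- The smooth approximation `z̄ (|z|² + δ)^((p-2)/2)` of `z̄ |z|^(p-2)`. -/
def regDual (p δ : ℝ) (z : ℂ) : ℂ :=
  (starRingEnd ℂ) z * (((‖z‖ ^ 2 + δ) ^ ((p - 2) / 2) : ℝ) : ℂ)

/-- The smooth approximation `(|z|² + δ)^(p/2) - δ^(p/2)` of `|z|^p`. -/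
def regPow (p δ : ℝ) (z : ℂ) : ℝ := (‖z‖ ^ 2 + δ) ^ (p / 2) - δ ^ (p / 2)

lemma contDiff_norm_sq_add_rpow {δ : ℝ} (hδ : 0 < δ) (a : ℝ) {n : WithTop ℕ∞} :
    ContDiff ℝ n fun z : ℂ => (‖z‖ ^ 2 + δ) ^ a :=
  ((contDiff_norm_sq ℝ).add contDiff_const).rpow_const_of_ne fun z => by positivity

lemma contDiff_regDual {δ : ℝ} (hδ : 0 < δ) (p : ℝ) {n : WithTop ℕ∞} :
    ContDiff ℝ n (regDual p δ) :=
  (Complex.conjCLE.contDiff).mul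
    (Complex.ofRealCLM.contDiff.comp (contDiff_norm_sq_add_rpow hδ _))

lemma contDiff_regPow {δ : ℝ} (hδ : 0 < δ) (p : ℝ) {n : WithTop ℕ∞} :
    ContDiff ℝ n (regPow p δ) :=
  (contDiff_norm_sq_add_rpow hδ _).sub contDiff_const

lemma regDual_zero (p δ : ℝ) : regDual p δ 0 = 0 := by simp [regDual]

lemma regPow_zero (p δ : ℝ) : regPow p δ 0 = 0 := by simp [regPow]

lemma hasFDerivAt_norm_sq_add_rpow {δ : ℝ} (hδ : 0 < δ) (a : ℝ) (z : ℂ) :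
    HasFDerivAt (fun z : ℂ => (‖z‖ ^ 2 + δ) ^ a)
      ((a * (‖z‖ ^ 2 + δ) ^ (a - 1)) • ((2 : ℕ) • innerSL ℝ z)) z :=
  ((hasStrictFDerivAt_norm_sq z).hasFDerivAt.add_const δ).rpow_const (Or.inl (by positivity))

lemma fderiv_regPow {δ : ℝ} (hδ : 0 < δ) (p : ℝ) (z w : ℂ) :
    fderiv ℝ (regPow p δ) z w =
      p * (‖z‖ ^ 2 + δ) ^ ((p - 2) / 2) * ((starRingEnd ℂ) z * w).re := by
  have h : HasFDerivAt (regPow p δ) _ z :=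
    (hasFDerivAt_norm_sq_add_rpow hδ (p / 2) z).sub_const (δ ^ (p / 2))
  rw [h.fderiv]
  change (p / 2 * (‖z‖ ^ 2 + δ) ^ (p / 2 - 1)) • ((2 : ℕ) • inner ℝ z w) = _
  rw [Complex.inner, show p / 2 - 1 = (p - 2) / 2 by ring]
  simp only [smul_eq_mul, nsmul_eq_mul]
  push_cast; ring_nf

lemma fderiv_regDual {δ : ℝ} (hδ : 0 < δ) (p : ℝ) (z w : ℂ) :
    fderiv ℝ (regDual p δ) z w =
      (((‖z‖ ^ 2 + δ) ^ ((p - 2) / 2) : ℝ) : ℂ) * ((starRingEnd ℂ) w +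
        (starRingEnd ℂ) z * (((p - 2) / (‖z‖ ^ 2 + δ) * ((starRingEnd ℂ) z * w).re : ℝ) : ℂ)) := by
  have h1 : HasFDerivAt (fun z : ℂ => (starRingEnd ℂ) z)
      (Complex.conjCLE : ℂ ≃L[ℝ] ℂ).toContinuousLinearMap z :=
    (Complex.conjCLE : ℂ ≃L[ℝ] ℂ).toContinuousLinearMap.hasFDerivAt
  have h2 := Complex.ofRealCLM.hasFDerivAt.comp z
    (hasFDerivAt_norm_sq_add_rpow hδ ((p - 2) / 2) z)
  have h : HasFDerivAt (regDual p δ) _ z := h1.mul h2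
  rw [h.fderiv]
  change (starRingEnd ℂ) z * (((((p - 2) / 2 * (‖z‖ ^ 2 + δ) ^ ((p - 2) / 2 - 1)) •
    ((2 : ℕ) • inner ℝ z w) : ℝ)) : ℂ) +
    (((‖z‖ ^ 2 + δ) ^ ((p - 2) / 2) : ℝ) : ℂ) * (starRingEnd ℂ) w = _
  have hq : 0 < ‖z‖ ^ 2 + δ := by positivity
  rw [Complex.inner, Real.rpow_sub_one hq.ne']
  simp only [smul_eq_mul, nsmul_eq_mul]
  push_cast
  ring_nf

variable {N : ℕ}

lemma contDiff_of_forall_mem_tsupport {F : Type*} [NormedAddCommGroup F] [NormedSpace ℝ F]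
    {g : E N → F} {n : WithTop ℕ∞} (h : ∀ x ∈ tsupport g, ContDiffAt ℝ n g x) : ContDiff ℝ n g :=
  contDiff_iff_contDiffAt.2 fun x => by
    by_cases hx : x ∈ tsupport g
    · exact h x hx
    · exact contDiffAt_const.congr_of_eventuallyEq (notMem_tsupport_iff_eventuallyEq.1 hx)

lemma tsupport_subset_tsupport {F G : Type*} [Zero F] [Zero G] {u : E N → F} {g : E N → G}
    (hs : ∀ x, u x = 0 → g x = 0) : tsupport g ⊆ tsupport u :=
  closure_mono fun x hx hxu => hx (hs x hxu)

/-- Smoothness has to be checked only on the support of u. This permits factors such as |x|^a that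
are singular at the origin. -/
lemma IsTest.of_contDiffAt {V : Set (E N)} {u g : E N → ℂ} (hu : IsTest V u)
    (hs : ∀ x, u x = 0 → g x = 0) (hg : ∀ x ∈ tsupport u, ContDiffAt ℝ ∞ g x) : IsTest V g := by
  have hsub : tsupport g ⊆ tsupport u := tsupport_subset_tsupport hs
  exact ⟨contDiff_of_forall_mem_tsupport fun x hx => hg x (hsub hx),
    hu.2.1.of_isClosed_subset (isClosed_tsupport _) hsub, hsub.trans hu.2.2⟩

lemma IsTest.norm_rpow_mul {u : E N → ℂ} (hu : IsTest (Omega N) u) (a : ℝ) :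
    IsTest (Omega N) fun x => ((‖x‖ ^ a : ℝ) : ℂ) * u x := by
  refine hu.of_contDiffAt (fun x hx => by simp [hx]) fun x hx => ?_
  exact (Complex.ofRealCLM.contDiff.contDiffAt.comp x
    (contDiffAt_norm_rpow (hu.2.2 hx).1 a)).mul hu.1.contDiffAt

lemma IsTest.regDual {V : Set (E N)} {u : E N → ℂ} (hu : IsTest V u) {δ : ℝ} (hδ : 0 < δ) (p : ℝ) :
    IsTest V fun x => regDual p δ (u x) :=
  hu.of_contDiffAt (fun x hx => by simp [hx, regDual_zero])
    fun _ _ => ((contDiff_regDual hδ p).comp hu.1).contDiffAt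

/-- The density of the form `-∫ L u ū|u|^(p-2)`, written in terms of `v = |x|^s u`, with a
regularization parameter `δ`. -/
def formDensity (p δ k f : ℝ) (v : E N → ℂ) (x : E N) : ℂ :=
  ((‖x‖ ^ (2 - N : ℝ) : ℝ) : ℂ) *
      ∑ i, partialD i v x * fderiv ℝ (regDual p δ) (v x) (partialD i v x)
    + Complex.I * ((k * ‖x‖ ^ (-N : ℝ) * (‖v x‖ ^ 2 + δ) ^ ((p - 2) / 2) *
        ((starRingEnd ℂ) (v x) * fderiv ℝ v x x).im : ℝ) : ℂ)
    + ((f * ‖x‖ ^ (-N : ℝ) * ‖v x‖ ^ 2 * (‖v x‖ ^ 2 + δ) ^ ((p - 2) / 2) : ℝ) : ℂ)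

/-! ### Pointwise bounds for the regularized gradient form -/

section Pointwise

variable {ι : Type*} [Fintype ι]

lemma sum_mul_fderiv_regDual {p δ : ℝ} (hδ : 0 < δ) (z : ℂ) (a : ι → ℂ) :
    ∑ i, a i * fderiv ℝ (regDual p δ) z (a i) =
      (((‖z‖ ^ 2 + δ) ^ ((p - 2) / 2) : ℝ) : ℂ) * (((∑ i, ‖a i‖ ^ 2 : ℝ) : ℂ) +
      (((p - 2) / (‖z‖ ^ 2 + δ) : ℝ) : ℂ) * ∑ i, ((starRingEnd ℂ) z * a i) *
        ((((starRingEnd ℂ) z * a i).re : ℝ) : ℂ)) := by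
  rw [Complex.ofReal_sum, Finset.mul_sum, ← Finset.sum_add_distrib, Finset.mul_sum]
  refine Finset.sum_congr rfl fun i _ => ?_
  rw [fderiv_regDual hδ]
  have : ((‖a i‖ ^ 2 : ℝ) : ℂ) = a i * (starRingEnd ℂ) (a i) := by
    rw [Complex.mul_conj, Complex.normSq_eq_norm_sq]
  rw [this]
  push_cast
  ring

lemma sum_re_sq_add_sum_im_sq (z : ℂ) (a : ι → ℂ) :
    ∑ i, ((starRingEnd ℂ) z * a i).re ^ 2 + ∑ i, ((starRingEnd ℂ) z * a i).im ^ 2 =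
      ‖z‖ ^ 2 * ∑ i, ‖a i‖ ^ 2 := by
  rw [← Finset.sum_add_distrib, Finset.mul_sum]
  refine Finset.sum_congr rfl fun i _ => ?_
  rw [← mul_pow, ← RCLike.norm_conj z, ← norm_mul, ← Complex.normSq_eq_norm_sq,
    Complex.normSq_apply]
  ring

lemma re_sum_mul_fderiv_regDual {p δ : ℝ} (hδ : 0 < δ) (z : ℂ) (a : ι → ℂ) :
    (∑ i, a i * fderiv ℝ (regDual p δ) z (a i)).re =
      (‖z‖ ^ 2 + δ) ^ ((p - 2) / 2) * (∑ i, ‖a i‖ ^ 2 +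
      (p - 2) / (‖z‖ ^ 2 + δ) * ∑ i, ((starRingEnd ℂ) z * a i).re ^ 2) := by
  rw [sum_mul_fderiv_regDual hδ, Complex.re_ofReal_mul, Complex.add_re, Complex.ofReal_re,
    Complex.re_ofReal_mul, Complex.re_sum]
  congr 3
  refine Finset.sum_congr rfl fun i _ => ?_
  rw [Complex.re_mul_ofReal]; ring

lemma im_sum_mul_fderiv_regDual {p δ : ℝ} (hδ : 0 < δ) (z : ℂ) (a : ι → ℂ) :
    (∑ i, a i * fderiv ℝ (regDual p δ) z (a i)).im =
      (‖z‖ ^ 2 + δ) ^ ((p - 2) / 2) * ((p - 2) / (‖z‖ ^ 2 + δ) *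
        ∑ i, ((starRingEnd ℂ) z * a i).im * ((starRingEnd ℂ) z * a i).re) := by
  rw [sum_mul_fderiv_regDual hδ, Complex.im_ofReal_mul, Complex.add_im, Complex.ofReal_im,
    Complex.im_ofReal_mul, Complex.im_sum, zero_add]
  congr 2
  refine Finset.sum_congr rfl fun i _ => ?_
  rw [Complex.im_mul_ofReal]

lemma sum_re_sq_div_le {δ : ℝ} (hδ : 0 < δ) (z : ℂ) (a : ι → ℂ) :
    (∑ i, ((starRingEnd ℂ) z * a i).re ^ 2) / (‖z‖ ^ 2 + δ) ≤ ∑ i, ‖a i‖ ^ 2 := by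
  rw [div_le_iff₀ (by positivity)]
  have h := sum_re_sq_add_sum_im_sq z a
  have h1 : 0 ≤ ∑ i, ((starRingEnd ℂ) z * a i).im ^ 2 := by positivity
  have h2 : 0 ≤ δ * ∑ i, ‖a i‖ ^ 2 := by positivity
  linarith

/-- The form is Q(|∇v|² + (p-2)R), where R = Σ (Re z̄a_i)²/(|z|²+δ) lies between 0 and |∇v|². For p
≥ 2 the second term can be dropped; for p < 2 it costs at most (2-p)|∇v|². -/
lemma le_re_sum_mul_fderiv_regDual {p δ : ℝ} (hδ : 0 < δ) (z : ℂ) (a : ι → ℂ) :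
    (‖z‖ ^ 2 + δ) ^ ((p - 2) / 2) * (min 1 (p - 1) * ∑ i, ‖a i‖ ^ 2) ≤
      (∑ i, a i * fderiv ℝ (regDual p δ) z (a i)).re := by
  rw [re_sum_mul_fderiv_regDual hδ]
  refine mul_le_mul_of_nonneg_left ?_ (by positivity)
  have h := sum_re_sq_div_le hδ z a
  have h0 : 0 ≤ (∑ i, ((starRingEnd ℂ) z * a i).re ^ 2) / (‖z‖ ^ 2 + δ) := by positivity
  rw [div_mul_eq_mul_div, mul_div_assoc]
  have hg : 0 ≤ ∑ i, ‖a i‖ ^ 2 := by positivity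
  rcases le_total 0 (p - 2) with hp | hp
  · rw [min_eq_left (by linarith)]
    nlinarith
  · rw [min_eq_right (by linarith)]
    nlinarith

lemma re_sum_mul_fderiv_regDual_le {p δ : ℝ} (hp : 1 < p) (hδ : 0 < δ) (z : ℂ) (a : ι → ℂ) :
    (∑ i, a i * fderiv ℝ (regDual p δ) z (a i)).re ≤
      (‖z‖ ^ 2 + δ) ^ ((p - 2) / 2) * (p * ∑ i, ‖a i‖ ^ 2) := by
  rw [re_sum_mul_fderiv_regDual hδ]
  refine mul_le_mul_of_nonneg_left ?_ (by positivity)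
  have h := sum_re_sq_div_le hδ z a
  have h0 : 0 ≤ (∑ i, ((starRingEnd ℂ) z * a i).re ^ 2) / (‖z‖ ^ 2 + δ) := by positivity
  rw [div_mul_eq_mul_div, mul_div_assoc]
  have hg : 0 ≤ ∑ i, ‖a i‖ ^ 2 := by positivity
  rcases le_total 0 (p - 2) with hp | hp
  · nlinarith
  · nlinarith

/-- Only the product of real and imaginary parts of z̄a_i contributes. It is at most the sum of
their squares, which adds up to |z|²Σ|a_i|². -/
lemma abs_im_sum_mul_fderiv_regDual_le {p δ : ℝ} (hδ : 0 < δ) (z : ℂ) (a : ι → ℂ) :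
    |(∑ i, a i * fderiv ℝ (regDual p δ) z (a i)).im| ≤
      (‖z‖ ^ 2 + δ) ^ ((p - 2) / 2) * (|p - 2| * ∑ i, ‖a i‖ ^ 2) := by
  have hq : 0 < ‖z‖ ^ 2 + δ := by positivity
  rw [im_sum_mul_fderiv_regDual hδ, abs_mul, abs_of_nonneg (by positivity : (0:ℝ) ≤
    (‖z‖ ^ 2 + δ) ^ ((p - 2) / 2))]
  refine mul_le_mul_of_nonneg_left ?_ (by positivity)
  rw [abs_mul, abs_div, abs_of_pos hq, div_mul_eq_mul_div, mul_div_assoc]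
  refine mul_le_mul_of_nonneg_left ?_ (abs_nonneg _)
  rw [div_le_iff₀ hq]
  have h := sum_re_sq_add_sum_im_sq z a
  have h1 : |∑ i, ((starRingEnd ℂ) z * a i).im * ((starRingEnd ℂ) z * a i).re| ≤
      ∑ i, ((starRingEnd ℂ) z * a i).re ^ 2 + ∑ i, ((starRingEnd ℂ) z * a i).im ^ 2 := by
    rw [← Finset.sum_add_distrib]
    refine (Finset.abs_sum_le_sum_abs _ _).trans (Finset.sum_le_sum fun i _ => ?_)
    rw [abs_le]
    constructor <;> nlinarith [sq_nonneg (((starRingEnd ℂ) z * a i).re +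
      ((starRingEnd ℂ) z * a i).im), sq_nonneg (((starRingEnd ℂ) z * a i).re -
      ((starRingEnd ℂ) z * a i).im), sq_nonneg (((starRingEnd ℂ) z * a i).re),
      sq_nonneg (((starRingEnd ℂ) z * a i).im)]
  have h2 : 0 ≤ δ * ∑ i, ‖a i‖ ^ 2 := by positivity
  linarith

end Pointwise

lemma norm_fderiv_apply_self_sq_le (v : E N → ℂ) (x : E N) :
    ‖fderiv ℝ v x x‖ ^ 2 ≤ ‖x‖ ^ 2 * ∑ i, ‖partialD i v x‖ ^ 2 := by
  rw [← sum_coord_smul_map (fderiv ℝ v x) x, ← sum_coord_sq x]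
  have h1 : ‖∑ i, x i • fderiv ℝ v x (EuclideanSpace.single i 1)‖ ≤
      ∑ i, |x i| * ‖partialD i v x‖ := by
    refine (norm_sum_le _ _).trans (Finset.sum_le_sum fun i _ => ?_)
    rw [norm_smul, Real.norm_eq_abs]; rfl
  calc _ ≤ (∑ i, |x i| * ‖partialD i v x‖) ^ 2 := by gcongr
    _ ≤ (∑ i, |x i| ^ 2) * ∑ i, ‖partialD i v x‖ ^ 2 := Finset.sum_mul_sq_le_sq_mul_sq _ _ _
    _ = _ := by simp

lemma re_formDensity (p δ k f : ℝ) (v : E N → ℂ) (x : E N) :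
    (formDensity p δ k f v x).re = ‖x‖ ^ (2 - N : ℝ) *
      (∑ i, partialD i v x * fderiv ℝ (regDual p δ) (v x) (partialD i v x)).re +
      f * ‖x‖ ^ (-N : ℝ) * ‖v x‖ ^ 2 * (‖v x‖ ^ 2 + δ) ^ ((p - 2) / 2) := by
  rw [formDensity, Complex.add_re, Complex.add_re, Complex.re_ofReal_mul, Complex.I_mul_re,
    Complex.ofReal_im, Complex.ofReal_re, neg_zero, add_zero]

lemma im_formDensity (p δ k f : ℝ) (v : E N → ℂ) (x : E N) :
    (formDensity p δ k f v x).im = ‖x‖ ^ (2 - N : ℝ) *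
      (∑ i, partialD i v x * fderiv ℝ (regDual p δ) (v x) (partialD i v x)).im +
      k * ‖x‖ ^ (-N : ℝ) * (‖v x‖ ^ 2 + δ) ^ ((p - 2) / 2) *
        ((starRingEnd ℂ) (v x) * fderiv ℝ v x x).im := by
  rw [formDensity, Complex.add_im, Complex.add_im, Complex.im_ofReal_mul, Complex.I_mul_im,
    Complex.ofReal_im, Complex.ofReal_re, add_zero]

lemma re_formDensity_nonneg {p δ k f : ℝ} (hp : 1 < p) (hδ : 0 < δ) (hf : 0 ≤ f) (v : E N → ℂ)
    (x : E N) : 0 ≤ (formDensity p δ k f v x).re := by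
  rw [re_formDensity]
  have h := le_re_sum_mul_fderiv_regDual (p := p) hδ (v x) (fun i => partialD i v x)
  have h1 : 0 < min 1 (p - 1) := lt_min one_pos (by linarith)
  have h2 : 0 ≤ (∑ i, partialD i v x * fderiv ℝ (regDual p δ) (v x) (partialD i v x)).re :=
    le_trans (by positivity) h
  positivity

/-- The rotational term satisfies |Im(v̄ x·∇v)| ≤ (|v|² + |x|²|∇v|²)/2. Its gradient half is
absorbed through `hl1` and its zeroth order half through `hl2`. The latter hypothesis also covers f
= 0 when k = 0. -/
lemma formDensity_mem_sector {p δ k f l : ℝ} (hp : 1 < p) (hδ : 0 < δ) (hf : 0 ≤ f) (hl : 0 ≤ l)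
    (hl1 : |p - 2| + |k| / 2 ≤ l * min 1 (p - 1)) (hl2 : |k| / 2 ≤ l * f) (v : E N → ℂ)
    {x : E N} (hx : x ≠ 0) : formDensity p δ k f v x ∈ sector l := by
  refine ⟨re_formDensity_nonneg hp hδ hf v x, ?_⟩
  rw [re_formDensity, im_formDensity]
  have h1 := le_re_sum_mul_fderiv_regDual (p := p) hδ (v x) (fun i => partialD i v x)
  have h2 := abs_im_sum_mul_fderiv_regDual_le (p := p) hδ (v x) (fun i => partialD i v x)
  have h3 := norm_fderiv_apply_self_sq_le v x
  set S := ∑ i, partialD i v x * fderiv ℝ (regDual p δ) (v x) (partialD i v x)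
  set Q := (‖v x‖ ^ 2 + δ) ^ ((p - 2) / 2)
  set g := ∑ i, ‖partialD i v x‖ ^ 2
  have hQ : 0 ≤ Q := by positivity
  have hg : 0 ≤ g := by positivity
  have hn : 0 < ‖x‖ := norm_pos_iff.2 hx
  have hr : ‖x‖ ^ (2 - N : ℝ) = ‖x‖ ^ 2 * ‖x‖ ^ (-N : ℝ) := by
    rw [← Real.rpow_natCast, ← Real.rpow_add hn]; congr 1
  rw [hr]
  set ρ := ‖x‖ ^ (-N : ℝ)
  have hρ : 0 ≤ ρ := by positivity
  have h4 : |((starRingEnd ℂ) (v x) * fderiv ℝ v x x).im| ≤ (‖v x‖ ^ 2 + ‖x‖ ^ 2 * g) / 2 := by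
    refine (Complex.abs_im_le_norm _).trans ?_
    rw [norm_mul, RCLike.norm_conj]
    nlinarith [sq_nonneg (‖v x‖ - ‖fderiv ℝ v x x‖)]
  calc |‖x‖ ^ 2 * ρ * S.im + k * ρ * Q * ((starRingEnd ℂ) (v x) * fderiv ℝ v x x).im|
      ≤ ‖x‖ ^ 2 * ρ * |S.im| + |k| * ρ * Q * |((starRingEnd ℂ) (v x) * fderiv ℝ v x x).im| := by
        refine (abs_add_le _ _).trans (le_of_eq ?_)
        rw [abs_mul, abs_of_nonneg (by positivity : 0 ≤ ‖x‖ ^ 2 * ρ), abs_mul, abs_mul, abs_mul,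
          abs_of_nonneg hρ, abs_of_nonneg hQ]
    _ ≤ ‖x‖ ^ 2 * ρ * (Q * (|p - 2| * g)) + |k| * ρ * Q * ((‖v x‖ ^ 2 + ‖x‖ ^ 2 * g) / 2) := by
        gcongr
    _ = ‖x‖ ^ 2 * ρ * Q * g * (|p - 2| + |k| / 2) + ρ * Q * ‖v x‖ ^ 2 * (|k| / 2) := by ring
    _ ≤ ‖x‖ ^ 2 * ρ * Q * g * (l * min 1 (p - 1)) + ρ * Q * ‖v x‖ ^ 2 * (l * f) := by
        gcongr
    _ = l * (‖x‖ ^ 2 * ρ * (Q * (min 1 (p - 1) * g)) + f * ρ * ‖v x‖ ^ 2 * Q) := by ring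
    _ ≤ l * (‖x‖ ^ 2 * ρ * S.re + f * ρ * ‖v x‖ ^ 2 * Q) := by gcongr

lemma partialD_comp_regDual {p δ : ℝ} (hδ : 0 < δ) {v : E N → ℂ} (hv : Differentiable ℝ v)
    (i : Fin N) (x : E N) : partialD i (fun y => regDual p δ (v y)) x =
      fderiv ℝ (regDual p δ) (v x) (partialD i v x) := by
  have h := ((contDiff_regDual hδ p (n := 1)).differentiable one_ne_zero (v x)).hasFDerivAt.comp x
    (hv x).hasFDerivAt
  rw [partialD]
  exact congrArg (fun L : E N →L[ℝ] ℂ => L (EuclideanSpace.single i 1)) h.fderiv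

lemma fderiv_norm_rpow_mul {v : E N → ℂ} {x : E N} (hx : x ≠ 0) (hv : DifferentiableAt ℝ v x)
    (a : ℝ) (e : E N) : fderiv ℝ (fun y => ((‖y‖ ^ a : ℝ) : ℂ) * v y) x e =
      ((‖x‖ ^ a : ℝ) : ℂ) * (fderiv ℝ v x e + ((a * inner ℝ x e / ‖x‖ ^ 2 : ℝ) : ℂ) * v x) := by
  have hn : 0 < ‖x‖ := norm_pos_iff.2 hx
  have h1 := Complex.ofRealCLM.hasFDerivAt.comp x (hasFDerivAt_norm_rpow_of_ne_zero hx a)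
  have h : HasFDerivAt (fun y => ((‖y‖ ^ a : ℝ) : ℂ) * v y) _ x := h1.mul hv.hasFDerivAt
  rw [h.fderiv]
  change ((‖x‖ ^ a : ℝ) : ℂ) * fderiv ℝ v x e +
    v x * (((a * ‖x‖ ^ (a - 2)) • inner ℝ x e : ℝ) : ℂ) = _
  have h2 : ‖x‖ ^ (a - 2) = ‖x‖ ^ a / ‖x‖ ^ 2 := by
    rw [Real.rpow_sub hn]; norm_cast
  rw [h2]
  simp only [smul_eq_mul]
  push_cast
  ring

lemma formDensity_eq_zero {p δ k f : ℝ} {v : E N → ℂ} {x : E N} (hx : x ∉ tsupport v) :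
    formDensity p δ k f v x = 0 := by
  simp [formDensity, partialD, fderiv_eq_zero_of_notMem_tsupport hx,
    image_eq_zero_of_notMem_tsupport hx]

lemma continuousOn_norm_rpow (a : ℝ) {K : Set (E N)} (hK : ∀ x ∈ K, x ≠ 0) :
    ContinuousOn (fun x : E N => ‖x‖ ^ a) K :=
  continuous_norm.continuousOn.rpow_const fun x hx => Or.inl (norm_ne_zero_iff.2 (hK x hx))

lemma continuous_fderiv_apply_self {F : Type*} [NormedAddCommGroup F] [NormedSpace ℝ F]
    {v : E N → F} (hv : ContDiff ℝ 1 v) : Continuous fun x => fderiv ℝ v x x :=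
  (hv.continuous_fderiv one_ne_zero).clm_apply continuous_id

lemma integrable_formDensity {p δ k f : ℝ} (hδ : 0 < δ) {v : E N → ℂ} (hv : IsTest (Omega N) v) :
    Integrable (formDensity p δ k f v) := by
  have hne : ∀ x ∈ tsupport v, x ≠ 0 := fun x hx => (hv.2.2 hx).1
  have hr := fun a => Complex.continuous_ofReal.comp_continuousOn (continuousOn_norm_rpow a hne)
  have hv1 : ContDiff ℝ 1 v := hv.1.of_le (by norm_cast)
  refine integrable_of_continuousOn_compact hv.2.1 ?_ fun x hx => formDensity_eq_zero hx
  have hP : ∀ i, Continuous (partialD i v) := fun i =>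
    (contDiff_partialD (m := 0) hv1 (by norm_num) i).continuous
  have hD := continuous_fderiv_apply_self hv1
  have hc : Continuous fun x => (starRingEnd ℂ) (v x) :=
    Complex.continuous_conj.comp hv1.continuous
  have hQ : Continuous fun x => (‖v x‖ ^ 2 + δ) ^ ((p - 2) / 2) :=
    (contDiff_norm_sq_add_rpow hδ _ (n := 0)).continuous.comp hv1.continuous
  have hF : ∀ i, Continuous fun x => fderiv ℝ (regDual p δ) (v x) (partialD i v x) := fun i =>
    (((contDiff_regDual hδ p (n := 1)).continuous_fderiv one_ne_zero).comp
      hv1.continuous).clm_apply (hP i)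
  unfold formDensity
  refine ((hr _).mul ?_).add (continuousOn_const.mul ?_) |>.add ?_
  · exact (continuous_finsetSum _ fun i _ => (hP i).mul (hF i)).continuousOn
  · refine Complex.continuous_ofReal.comp_continuousOn ?_
    exact ((continuousOn_const.mul (continuousOn_norm_rpow _ hne)).mul hQ.continuousOn).mul
      (Complex.continuous_im.comp (hc.mul hD)).continuousOn
  · refine Complex.continuous_ofReal.comp_continuousOn ?_
    exact ((continuousOn_const.mul (continuousOn_norm_rpow _ hne)).mul
      (hv1.continuous.norm.pow 2).continuousOn).mul hQ.continuousOn

end Form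

/-! ### Integration by parts for the regularized form -/

section FormIdentity

variable {N : ℕ}

lemma IsTest.zero_notMem_tsupport {v : E N → ℂ} (hv : IsTest (Omega N) v) : (0 : E N) ∉ tsupport v :=
  fun h => (hv.2.2 h).1 rfl

lemma IsTest.contDiff_one {V : Set (E N)} {v : E N → ℂ} (hv : IsTest V v) : ContDiff ℝ 1 v :=
  hv.1.of_le (by norm_cast)

lemma IsTest.contDiff_two {V : Set (E N)} {v : E N → ℂ} (hv : IsTest V v) : ContDiff ℝ 2 v :=
  hv.1.of_le (by norm_cast)

lemma sum_mul_add_expand {ι : Type*} [Fintype ι] (y a m : ι → ℂ) (A B s t z w : ℂ) :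
    ∑ i, (A * (a i + s * y i * z)) * (B * (m i + t * y i * w)) =
      A * B * (∑ i, a i * m i + t * w * ∑ i, y i * a i + s * z * ∑ i, y i * m i +
        s * t * z * w * ∑ i, y i ^ 2) := by
  simp only [Finset.mul_sum, ← Finset.sum_add_distrib]
  exact Finset.sum_congr rfl fun i _ => by ring

/-- The pointwise identity behind the form of `L`. -/
lemma grad_mul_grad_eq_formDensity {p δ : ℝ} (hp : p ≠ 0) (hδ : 0 < δ) (b c s : ℝ) {v : E N → ℂ}
    (hv : ContDiff ℝ 1 v) {x : E N} (hx : x ≠ 0) :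
    (∑ i, partialD i (fun y => ((‖y‖ ^ (-s) : ℝ) : ℂ) * v y) x *
        partialD i (fun y => ((‖y‖ ^ (2 - N + s) : ℝ) : ℂ) * regDual p δ (v y)) x)
      - ((c / ‖x‖ ^ 2 : ℝ) : ℂ) * (fderiv ℝ (fun y => ((‖y‖ ^ (-s) : ℝ) : ℂ) * v y) x x *
          (((‖x‖ ^ (2 - N + s) : ℝ) : ℂ) * regDual p δ (v x)))
      + ((b / ‖x‖ ^ 2 : ℝ) : ℂ) * ((((‖x‖ ^ (-s) : ℝ) : ℂ) * v x) *
          (((‖x‖ ^ (2 - N + s) : ℝ) : ℂ) * regDual p δ (v x))) =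
    formDensity p δ (2 - N + 2 * s - c) (quadF N b c s) v x
      - (s : ℂ) * (‖x‖ ^ (-N : ℝ) • fderiv ℝ (fun y => v y * regDual p δ (v y)) x x)
      + (((2 - N + 2 * s - c) / p : ℝ) : ℂ) *
        ((‖x‖ ^ (-N : ℝ) • fderiv ℝ (fun y => regPow p δ (v y)) x x : ℝ) : ℂ) := by
  have hn : 0 < ‖x‖ := norm_pos_iff.2 hx
  have hvd : Differentiable ℝ v := hv.differentiable one_ne_zero
  have hmd : Differentiable ℝ fun y => regDual p δ (v y) :=
    ((contDiff_regDual hδ p (n := 1)).comp hv).differentiable one_ne_zero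
  have h1 : ∀ i, partialD i (fun y => ((‖y‖ ^ (-s) : ℝ) : ℂ) * v y) x =
      ((‖x‖ ^ (-s) : ℝ) : ℂ) * (partialD i v x +
        ((-s / ‖x‖ ^ 2 : ℝ) : ℂ) * ((x i : ℝ) : ℂ) * v x) := by
    intro i
    rw [partialD, fderiv_norm_rpow_mul hx (hvd x), inner_single_right, partialD]
    push_cast; ring
  have h2 : ∀ i, partialD i (fun y => ((‖y‖ ^ (2 - N + s) : ℝ) : ℂ) * regDual p δ (v y)) x =
      ((‖x‖ ^ (2 - N + s) : ℝ) : ℂ) * (fderiv ℝ (regDual p δ) (v x) (partialD i v x) +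
        (((2 - N + s) / ‖x‖ ^ 2 : ℝ) : ℂ) * ((x i : ℝ) : ℂ) * regDual p δ (v x)) := by
    intro i
    rw [partialD, fderiv_norm_rpow_mul hx (hmd x), inner_single_right,
      ← partialD_comp_regDual hδ hvd, partialD]
    push_cast; ring
  have h3 : fderiv ℝ (fun y => ((‖y‖ ^ (-s) : ℝ) : ℂ) * v y) x x =
      ((‖x‖ ^ (-s) : ℝ) : ℂ) * (fderiv ℝ v x x - s * v x) := by
    rw [fderiv_norm_rpow_mul hx (hvd x), real_inner_self_eq_norm_sq,
      mul_div_cancel_right₀ _ (by positivity)]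
    push_cast; ring
  have h4 : ∑ i, ((x i : ℝ) : ℂ) * partialD i v x = fderiv ℝ v x x := by
    rw [← sum_coord_smul_map (fderiv ℝ v x) x]
    exact Finset.sum_congr rfl fun i _ => by rw [Complex.real_smul]; rfl
  have h5 : ∑ i, ((x i : ℝ) : ℂ) * fderiv ℝ (regDual p δ) (v x) (partialD i v x) =
      fderiv ℝ (regDual p δ) (v x) (fderiv ℝ v x x) := by
    rw [← h4, map_sum]
    exact Finset.sum_congr rfl fun i _ => by
      rw [← Complex.real_smul, ← Complex.real_smul, map_smul]
  have h6 : ∑ i, ((x i : ℝ) : ℂ) ^ 2 = ((‖x‖ ^ 2 : ℝ) : ℂ) := by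
    rw [← sum_coord_sq x]; push_cast; rfl
  have h7 : fderiv ℝ (fun y => v y * regDual p δ (v y)) x x =
      v x * fderiv ℝ (regDual p δ) (v x) (fderiv ℝ v x x) +
        regDual p δ (v x) * fderiv ℝ v x x := by
    have hm : HasFDerivAt (fun y => regDual p δ (v y)) _ x :=
      ((contDiff_regDual hδ p (n := 1)).differentiable one_ne_zero (v x)).hasFDerivAt.comp x
      (hvd x).hasFDerivAt
    have hvm : HasFDerivAt (fun y => v y * regDual p δ (v y)) _ x := (hvd x).hasFDerivAt.mul hm
    rw [hvm.fderiv]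
    rfl
  have h8 : fderiv ℝ (fun y => regPow p δ (v y)) x x =
      p * (‖v x‖ ^ 2 + δ) ^ ((p - 2) / 2) * ((starRingEnd ℂ) (v x) * fderiv ℝ v x x).re := by
    have hm : HasFDerivAt (fun y => regPow p δ (v y)) _ x :=
      ((contDiff_regPow hδ p (n := 1)).differentiable one_ne_zero (v x)).hasFDerivAt.comp x
      (hvd x).hasFDerivAt
    rw [hm.fderiv, ← fderiv_regPow hδ]
    rfl
  simp_rw [h1, h2]
  rw [sum_mul_add_expand, h4, h5, h6, h3, h7, h8, formDensity]
  have hr : ‖x‖ ^ (2 - N : ℝ) = ‖x‖ ^ 2 * ‖x‖ ^ (-N : ℝ) := by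
    rw [← Real.rpow_natCast, ← Real.rpow_add hn]; congr 1
  have hAB : ((‖x‖ ^ (-s) : ℝ) : ℂ) * ((‖x‖ ^ (2 - N + s) : ℝ) : ℂ) =
      ((‖x‖ ^ 2 : ℝ) : ℂ) * ((‖x‖ ^ (-N : ℝ) : ℝ) : ℂ) := by
    rw [← Complex.ofReal_mul, ← Complex.ofReal_mul, ← hr, ← Real.rpow_add hn]
    congr 2; ring
  rw [hr]
  set A : ℂ := ((‖x‖ ^ (-s) : ℝ) : ℂ)
  set B : ℂ := ((‖x‖ ^ (2 - N + s) : ℝ) : ℂ)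
  set S := ∑ i, partialD i v x * fderiv ℝ (regDual p δ) (v x) (partialD i v x)
  set X := fderiv ℝ v x x
  set Y := fderiv ℝ (regDual p δ) (v x) X
  set ρ : ℝ := ‖x‖ ^ (-N : ℝ)
  set Q : ℝ := (‖v x‖ ^ 2 + δ) ^ ((p - 2) / 2)
  have hm : regDual p δ (v x) = (starRingEnd ℂ) (v x) * (Q : ℂ) := rfl
  have hvv : ((‖v x‖ : ℝ) : ℂ) ^ 2 = v x * (starRingEnd ℂ) (v x) := by
    rw [Complex.mul_conj, Complex.normSq_eq_norm_sq]; push_cast; rfl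
  have hvX : (starRingEnd ℂ) (v x) * X = (((starRingEnd ℂ) (v x) * X).re : ℂ) +
      Complex.I * (((starRingEnd ℂ) (v x) * X).im : ℂ) := by
    rw [mul_comm Complex.I]; exact (Complex.re_add_im _).symm
  set ξ : ℝ := ((starRingEnd ℂ) (v x) * X).re
  set η : ℝ := ((starRingEnd ℂ) (v x) * X).im
  have hrc : ((‖x‖ : ℝ) : ℂ) ≠ 0 := by exact_mod_cast hn.ne'
  have hpc : (p : ℂ) ≠ 0 := by exact_mod_cast hp
  rw [hm, quadF]
  set w := (starRingEnd ℂ) (v x)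
  simp only [Complex.real_smul, smul_eq_mul]
  push_cast at hAB ⊢
  rw [hvv, show A * (X - s * v x) * (B * (w * Q)) = A * B * ((X - s * v x) * (w * Q)) by ring,
    show A * v x * (B * (w * Q)) = A * B * (v x * (w * Q)) by ring, hAB]
  field_simp
  -- The first order terms are -s x·∇(v m) + k m x·∇v with m the regularized dual of v. Splitting v̄
  -- x·∇v into ξ + iη, the ξ part is the radial derivative of `regPow` divided by p, and the η part
  -- is the imaginary term of the density.
  linear_combination (ρ * Q * (2 - N + 2 * s - c) : ℂ) * hvX

lemma integrable_norm_rpow_smul_radial {G : Type*} [NormedAddCommGroup G] [NormedSpace ℝ G]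
    {g : E N → G} (hg : ContDiff ℝ 1 g) (hc : HasCompactSupport g) (h0 : (0 : E N) ∉ tsupport g)
    (a : ℝ) : Integrable fun x => ‖x‖ ^ a • fderiv ℝ g x x :=
  integrable_of_continuousOn_compact hc
    ((continuousOn_norm_rpow a fun _ hx h => h0 (h ▸ hx)).smul
      (continuous_fderiv_apply_self hg).continuousOn)
    fun x hx => by simp [fderiv_eq_zero_of_notMem_tsupport hx]

/-- `u * g` is integrable against a function that is continuous away from the origin. -/
lemma IsTest.integrable_mul {g h : E N → ℂ} (hg : IsTest (Omega N) g)
    (hh : ContinuousOn h {0}ᶜ) : Integrable fun x => h x * g x :=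
  integrable_of_continuousOn_compact hg.2.1
    ((hh.mono fun x hx => (hg.2.2 hx).1).mul hg.1.continuous.continuousOn)
    fun x hx => by simp [image_eq_zero_of_notMem_tsupport hx]

lemma continuousOn_ofReal_div_norm_sq (c : ℝ) :
    ContinuousOn (fun x : E N => ((c / ‖x‖ ^ 2 : ℝ) : ℂ)) {0}ᶜ := by
  refine Complex.continuous_ofReal.comp_continuousOn ?_
  exact continuousOn_const.div (continuous_norm.pow 2).continuousOn
    fun x hx => pow_ne_zero _ (norm_ne_zero_iff.2 hx)

/-- The factor |x|^(-α) in the multiplier removes the degenerate coefficient |x|^α, so that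
integration by parts concerns only the Laplacian. -/
lemma opL_mul_eq {α b c β : ℝ} (u : E N → ℂ) {x : E N} (hx : x ≠ 0) (m : ℂ) :
    opL α b c u x * (((‖x‖ ^ (β - α) : ℝ) : ℂ) * m) =
      Laplacian.laplacian u x * (((‖x‖ ^ β : ℝ) : ℂ) * m) +
      (((c / ‖x‖ ^ 2 : ℝ) : ℂ) * fderiv ℝ u x x * (((‖x‖ ^ β : ℝ) : ℂ) * m) -
        ((b / ‖x‖ ^ 2 : ℝ) : ℂ) * u x * (((‖x‖ ^ β : ℝ) : ℂ) * m)) := by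
  have hn : 0 < ‖x‖ := norm_pos_iff.2 hx
  have hrc : ((‖x‖ : ℝ) : ℂ) ≠ 0 := by exact_mod_cast hn.ne'
  have h1 : ‖x‖ ^ (α - 1) = ‖x‖ ^ α / ‖x‖ := Real.rpow_sub_one hn.ne' α
  have h2 : ‖x‖ ^ (α - 2) = ‖x‖ ^ α / ‖x‖ ^ 2 := by rw [Real.rpow_sub hn]; norm_cast
  have h3 : ‖x‖ ^ (β - α) = ‖x‖ ^ β / ‖x‖ ^ α := Real.rpow_sub hn β α
  have h4 : ((‖x‖ ^ α : ℝ) : ℂ) ≠ 0 := by exact_mod_cast (Real.rpow_pos_of_pos hn α).ne'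
  rw [opL, map_smul, h1, h2, h3, Complex.real_smul]
  push_cast
  field_simp
  ring

/-- After moving one derivative from the Laplacian to the multiplier, `grad_mul_grad_eq_formDensity`
applies pointwise. The two radial derivatives it leaves over integrate to zero against |x|^(-N). The
identity holds for every s; the relation between s, p and α enters only in the limit δ → 0. -/
lemma neg_integral_opL_mul_regDual {p δ : ℝ} (hp : p ≠ 0) (hδ : 0 < δ) (α b c s : ℝ)
    {v : E N → ℂ} (hv : IsTest (Omega N) v) :
    -∫ x, opL α b c (fun y => ((‖y‖ ^ (-s) : ℝ) : ℂ) * v y) x *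
        (((‖x‖ ^ (2 - N + s - α) : ℝ) : ℂ) * regDual p δ (v x)) =
      ∫ x, formDensity p δ (2 - N + 2 * s - c) (quadF N b c s) v x := by
  have hu := hv.norm_rpow_mul (-s)
  have hm := hv.regDual hδ p
  have hΘ := hm.norm_rpow_mul (2 - N + s)
  have hsub : ∀ x, x ∉ tsupport v → regDual p δ (v x) = 0 := fun x hx => by
    rw [image_eq_zero_of_notMem_tsupport hx, regDual_zero]
  set u : E N → ℂ := fun y => ((‖y‖ ^ (-s) : ℝ) : ℂ) * v y with hu_def
  set Θ : E N → ℂ := fun y => ((‖y‖ ^ (2 - N + s) : ℝ) : ℂ) * regDual p δ (v y) with hΘ_def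
  have hu1 := hu.contDiff_one
  have i1 : Integrable fun x => Laplacian.laplacian u x * Θ x := by
    refine hΘ.integrable_mul ?_
    rw [funext (laplacian_eq_sum_partialD hu.contDiff_two)]
    refine (continuous_finsetSum _ fun i _ => ?_).continuousOn
    exact (contDiff_partialD (m := 0) (contDiff_partialD (m := 1) hu.contDiff_two (by norm_num) i)
      (by norm_num) i).continuous
  have i2 : Integrable fun x => ((c / ‖x‖ ^ 2 : ℝ) : ℂ) * fderiv ℝ u x x * Θ x :=
    hΘ.integrable_mul ((continuousOn_ofReal_div_norm_sq c).mul
      (continuous_fderiv_apply_self hu1).continuousOn)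
  have i3 : Integrable fun x => ((b / ‖x‖ ^ 2 : ℝ) : ℂ) * u x * Θ x :=
    hΘ.integrable_mul ((continuousOn_ofReal_div_norm_sq b).mul hu1.continuous.continuousOn)
  have i4 : Integrable fun x => ∑ i, partialD i u x * partialD i Θ x := by
    refine integrable_of_continuousOn_compact hΘ.2.1 (continuous_finsetSum _ fun i _ =>
      (contDiff_partialD (m := 0) hu1 (by norm_num) i).continuous.mul
      (contDiff_partialD (m := 0) hΘ.contDiff_one (by norm_num) i).continuous).continuousOn
      fun x hx => by simp [partialD, fderiv_eq_zero_of_notMem_tsupport hx]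
  have hvm : IsTest (Omega N) fun y => v y * regDual p δ (v y) :=
    hv.of_contDiffAt (fun x hx => by simp [hx]) fun x _ => (hv.1.mul hm.1).contDiffAt
  have hpow : ContDiff ℝ 1 fun y => regPow p δ (v y) := (contDiff_regPow hδ p).comp hv.contDiff_one
  have hpows : tsupport (fun y => regPow p δ (v y)) ⊆ tsupport v :=
    tsupport_comp_subset (regPow_zero p δ) v
  have hpowc : HasCompactSupport fun y => regPow p δ (v y) :=
    hv.2.1.of_isClosed_subset (isClosed_tsupport _) hpows
  have hpow0 : (0 : E N) ∉ tsupport fun y => regPow p δ (v y) :=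
    fun h => hv.zero_notMem_tsupport (hpows h)
  have i5 := integrable_norm_rpow_smul_radial hvm.contDiff_one hvm.2.1 hvm.zero_notMem_tsupport
    (-(N : ℝ))
  have i6 := integrable_norm_rpow_smul_radial hpow hpowc hpow0 (-(N : ℝ))
  have r1 := integral_norm_rpow_smul_radial_eq_zero hvm.contDiff_one hvm.2.1
    hvm.zero_notMem_tsupport
  have r2 := integral_norm_rpow_smul_radial_eq_zero hpow hpowc hpow0
  have i7 := integrable_formDensity (p := p) (k := 2 - N + 2 * s - c) (f := quadF N b c s) hδ hv
  have e1 : ∀ x, opL α b c u x * (((‖x‖ ^ (2 - N + s - α) : ℝ) : ℂ) * regDual p δ (v x)) =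
      Laplacian.laplacian u x * Θ x + (((c / ‖x‖ ^ 2 : ℝ) : ℂ) * fderiv ℝ u x x * Θ x -
        ((b / ‖x‖ ^ 2 : ℝ) : ℂ) * u x * Θ x) := by
    intro x
    by_cases hx : x ∈ tsupport v
    · exact opL_mul_eq u (hv.2.2 hx).1 _
    · simp [hΘ_def, hsub x hx]
  have e2 : ∀ x, (∑ i, partialD i u x * partialD i Θ x) -
      (((c / ‖x‖ ^ 2 : ℝ) : ℂ) * fderiv ℝ u x x * Θ x - ((b / ‖x‖ ^ 2 : ℝ) : ℂ) * u x * Θ x) =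
      formDensity p δ (2 - N + 2 * s - c) (quadF N b c s) v x
      - (s : ℂ) * (‖x‖ ^ (-N : ℝ) • fderiv ℝ (fun y => v y * regDual p δ (v y)) x x)
      + (((2 - N + 2 * s - c) / p : ℝ) : ℂ) *
        ((‖x‖ ^ (-N : ℝ) • fderiv ℝ (fun y => regPow p δ (v y)) x x : ℝ) : ℂ) := by
    intro x
    by_cases hx : x ∈ tsupport v
    · rw [← grad_mul_grad_eq_formDensity hp hδ b c s hv.contDiff_one (hv.2.2 hx).1]
      simp only [hu_def, hΘ_def]
      ring
    · have hx1 : x ∉ tsupport Θ := fun h => hx (tsupport_subset_tsupport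
        (fun y hy => by simp [hΘ_def, hy, regDual_zero]) h)
      have hx2 : x ∉ tsupport fun y => v y * regDual p δ (v y) := fun h =>
        hx (tsupport_subset_tsupport (fun y hy => by simp [hy]) h)
      have hx3 : Θ x = 0 := image_eq_zero_of_notMem_tsupport hx1
      simp [partialD, fderiv_eq_zero_of_notMem_tsupport hx1, fderiv_eq_zero_of_notMem_tsupport hx2,
        fderiv_eq_zero_of_notMem_tsupport (fun h => hx (hpows h)), formDensity_eq_zero hx, hx3]
  have i23 : Integrable fun x => ((c / ‖x‖ ^ 2 : ℝ) : ℂ) * fderiv ℝ u x x * Θ x -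
      ((b / ‖x‖ ^ 2 : ℝ) : ℂ) * u x * Θ x := i2.sub i3
  have i57 : Integrable fun x => formDensity p δ (2 - N + 2 * s - c) (quadF N b c s) v x -
      (s : ℂ) * (‖x‖ ^ (-N : ℝ) • fderiv ℝ (fun y => v y * regDual p δ (v y)) x x) :=
    i7.sub (i5.const_mul _)
  have i6c : Integrable fun x => ((‖x‖ ^ (-N : ℝ) •
      fderiv ℝ (fun y => regPow p δ (v y)) x x : ℝ) : ℂ) := i6.ofReal
  have r2c : ∫ x, ((‖x‖ ^ (-N : ℝ) • fderiv ℝ (fun y => regPow p δ (v y)) x x : ℝ) : ℂ) = 0 := by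
    rw [integral_complex_ofReal, r2, Complex.ofReal_zero]
  simp_rw [e1]
  rw [integral_add i1 i23, integral_laplacian_mul hu.contDiff_two hΘ.contDiff_one hΘ.2.1,
    neg_add, neg_neg, ← sub_eq_add_neg, ← integral_sub i4 i23]
  simp_rw [e2]
  rw [integral_add i57 (i6c.const_mul _),
    integral_sub i7 (i5.const_mul _), integral_const_mul, integral_const_mul, r1, r2c]
  simp

end FormIdentity

/-! ### The numerical range of `L_min` -/

section MinimalOperator

variable {N : ℕ}

lemma opL_eq_zero {α b c : ℝ} {u : E N → ℂ} (hu : ContDiff ℝ 2 u) {x : E N} (hx : x ∉ tsupport u) :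
    opL α b c u x = 0 := by
  have h : ∀ i, partialD i (partialD i u) x = 0 := fun i =>
    image_eq_zero_of_notMem_tsupport fun h =>
      hx (tsupport_partialD_subset i u (tsupport_partialD_subset i _ h))
  simp [opL, laplacian_eq_sum_partialD hu, h, fderiv_eq_zero_of_notMem_tsupport hx,
    image_eq_zero_of_notMem_tsupport hx]

lemma tsupport_opL_subset {α b c : ℝ} {u : E N → ℂ} (hu : ContDiff ℝ 2 u) :
    tsupport (opL α b c u) ⊆ tsupport u := by
  refine closure_minimal (fun x hx => ?_) (isClosed_tsupport _)
  by_contra h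
  exact hx (opL_eq_zero hu h)

lemma continuousAt_norm_rpow {x : E N} (hx : x ≠ 0) (a : ℝ) :
    ContinuousAt (fun y : E N => ‖y‖ ^ a) x :=
  continuous_norm.continuousAt.rpow_const (Or.inl (norm_ne_zero_iff.2 hx))

lemma continuous_opL {α b c : ℝ} {u : E N → ℂ} (hu : IsTest (Omega N) u) :
    Continuous (opL α b c u) := by
  refine continuous_of_tsupport fun x hx => ?_
  have hx0 : x ≠ 0 := (hu.2.2 (tsupport_opL_subset hu.contDiff_two hx)).1
  have hr := fun a => Complex.continuous_ofReal.continuousAt.comp (continuousAt_norm_rpow hx0 a)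
  have hr' := fun k a => Complex.continuous_ofReal.continuousAt.comp
    ((continuousAt_const (y := k)).mul (continuousAt_norm_rpow hx0 a))
  have hl : Continuous (Laplacian.laplacian u) := by
    rw [funext (laplacian_eq_sum_partialD hu.contDiff_two)]
    exact continuous_finsetSum _ fun i _ => (contDiff_partialD (m := 0)
      (contDiff_partialD (m := 1) hu.contDiff_two (by norm_num) i) (by norm_num) i).continuous
  have hd : ContinuousAt (fun y => fderiv ℝ u y (‖y‖⁻¹ • y)) x :=
    (hu.contDiff_one.continuous_fderiv one_ne_zero).continuousAt.clm_apply
      ((continuous_norm.continuousAt.inv₀ (norm_ne_zero_iff.2 hx0)).smul continuousAt_id)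
  exact (((hr α).mul hl.continuousAt).add ((hr' c _).mul hd)).sub
    ((hr' b _).mul hu.1.continuous.continuousAt)

lemma hasCompactSupport_opL {α b c : ℝ} {u : E N → ℂ} (hu : IsTest (Omega N) u) :
    HasCompactSupport (opL α b c u) :=
  hu.2.1.of_isClosed_subset (isClosed_tsupport _) (tsupport_opL_subset hu.contDiff_two)

lemma norm_regDual_le {p δ : ℝ} (hδ : 0 < δ) (z : ℂ) :
    ‖regDual p δ z‖ ≤ (‖z‖ ^ 2 + δ) ^ ((p - 1) / 2) := by
  have hq : 0 < ‖z‖ ^ 2 + δ := by positivity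
  rw [regDual, norm_mul, RCLike.norm_conj, Complex.norm_real, Real.norm_of_nonneg (by positivity),
    show (p - 1) / 2 = 1 / 2 + (p - 2) / 2 by ring, Real.rpow_add hq]
  refine mul_le_mul_of_nonneg_right ?_ (by positivity)
  rw [← Real.sqrt_eq_rpow]
  exact Real.le_sqrt_of_sq_le (by linarith)

lemma norm_sq_rpow_half (z : ℂ) (a : ℝ) : (‖z‖ ^ 2) ^ (a / 2) = ‖z‖ ^ a := by
  rw [← Real.rpow_natCast, ← Real.rpow_mul (norm_nonneg _)]
  congr 1; push_cast; ring

lemma tendsto_regDual (p : ℝ) (z : ℂ) {δ : ℕ → ℝ} (hδ : Tendsto δ atTop (𝓝 0)) :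
    Tendsto (fun n => regDual p (δ n) z) atTop (𝓝 (dualFun p z)) := by
  rcases eq_or_ne z 0 with rfl | hz
  · simp [regDual_zero, dualFun]
  · have hn : 0 < ‖z‖ := norm_pos_iff.2 hz
    rw [dualFun, ← norm_sq_rpow_half]
    refine tendsto_const_nhds.mul ((Complex.continuous_ofReal.tendsto _).comp ?_)
    have h : Tendsto (fun n => ‖z‖ ^ 2 + δ n) atTop (𝓝 (‖z‖ ^ 2)) := by
      simpa using tendsto_const_nhds.add hδ
    exact h.rpow_const (Or.inl (by positivity))

/-- The form `-∫ L u ū|u|^(p-2)` as a limit of regularized forms. -/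
lemma tendsto_integral_formDensity {p : ℝ} (hp : 1 < p) (α b c : ℝ) {v : E N → ℂ}
    (hv : IsTest (Omega N) v) {s : ℝ} (hs : s * p = N - 2 + α) :
    Tendsto (fun n : ℕ => ∫ x, formDensity p (1 / ((n : ℝ) + 1)) (2 - N + 2 * s - c)
      (quadF N b c s) v x) atTop
      (𝓝 (-∫ x, opL α b c (fun y => ((‖y‖ ^ (-s) : ℝ) : ℂ) * v y) x *
        dualFun p (((‖x‖ ^ (-s) : ℝ) : ℂ) * v x))) := by
  have hδ : ∀ n : ℕ, (0 : ℝ) < 1 / ((n : ℝ) + 1) := fun n => by positivity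
  simp_rw [← fun n => neg_integral_opL_mul_regDual (by linarith : p ≠ 0) (hδ n) α b c s hv]
  refine Tendsto.neg ?_
  have hu := hv.norm_rpow_mul (-s)
  set u : E N → ℂ := fun y => ((‖y‖ ^ (-s) : ℝ) : ℂ) * v y with hu_def
  have hsup : tsupport u ⊆ tsupport v := tsupport_subset_tsupport fun x hx => by simp [hu_def, hx]
  have hne : ∀ x ∈ tsupport v, x ≠ 0 := fun x hx => (hv.2.2 hx).1
  refine tendsto_integral_of_dominated_convergence
    (fun x => ‖opL α b c u x‖ * (‖x‖ ^ (2 - N + s - α) * (‖v x‖ ^ 2 + 1) ^ ((p - 1) / 2)))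
    (fun n => ?_) ?_ (fun n => Eventually.of_forall fun x => ?_)
    (Eventually.of_forall fun x => ?_)
  · refine (continuous_opL hu).aestronglyMeasurable.mul (AEStronglyMeasurable.mul ?_ ?_)
    · exact (Complex.measurable_ofReal.comp (measurable_norm.pow_const _)).aestronglyMeasurable
    · exact ((contDiff_regDual (hδ n) p (n := 0)).continuous.comp
        hv.1.continuous).aestronglyMeasurable
  · refine integrable_of_continuousOn_compact hv.2.1 ?_ fun x hx => by
      simp [opL_eq_zero hu.contDiff_two fun h => hx (hsup h)]
    refine (continuous_opL hu).norm.continuousOn.mul ((continuousOn_norm_rpow _ hne).mul ?_)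
    exact ((contDiff_norm_sq_add_rpow one_pos _ (n := 0)).continuous.comp
      hv.1.continuous).continuousOn
  · rw [norm_mul, norm_mul, Complex.norm_real, Real.norm_of_nonneg (by positivity)]
    gcongr
    refine (norm_regDual_le (hδ n) _).trans ?_
    have : 1 / ((n : ℝ) + 1) ≤ 1 := by
      rw [div_le_one (by positivity)]
      have : (0 : ℝ) ≤ n := by positivity
      linarith
    exact Real.rpow_le_rpow (by positivity) (by linarith) (by linarith)
  · rw [dualFun_real_smul hp (by positivity)]
    refine tendsto_const_nhds.mul ?_
    by_cases hx : x = 0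
    · subst hx
      have : v 0 = 0 := image_eq_zero_of_notMem_tsupport hv.zero_notMem_tsupport
      simp [this, regDual_zero, dualFun]
    -- This is where s is fixed: sp = N-2+α makes the weight |x|^(2-N+s-α) of the multiplier equal
    -- to |x|^(-s(p-1)), the weight produced by the dual function of |x|^(-s)v.
    · rw [← Real.rpow_mul (norm_nonneg _), show -s * (p - 1) = 2 - N + s - α by linarith]
      exact tendsto_const_nhds.mul (tendsto_regDual p _ tendsto_one_div_add_atTop_nhds_zero_nat)

lemma IsTest.eq_norm_rpow_neg_mul {u : E N → ℂ} (hu : IsTest (Omega N) u) (s : ℝ) :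
    u = fun x => ((‖x‖ ^ (-s) : ℝ) : ℂ) * (((‖x‖ ^ s : ℝ) : ℂ) * u x) := by
  ext x
  by_cases hx : x = 0
  · have : u x = 0 := by
      rw [hx]; exact image_eq_zero_of_notMem_tsupport hu.zero_notMem_tsupport
    simp [this]
  · rw [← mul_assoc, ← Complex.ofReal_mul, ← Real.rpow_add (norm_pos_iff.2 hx)]
    simp

/-- The substitution v = |x|^s u puts every regularized form in the sector, since the sector is a
closed convex cone; the limit δ → 0 stays there. -/
lemma neg_integral_opL_mul_dualFun_mem_sector {p : ℝ} (hp : 1 < p) {α b c l : ℝ} {s : ℝ}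
    (hs : s * p = N - 2 + α) (hf : 0 ≤ quadF N b c s) (hl : 0 ≤ l)
    (hl1 : |p - 2| + |2 - N + 2 * s - c| / 2 ≤ l * min 1 (p - 1))
    (hl2 : |2 - N + 2 * s - c| / 2 ≤ l * quadF N b c s) {u : E N → ℂ}
    (hu : IsTest (Omega N) u) : -∫ x, opL α b c u x * dualFun p (u x) ∈ sector l := by
  have hv := hu.norm_rpow_mul s
  have h := tendsto_integral_formDensity hp α b c hv hs
  rw [← hu.eq_norm_rpow_neg_mul s] at h
  have h' : ∀ x, dualFun p (((‖x‖ ^ (-s) : ℝ) : ℂ) * (((‖x‖ ^ s : ℝ) : ℂ) * u x)) =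
      dualFun p (u x) := fun x => congrArg _ (congrFun (hu.eq_norm_rpow_neg_mul s).symm x)
  simp_rw [h'] at h
  refine (isClosed_sector l).mem_of_tendsto h (Eventually.of_forall fun n => ?_)
  have hδ : (0 : ℝ) < 1 / ((n : ℝ) + 1) := by positivity
  refine integral_mem_sector (integrable_formDensity hδ hv) fun x => ?_
  by_cases hx : x = 0
  · rw [formDensity_eq_zero fun h => (hv.2.2 h).1 hx]
    simp [sector]
  · exact formDensity_mem_sector hp hδ hf hl hl1 hl2 _ hx

/-- For the real part the term with k is invisible, so no compatibility between k and f is required.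
This matters at f = 0, where k may be nonzero and the sector estimate is unavailable. -/
lemma re_integral_opL_mul_dualFun_nonpos {p : ℝ} (hp : 1 < p) {α b c : ℝ} {s : ℝ}
    (hs : s * p = N - 2 + α) (hf : 0 ≤ quadF N b c s) {u : E N → ℂ}
    (hu : IsTest (Omega N) u) : (∫ x, opL α b c u x * dualFun p (u x)).re ≤ 0 := by
  have hv := hu.norm_rpow_mul s
  have h := tendsto_integral_formDensity hp α b c hv hs
  rw [← hu.eq_norm_rpow_neg_mul s] at h
  have h' : ∀ x, dualFun p (((‖x‖ ^ (-s) : ℝ) : ℂ) * (((‖x‖ ^ s : ℝ) : ℂ) * u x)) =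
      dualFun p (u x) := fun x => congrArg _ (congrFun (hu.eq_norm_rpow_neg_mul s).symm x)
  simp_rw [h'] at h
  have h2 := (isClosed_le continuous_const Complex.continuous_re).mem_of_tendsto h
    (Eventually.of_forall fun n => show (0 : ℝ) ≤ _ from ?_)
  · have h3 : 0 ≤ (-∫ x, opL α b c u x * dualFun p (u x)).re := h2
    rw [Complex.neg_re] at h3
    linarith
  · have hδ : (0 : ℝ) < 1 / ((n : ℝ) + 1) := by positivity
    have hre := integral_re (𝕜 := ℂ) (integrable_formDensity (p := p) (k := 2 - N + 2 * s - c)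
      (f := quadF N b c s) hδ hv)
    refine le_of_le_of_eq ?_ hre
    exact integral_nonneg fun x => re_formDensity_nonneg hp hδ hf _ x

lemma isOpen_Omega : IsOpen (Omega N) := by
  have : Omega N = {0}ᶜ ∩ ⋂ i : Fin N, {x : E N | N = 1 → 0 < x i} := by
    ext x
    simp only [Omega, Set.mem_ofPred_eq, Set.mem_inter_iff, Set.mem_compl_iff,
      Set.mem_singleton_iff, Set.mem_iInter]
    exact and_congr_right fun _ => ⟨fun h i hN => h hN i, fun h hN i => h i hN⟩
  rw [this]
  refine isOpen_compl_singleton.inter (isOpen_iInter_of_finite fun i => ?_)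
  by_cases hN : N = 1
  · simp only [hN, forall_const]
    exact isOpen_lt continuous_const (EuclideanSpace.proj i : E N →L[ℝ] ℝ).continuous
  · simp [hN]

lemma dualPairing_eq_of_graphTest {p : ℝ≥0∞} {α b c : ℝ} {u w : LpOn p (Omega N)} {φ : E N → ℂ}
    (hφ : IsTest (Omega N) φ) (hu : u =ᵐ[volume.restrict (Omega N)] φ)
    (hw : w =ᵐ[volume.restrict (Omega N)] opL α b c φ) :
    dualPairing u w = ∫ x, opL α b c φ x * dualFun p.toReal (φ x) := by
  rw [← setIntegral_eq_integral_of_forall_compl_eq_zero (s := Omega N)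
    (f := fun x => opL α b c φ x * dualFun p.toReal (φ x)) fun x hx => by
      rw [opL_eq_zero hφ.contDiff_two fun h => hx (hφ.2.2 h), zero_mul]]
  refine integral_congr_ae ?_
  filter_upwards [hu, hw] with x h1 h2
  rw [h1, h2]

/-- The condition is closed in the pair (u, w), so its validity on test functions extends to the
closure of the graph. -/
lemma neg_dualPairing_Lmin_mem_sector {p : ℝ≥0∞} [Fact (1 ≤ p)] (hp1 : 1 < p) (hp : p ≠ ⊤)
    {α b c l s : ℝ} (hs : s * p.toReal = N - 2 + α) (hf : 0 ≤ quadF N b c s) (hl : 0 ≤ l)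
    (hl1 : |p.toReal - 2| + |2 - N + 2 * s - c| / 2 ≤ l * min 1 (p.toReal - 1))
    (hl2 : |2 - N + 2 * s - c| / 2 ≤ l * quadF N b c s) {u w : LpOn p (Omega N)}
    (h : (u, w) ∈ Lmin N p α b c) : -dualPairing u w ∈ sector l := by
  refine closure_minimal (t := {q : LpOn p (Omega N) × LpOn p (Omega N) |
    -dualPairing q.1 q.2 ∈ sector l}) ?_ (isClosed_dualPairing_sector hp1 hp l) h
  rintro ⟨u, w⟩ ⟨φ, hφ, h1, h2⟩
  change -dualPairing u w ∈ sector l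
  rw [dualPairing_eq_of_graphTest hφ h1 h2]
  exact neg_integral_opL_mul_dualFun_mem_sector (one_lt_toReal hp1 hp) hs hf hl hl1 hl2 hφ

lemma isDissipative_Lmin {p : ℝ≥0∞} [Fact (1 ≤ p)] (hp1 : 1 < p) (hp : p ≠ ⊤)
    {α b c s : ℝ} (hs : s * p.toReal = N - 2 + α) (hf : 0 ≤ quadF N b c s) :
    IsDissipative (Lmin N p α b c) := by
  rw [isDissipative_iff_dualPairing hp1 hp]
  intro u w h
  refine closure_minimal (t := {q : LpOn p (Omega N) × LpOn p (Omega N) |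
    ((1 : ℂ) * dualPairing q.1 q.2).re ≤ 0}) ?_ (isClosed_dualPairing_re_nonpos hp1 hp 1) h
    |> fun h => by simpa using h
  rintro ⟨u, w⟩ ⟨φ, hφ, h1, h2⟩
  change ((1 : ℂ) * dualPairing u w).re ≤ 0
  rw [one_mul, dualPairing_eq_of_graphTest hφ h1 h2]
  exact re_integral_opL_mul_dualFun_nonpos (one_lt_toReal hp1 hp) hs hf hφ

end MinimalOperator

/-! ### Necessity of the dissipativity condition -/

section Necessity

variable {N : ℕ}

/-- The closed logarithmic annulus `{x ∈ Ω : e^a ≤ |x| ≤ e^b}`. -/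
def logAnnulus (N : ℕ) (a b : ℝ) : Set (E N) :=
  {x | x ∈ Omega N ∧ Real.exp a ≤ ‖x‖ ∧ ‖x‖ ≤ Real.exp b}

/-- In dimension one the condition 0 < x is not closed by itself, but the positive lower bound on
‖x‖ lets it be relaxed to 0 ≤ x. -/
lemma isClosed_logAnnulus (a b : ℝ) : IsClosed (logAnnulus N a b) := by
  have : logAnnulus N a b = (⋂ i : Fin N, {x : E N | N = 1 → 0 ≤ x i}) ∩
      {x | Real.exp a ≤ ‖x‖} ∩ {x | ‖x‖ ≤ Real.exp b} := by
    ext x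
    simp only [logAnnulus, Omega, Set.mem_ofPred_eq, Set.mem_inter_iff, Set.mem_iInter]
    constructor
    · rintro ⟨⟨-, h⟩, h1, h2⟩
      exact ⟨⟨fun i hN => (h hN i).le, h1⟩, h2⟩
    · rintro ⟨⟨h, h1⟩, h2⟩
      have hx : x ≠ 0 := fun h0 => by
        rw [h0, norm_zero] at h1; exact absurd h1 (not_le.2 (Real.exp_pos a))
      refine ⟨⟨hx, fun hN i => lt_of_le_of_ne (h i hN) fun h0 => hx ?_⟩, h1, h2⟩
      subst hN
      ext j
      rw [Subsingleton.elim j i, ← h0]; rfl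
  rw [this]
  refine ((isClosed_iInter fun i => ?_).inter (isClosed_le continuous_const continuous_norm)).inter
    (isClosed_le continuous_norm continuous_const)
  by_cases hN : N = 1
  · simp only [hN, forall_const]
    exact isClosed_le continuous_const (EuclideanSpace.proj i : E N →L[ℝ] ℝ).continuous
  · simp [hN]

lemma isCompact_logAnnulus (a b : ℝ) : IsCompact (logAnnulus N a b) :=
  Metric.isCompact_of_isClosed_isBounded (isClosed_logAnnulus a b)
    ((Metric.isBounded_closedBall (x := (0 : E N)) (r := Real.exp b)).subset
      fun x hx => by simpa using hx.2.2)

lemma logAnnulus_subset_Omega (a b : ℝ) : logAnnulus N a b ⊆ Omega N := fun _ hx => hx.1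

lemma integrableOn_norm_rpow_logAnnulus (a b r : ℝ) :
    IntegrableOn (fun x : E N => ‖x‖ ^ r) (logAnnulus N a b) :=
  (continuousOn_norm_rpow r fun _ hx => hx.1.1).integrableOn_compact (isCompact_logAnnulus a b)

lemma smul_mem_Omega_iff {R : ℝ} (hR : 0 < R) {x : E N} : R • x ∈ Omega N ↔ x ∈ Omega N := by
  simp [Omega, hR, hR.ne']

open scoped Pointwise in
lemma exp_smul_logAnnulus (a b t : ℝ) :
    Real.exp t • logAnnulus N a b = logAnnulus N (a + t) (b + t) := by
  ext x
  rw [Set.mem_smul_set_iff_inv_smul_mem₀ (Real.exp_pos t).ne']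
  simp only [logAnnulus, Set.mem_ofPred_eq, smul_mem_Omega_iff (inv_pos.2 (Real.exp_pos t)),
    norm_smul, norm_inv, Real.norm_of_nonneg (Real.exp_pos t).le, Real.exp_add]
  rw [inv_mul_eq_div, le_div_iff₀ (Real.exp_pos t), div_le_iff₀ (Real.exp_pos t)]

/-- The measure |x|^(-N) dx is invariant under dilations, which act on log|x| as translations. -/
lemma setIntegral_logAnnulus_add (a b t : ℝ) :
    ∫ x in logAnnulus N (a + t) (b + t), ‖x‖ ^ (-N : ℝ) =
      ∫ x in logAnnulus N a b, ‖x‖ ^ (-N : ℝ) := by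
  have h := Measure.setIntegral_comp_smul (volume : Measure (E N))
    (fun x : E N => ‖x‖ ^ (-N : ℝ)) (logAnnulus N a b) (Real.exp_pos t).ne'
  rw [exp_smul_logAnnulus] at h
  have h1 : ∀ x : E N, ‖Real.exp t • x‖ ^ (-N : ℝ) = (Real.exp t ^ N)⁻¹ * ‖x‖ ^ (-N : ℝ) := by
    intro x
    rw [norm_smul, Real.norm_of_nonneg (Real.exp_pos t).le,
      Real.mul_rpow (Real.exp_pos t).le (norm_nonneg _), Real.rpow_neg (Real.exp_pos t).le,
      Real.rpow_natCast]
  simp_rw [h1] at h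
  rw [integral_const_mul, finrank_euclideanSpace_fin, abs_of_pos (by positivity),
    smul_eq_mul] at h
  exact (mul_left_cancel₀ (by positivity) h).symm

/-- The long annulus is covered by two translates, in logarithmic scale, of the short one. -/
lemma setIntegral_logAnnulus_double_le (n : ℝ) :
    ∫ x in logAnnulus N (-(2 * n)) (2 * n), ‖x‖ ^ (-N : ℝ) ≤
      2 * ∫ x in logAnnulus N (-n) n, ‖x‖ ^ (-N : ℝ) := by
  have h1 := setIntegral_logAnnulus_add (N := N) (-n) n n
  have h2 := setIntegral_logAnnulus_add (N := N) (-n) n (-n)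
  have hsub : logAnnulus N (-(2 * n)) (2 * n) ⊆
      logAnnulus N (-n + n) (n + n) ∪ logAnnulus N (-n + -n) (n + -n) := by
    rintro x ⟨h, h3, h4⟩
    rcases le_total 1 ‖x‖ with hx | hx
    · left
      refine ⟨h, ?_, ?_⟩
      · simpa using hx
      · rwa [← two_mul]
    · right
      refine ⟨h, ?_, ?_⟩
      · convert h3 using 2; ring
      · simpa using hx
  have hi1 := integrableOn_norm_rpow_logAnnulus (N := N) (-n + n) (n + n) (-N : ℝ)
  have hi2 := integrableOn_norm_rpow_logAnnulus (N := N) (-n + -n) (n + -n) (-N : ℝ)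
  calc _ ≤ ∫ x in logAnnulus N (-n + n) (n + n) ∪ logAnnulus N (-n + -n) (n + -n),
        ‖x‖ ^ (-N : ℝ) :=
        setIntegral_mono_set (hi1.union hi2) (Eventually.of_forall fun x => by positivity)
          hsub.eventuallyLE
    _ ≤ (∫ x in logAnnulus N (-n + n) (n + n), ‖x‖ ^ (-N : ℝ)) +
        ∫ x in logAnnulus N (-n + -n) (n + -n), ‖x‖ ^ (-N : ℝ) := by
        rw [← integral_add_measure hi1 hi2]
        refine integral_mono_measure (Measure.restrict_union_le _ _)
          (Eventually.of_forall fun x => by positivity) (Integrable.add_measure hi1 hi2)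
    _ = _ := by rw [h1, h2]; ring

lemma setIntegral_logAnnulus_pos (hN : 1 ≤ N) {n : ℝ} (hn : 0 < n) :
    0 < ∫ x in logAnnulus N (-n) n, ‖x‖ ^ (-N : ℝ) := by
  rw [setIntegral_pos_iff_support_of_nonneg_ae (Eventually.of_forall fun x => by positivity)
    (integrableOn_norm_rpow_logAnnulus _ _ _)]
  have hopen : IsOpen (Omega N ∩ {x | Real.exp (-n) < ‖x‖} ∩ {x : E N | ‖x‖ < Real.exp n}) :=
    (isOpen_Omega.inter (isOpen_lt continuous_const continuous_norm)).inter
      (isOpen_lt continuous_norm continuous_const)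
  have hne : (Omega N ∩ {x | Real.exp (-n) < ‖x‖} ∩ {x : E N | ‖x‖ < Real.exp n}).Nonempty := by
    refine ⟨EuclideanSpace.single ⟨0, hN⟩ (1 : ℝ), ⟨⟨?_, ?_⟩, ?_⟩, ?_⟩
    · intro h
      have := congrArg norm h
      simp at this
    · intro h i
      subst h
      rw [Subsingleton.elim i ⟨0, hN⟩]
      simp
    · simpa using hn
    · simpa using hn
  refine (hopen.measure_pos volume hne).trans_le (measure_mono ?_)
  rintro x ⟨⟨h1, h2⟩, h3⟩
  refine ⟨?_, h1, le_of_lt h2, le_of_lt h3⟩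
  exact (Real.rpow_pos_of_pos (norm_pos_iff.2 h1.1) _).ne'

/-- A smooth cutoff on `ℝ`, equal to `1` on `[-1, 1]` and supported in `[-2, 2]`. -/
def unitBump : ContDiffBump (0 : ℝ) := ⟨1, 2, one_pos, one_lt_two⟩

lemma exists_abs_deriv_unitBump_le : ∃ C, 0 ≤ C ∧ ∀ t, |deriv unitBump t| ≤ C := by
  have hc : Continuous (deriv unitBump) := unitBump.contDiff.continuous_deriv le_rfl
  obtain ⟨C, hC⟩ := hc.bounded_above_of_compact_support unitBump.hasCompactSupport.deriv
  exact ⟨C, (norm_nonneg _).trans (hC 0), hC⟩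

/-- The square of a logarithmic cutoff, at scale `n`. -/
def logCutoff (N : ℕ) (n : ℝ) (x : E N) : ℝ :=
  open scoped Classical in if x ∈ Omega N then unitBump (Real.log ‖x‖ / n) ^ 2 else 0

lemma logCutoff_nonneg (n : ℝ) (x : E N) : 0 ≤ logCutoff N n x := by
  unfold logCutoff; split_ifs <;> positivity

lemma logCutoff_le_one (n : ℝ) (x : E N) : logCutoff N n x ≤ 1 := by
  unfold logCutoff
  split_ifs
  · exact pow_le_one₀ unitBump.nonneg unitBump.le_one
  · exact zero_le_one

lemma logCutoff_eq_one {n : ℝ} (hn : 0 < n) {x : E N} (hx : x ∈ logAnnulus N (-n) n) :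
    logCutoff N n x = 1 := by
  have hpos : 0 < ‖x‖ := norm_pos_iff.2 hx.1.1
  have h1 : -n ≤ Real.log ‖x‖ := (Real.le_log_iff_exp_le hpos).2 hx.2.1
  have h2 : Real.log ‖x‖ ≤ n := (Real.log_le_iff_le_exp hpos).2 hx.2.2
  rw [logCutoff, if_pos hx.1, unitBump.one_of_mem_closedBall, one_pow]
  rw [mem_closedBall_zero_iff, Real.norm_eq_abs, abs_div, abs_of_pos hn, div_le_iff₀ hn,
    abs_le]
  change -(1 * n) ≤ _ ∧ _ ≤ 1 * n
  constructor <;> linarith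

lemma mem_logAnnulus_of_logCutoff_ne_zero {n : ℝ} (hn : 0 < n) {x : E N}
    (hx : logCutoff N n x ≠ 0) : x ∈ logAnnulus N (-(2 * n)) (2 * n) := by
  unfold logCutoff at hx
  split_ifs at hx with hΩ
  · have hpos : 0 < ‖x‖ := norm_pos_iff.2 hΩ.1
    have hb : Real.log ‖x‖ / n ∈ Metric.ball (0 : ℝ) 2 := by
      by_contra h
      refine hx ?_
      rw [unitBump.zero_of_le_dist, zero_pow two_ne_zero]
      exact not_lt.1 h
    rw [mem_ball_zero_iff, Real.norm_eq_abs, abs_div, abs_of_pos hn, div_lt_iff₀ hn, abs_lt] at hb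
    exact ⟨hΩ, (Real.le_log_iff_exp_le hpos).1 hb.1.le, (Real.log_le_iff_le_exp hpos).1 hb.2.le⟩
  · exact absurd rfl hx

lemma logCutoff_eventuallyEq (n : ℝ) {x : E N} (hx : x ∈ Omega N) :
    logCutoff N n =ᶠ[𝓝 x] fun y => unitBump (Real.log ‖y‖ / n) ^ 2 := by
  filter_upwards [isOpen_Omega.mem_nhds hx] with y hy
  rw [logCutoff, if_pos hy]

lemma contDiffAt_logCutoff (n : ℝ) {x : E N} (hx : x ∈ Omega N) :
    ContDiffAt ℝ ∞ (logCutoff N n) x := by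
  refine ContDiffAt.congr_of_eventuallyEq ?_ (logCutoff_eventuallyEq n hx)
  have h1 : ContDiffAt ℝ ∞ (fun y : E N => Real.log ‖y‖ / n) x :=
    ((contDiffAt_norm ℝ hx.1).log (norm_ne_zero_iff.2 hx.1)).div_const n
  exact (unitBump.contDiff.contDiffAt.comp x h1).pow 2

lemma tsupport_logCutoff_subset {n : ℝ} (hn : 0 < n) :
    tsupport (fun x => (logCutoff N n x : ℂ)) ⊆ logAnnulus N (-(2 * n)) (2 * n) :=
  closure_minimal (fun x hx => mem_logAnnulus_of_logCutoff_ne_zero hn fun h => hx (by simp [h]))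
    (isClosed_logAnnulus _ _)

lemma isTest_logCutoff {n : ℝ} (hn : 0 < n) :
    IsTest (Omega N) fun x => (logCutoff N n x : ℂ) := by
  have hsub := tsupport_logCutoff_subset (N := N) hn
  refine ⟨contDiff_of_forall_mem_tsupport fun x hx => ?_,
    (isCompact_logAnnulus _ _).of_isClosed_subset (isClosed_tsupport _) hsub,
    hsub.trans (logAnnulus_subset_Omega _ _)⟩
  exact Complex.ofRealCLM.contDiff.contDiffAt.comp x (contDiffAt_logCutoff n (hsub hx).1)

lemma hasFDerivAt_logCutoff {n : ℝ} {x : E N} (hx : x ∈ Omega N) :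
    HasFDerivAt (logCutoff N n) ((2 * unitBump (Real.log ‖x‖ / n) *
      deriv unitBump (Real.log ‖x‖ / n) / (n * ‖x‖ ^ 2)) • innerSL ℝ x) x := by
  have hpos : 0 < ‖x‖ := norm_pos_iff.2 hx.1
  refine HasFDerivAt.congr_of_eventuallyEq ?_ (logCutoff_eventuallyEq n hx)
  have h0 : HasFDerivAt (fun y : E N => ‖y‖) (‖x‖⁻¹ • innerSL ℝ x) x := by
    have := hasFDerivAt_norm_rpow_of_ne_zero hx.1 1
    simp only [Real.rpow_one, one_mul] at this
    rwa [show (1 : ℝ) - 2 = -1 by norm_num, Real.rpow_neg_one] at this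
  have h1 := ((h0.log hpos.ne').mul_const n⁻¹)
  have h2 : HasDerivAt unitBump (deriv unitBump (Real.log ‖x‖ * n⁻¹)) (Real.log ‖x‖ * n⁻¹) :=
    (unitBump.contDiff.differentiable (n := 1) one_ne_zero _).hasDerivAt
  have h3 := (h2.comp_hasFDerivAt x h1).pow 2
  simp only [Function.comp_def, ← div_eq_mul_inv] at h3
  refine h3.congr_fderiv ?_
  ext e
  simp only [smul_apply, smul_eq_mul]
  simp
  field_simp

/-- Squaring the bump leaves a factor v in |∇v|². For p < 2 this factor compensates the growth of
(v²+δ)^((p-2)/2) where v is small, uniformly in δ. -/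
lemma sum_norm_partialD_logCutoff_sq {n : ℝ} {x : E N} (hx : x ∈ Omega N) :
    ∑ i, ‖partialD i (fun x => (logCutoff N n x : ℂ)) x‖ ^ 2 =
      4 * logCutoff N n x * deriv unitBump (Real.log ‖x‖ / n) ^ 2 / (n ^ 2 * ‖x‖ ^ 2) := by
  have hpos : 0 < ‖x‖ := norm_pos_iff.2 hx.1
  have h : ∀ i, partialD i (fun x => (logCutoff N n x : ℂ)) x =
      ((2 * unitBump (Real.log ‖x‖ / n) *
      deriv unitBump (Real.log ‖x‖ / n) / (n * ‖x‖ ^ 2) * x i : ℝ) : ℂ) := by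
    intro i
    have h1 : HasFDerivAt (fun x => (logCutoff N n x : ℂ)) _ x :=
      Complex.ofRealCLM.hasFDerivAt.comp x (hasFDerivAt_logCutoff (n := n) hx)
    rw [partialD, h1.fderiv, ← inner_single_right x i]
    rfl
  simp_rw [h, Complex.norm_real, Real.norm_eq_abs, sq_abs, mul_pow _ (x.ofLp _)]
  rw [← Finset.mul_sum, sum_coord_sq, logCutoff, if_pos hx]
  field_simp
  ring

/-- The gradient term lives on the long annulus with a factor n^(-2). The zeroth order term is
nonpositive everywhere and is kept only on the short annulus, where the cutoff is 1. -/
lemma re_formDensity_logCutoff_le {p δ f k n C : ℝ} (hp : 1 < p) (hδ : 0 < δ) (hδ1 : δ ≤ 1)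
    (hf : f ≤ 0) (hn : 0 < n) (hC : ∀ t, |deriv unitBump t| ≤ C) (x : E N) :
    (formDensity p δ k f (fun x => (logCutoff N n x : ℂ)) x).re ≤
      (logAnnulus N (-(2 * n)) (2 * n)).indicator (fun x => 4 * p * C ^ 2 * 2 ^ ((p - 1) / 2) /
        n ^ 2 * ‖x‖ ^ (-N : ℝ)) x +
      (logAnnulus N (-n) n).indicator (fun x => f * 2 ^ (-|(p - 2) / 2|) * ‖x‖ ^ (-N : ℝ)) x := by
  have hsub : logAnnulus N (-n) n ⊆ logAnnulus N (-(2 * n)) (2 * n) := fun y hy =>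
    ⟨hy.1, (Real.exp_le_exp.2 (by linarith)).trans hy.2.1,
      hy.2.2.trans (Real.exp_le_exp.2 (by linarith))⟩
  by_cases hx : x ∈ logAnnulus N (-(2 * n)) (2 * n)
  · rw [Set.indicator_of_mem hx, re_formDensity]
    have hΩ := hx.1
    have hpos : 0 < ‖x‖ := norm_pos_iff.2 hΩ.1
    have hr : ‖x‖ ^ (2 - N : ℝ) = ‖x‖ ^ 2 * ‖x‖ ^ (-N : ℝ) := by
      rw [← Real.rpow_natCast, ← Real.rpow_add hpos]; congr 1
    have h1 := re_sum_mul_fderiv_regDual_le hp hδ (logCutoff N n x : ℂ)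
      (fun i => partialD i (fun x => (logCutoff N n x : ℂ)) x)
    rw [sum_norm_partialD_logCutoff_sq hΩ] at h1
    have h2 := norm_regDual_le (p := p) hδ (logCutoff N n x : ℂ)
    rw [regDual, norm_mul, RCLike.norm_conj, Complex.norm_real, Complex.norm_real,
      Real.norm_of_nonneg (logCutoff_nonneg n x), Real.norm_of_nonneg (by positivity)] at h2
    rw [Complex.norm_real, Real.norm_of_nonneg (logCutoff_nonneg n x)] at h1 ⊢
    have hv0 := logCutoff_nonneg n x
    have hv1 := logCutoff_le_one n x
    set v := logCutoff N n x with hv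
    set Q := (v ^ 2 + δ) ^ ((p - 2) / 2) with hQd
    have hQ : 0 ≤ Q := by positivity
    set ρ := ‖x‖ ^ (-N : ℝ)
    have hρ : 0 ≤ ρ := by positivity
    -- Here v Q ≤ (v²+δ)^((p-1)/2), with v and δ at most 1. The bound does not depend on δ.
    have h3 : v * Q ≤ 2 ^ ((p - 1) / 2) :=
      h2.trans (Real.rpow_le_rpow (by positivity) (by nlinarith) (by linarith))
    have h4 : deriv unitBump (Real.log ‖x‖ / n) ^ 2 ≤ C ^ 2 := by
      rw [← sq_abs]; gcongr; exact hC _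
    refine add_le_add ?_ ?_
    · rw [hr]
      calc _ ≤ ‖x‖ ^ 2 * ρ * (Q * (p * (4 * v * deriv unitBump (Real.log ‖x‖ / n) ^ 2 /
            (n ^ 2 * ‖x‖ ^ 2)))) := mul_le_mul_of_nonneg_left h1 (by positivity)
        _ = 4 * p * deriv unitBump (Real.log ‖x‖ / n) ^ 2 * (v * Q) / n ^ 2 * ρ := by
            field_simp
        _ ≤ _ := by gcongr
    · by_cases hx1 : x ∈ logAnnulus N (-n) n
      · rw [Set.indicator_of_mem hx1]
        have hv' : v = 1 := logCutoff_eq_one hn hx1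
        -- With v = 1 the base 1+δ lies in [1, 2], so the power is bounded below whatever the sign
        -- of p-2.
        have hQ1 : 2 ^ (-|(p - 2) / 2|) ≤ Q := by
          rw [hQd, hv']
          have h5 : (2 : ℝ) ^ (-|(p - 2) / 2|) ≤ (1 ^ 2 + δ) ^ (-|(p - 2) / 2|) :=
            Real.rpow_le_rpow_of_nonpos (by positivity) (by linarith) (by simp)
          exact h5.trans (Real.rpow_le_rpow_of_exponent_le (by linarith) (neg_abs_le _))
        rw [hv', one_pow, mul_one]
        have h6 : ρ * f ≤ 0 := mul_nonpos_of_nonneg_of_nonpos hρ hf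
        nlinarith
      · rw [Set.indicator_of_notMem hx1]
        have h6 : f * ρ ≤ 0 := mul_nonpos_of_nonpos_of_nonneg hf hρ
        have h7 : 0 ≤ v ^ 2 * Q := by positivity
        rw [mul_assoc]
        exact mul_nonpos_of_nonpos_of_nonneg h6 h7
  · rw [Set.indicator_of_notMem hx, Set.indicator_of_notMem fun h => hx (hsub h),
      formDensity_eq_zero fun h => hx (tsupport_logCutoff_subset hn h)]
    simp

lemma exists_isTest_re_integral_opL_pos (hN : 1 ≤ N) {p : ℝ} (hp : 1 < p) {α b c s : ℝ}
    (hs : s * p = N - 2 + α) (hf : quadF N b c s < 0) :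
    ∃ u, IsTest (Omega N) u ∧ 0 < (∫ x, opL α b c u x * dualFun p (u x)).re := by
  obtain ⟨C, hC0, hC⟩ := exists_abs_deriv_unitBump_le
  set f := quadF N b c s with hf_def
  set K := 4 * p * C ^ 2 * (2 : ℝ) ^ ((p - 1) / 2) with hK_def
  set a : ℝ := 2 ^ (-|(p - 2) / 2|) with ha_def
  have ha : 0 < a := by positivity
  have hK : 0 ≤ K := by positivity
  have hfa : 0 < -f * a := mul_pos (by linarith) ha
  -- This n gives 2K < -f a n ≤ -f a n². Thus the negative term wins even after the factor 2 lost in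
  -- passing from the long to the short annulus.
  set n : ℝ := 2 * K / (-f * a) + 1 with hn_def
  have hn1 : 1 ≤ n := by rw [hn_def]; linarith [show 0 ≤ 2 * K / (-f * a) by positivity]
  have hn : 0 < n := by linarith
  have hneg : 2 * (K / n ^ 2) + f * a < 0 := by
    have h1 : 2 * K < (-f * a) * n := by
      rw [hn_def, mul_add, mul_div_cancel₀ _ hfa.ne']; linarith
    have h2 : 2 * (K / n ^ 2) < -f * a := by
      rw [← mul_div_assoc, div_lt_iff₀ (by positivity)]
      nlinarith
    linarith
  have hv := isTest_logCutoff (N := N) hn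
  refine ⟨_, hv.norm_rpow_mul (-s), ?_⟩
  have hlim := (Complex.continuous_re.tendsto _).comp (tendsto_integral_formDensity hp α b c hv hs)
  have hIpos := setIntegral_logAnnulus_pos hN hn
  set I := ∫ x in logAnnulus N (-n) n, ‖x‖ ^ (-N : ℝ)
  have hbound : (-∫ x, opL α b c (fun y => ((‖y‖ ^ (-s) : ℝ) : ℂ) * (logCutoff N n y : ℂ)) x *
      dualFun p (((‖x‖ ^ (-s) : ℝ) : ℂ) * (logCutoff N n x : ℂ))).re ≤
      (2 * (K / n ^ 2) + f * a) * I := by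
    refine le_of_tendsto hlim (Eventually.of_forall fun m => ?_)
    have hδ : (0 : ℝ) < 1 / ((m : ℝ) + 1) := by positivity
    have hδ1 : 1 / ((m : ℝ) + 1) ≤ 1 := by
      rw [div_le_one (by positivity)]
      linarith [show (0 : ℝ) ≤ m by positivity]
    have hintg := integrable_formDensity (p := p) (k := 2 - N + 2 * s - c) (f := f) hδ hv
    have i1 : IntegrableOn (fun x : E N => K / n ^ 2 * ‖x‖ ^ (-N : ℝ))
        (logAnnulus N (-(2 * n)) (2 * n)) :=
      (integrableOn_norm_rpow_logAnnulus (-(2 * n)) (2 * n) (-N : ℝ)).const_mul _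
    have i2 : IntegrableOn (fun x : E N => f * a * ‖x‖ ^ (-N : ℝ)) (logAnnulus N (-n) n) :=
      (integrableOn_norm_rpow_logAnnulus (-n) n (-N : ℝ)).const_mul _
    have m1 := (isClosed_logAnnulus (N := N) (-(2 * n)) (2 * n)).measurableSet
    have m2 := (isClosed_logAnnulus (N := N) (-n) n).measurableSet
    have hre := integral_re (𝕜 := ℂ) hintg
    refine le_of_eq_of_le hre.symm ?_
    refine (integral_mono hintg.re ((i1.integrable_indicator m1).add (i2.integrable_indicator m2))
      fun x => re_formDensity_logCutoff_le hp hδ hδ1 hf.le hn hC x).trans ?_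
    rw [integral_add' (i1.integrable_indicator m1) (i2.integrable_indicator m2),
      integral_indicator m1, integral_indicator m2, integral_const_mul, integral_const_mul]
    have := mul_le_mul_of_nonneg_left (setIntegral_logAnnulus_double_le (N := N) n)
      (by positivity : 0 ≤ K / n ^ 2)
    linarith
  rw [Complex.neg_re] at hbound
  have := mul_neg_of_neg_of_pos hneg hIpos
  linarith

lemma quadF_nonneg_of_isDissipative (hN : 1 ≤ N) {p : ℝ≥0∞} [Fact (1 ≤ p)] (hp1 : 1 < p)
    (hp : p ≠ ⊤) {α b c s : ℝ} (hs : s * p.toReal = N - 2 + α)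
    (h : IsDissipative (Lmin N p α b c)) : 0 ≤ quadF N b c s := by
  by_contra! hf
  obtain ⟨u, hu, hpos⟩ := exists_isTest_re_integral_opL_pos hN (one_lt_toReal hp1 hp) hs hf
  have m1 : MemLp u p (volume.restrict (Omega N)) :=
    (hu.1.continuous.memLp_of_hasCompactSupport hu.2.1).restrict _
  have m2 : MemLp (opL α b c u) p (volume.restrict (Omega N)) :=
    ((continuous_opL hu).memLp_of_hasCompactSupport (hasCompactSupport_opL hu)).restrict _
  have hmem : (m1.toLp u, m2.toLp _) ∈ Lmin N p α b c :=
    subset_closure ⟨u, hu, m1.coeFn_toLp, m2.coeFn_toLp⟩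
  have h1 := (isDissipative_iff_dualPairing hp1 hp _).1 h _ _ hmem
  rw [dualPairing_eq_of_graphTest hu m1.coeFn_toLp m2.coeFn_toLp] at h1
  linarith

end Necessity

/-! ### Mollification -/

section Mollification

open scoped Convolution

variable {N : ℕ} {p : ℝ≥0∞}

/-- Convolution with a normalized bump function. -/
def mollify (ρ : ContDiffBump (0 : E N)) (f : E N → ℂ) : E N → ℂ :=
  ρ.normed volume ⋆[ContinuousLinearMap.lsmul ℝ ℝ, volume] f

/-- The probability measure with density a normalized bump function. -/
def bumpMeasure (ρ : ContDiffBump (0 : E N)) : Measure (E N) :=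
  volume.withDensity fun t => ENNReal.ofReal (ρ.normed volume t)

instance (ρ : ContDiffBump (0 : E N)) : IsProbabilityMeasure (bumpMeasure ρ) := by
  constructor
  rw [bumpMeasure, withDensity_apply _ MeasurableSet.univ, Measure.restrict_univ,
    ← ofReal_integral_eq_lintegral_ofReal ρ.integrable_normed
      (Eventually.of_forall ρ.nonneg_normed), ρ.integral_normed, ENNReal.ofReal_one]

/-- A mollification is an average of translates against a probability measure; this is the form to
which Jensen's inequality applies. -/
lemma enorm_mollify_le (ρ : ContDiffBump (0 : E N)) {f : E N → ℂ} (hf : StronglyMeasurable f)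
    (x : E N) : ‖mollify ρ f x‖ₑ ≤ eLpNorm (fun t => f (x - t)) 1 (bumpMeasure ρ) := by
  rw [eLpNorm_one_eq_lintegral_enorm, bumpMeasure, lintegral_withDensity_eq_lintegral_mul]
  · refine (enorm_integral_le_lintegral_enorm _).trans (le_of_eq ?_)
    refine lintegral_congr fun t => ?_
    change ‖ρ.normed volume t • f (x - t)‖ₑ = _
    rw [enorm_smul, Real.enorm_of_nonneg (ρ.nonneg_normed t)]
    rfl
  · exact (ρ.continuous_normed.measurable).ennreal_ofReal
  · exact (hf.measurable.comp (measurable_const.sub measurable_id)).enorm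

/-- Jensen's inequality for the bump measure, followed by Tonelli and translation invariance of
Lebesgue measure. -/
lemma eLpNorm_mollify_le_of_stronglyMeasurable (ρ : ContDiffBump (0 : E N)) (hp1 : 1 < p)
    (hp : p ≠ ⊤) {f : E N → ℂ} (hf : StronglyMeasurable f) :
    eLpNorm (mollify ρ f) p volume ≤ eLpNorm f p volume := by
  have hp0 : p ≠ 0 := by positivity
  have h1 := one_lt_toReal hp1 hp
  have hmeas : Measurable fun q : E N × E N => ‖f (q.1 - q.2)‖ₑ ^ p.toReal :=
    (hf.measurable.comp (measurable_fst.sub measurable_snd)).enorm.pow_const _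
  rw [eLpNorm_eq_lintegral_rpow_enorm_toReal hp0 hp, eLpNorm_eq_lintegral_rpow_enorm_toReal hp0 hp]
  refine ENNReal.rpow_le_rpow ?_ (by positivity)
  calc ∫⁻ x, ‖mollify ρ f x‖ₑ ^ p.toReal
      ≤ ∫⁻ x, ∫⁻ t, ‖f (x - t)‖ₑ ^ p.toReal ∂(bumpMeasure ρ) := by
        refine lintegral_mono fun x => ?_
        have hm : AEStronglyMeasurable (fun t => f (x - t)) (bumpMeasure ρ) :=
          (hf.comp_measurable (measurable_const.sub measurable_id)).aestronglyMeasurable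
        have h2 := (enorm_mollify_le ρ hf x).trans (eLpNorm_le_eLpNorm_of_exponent_le hp1.le hm)
        rw [eLpNorm_eq_lintegral_rpow_enorm_toReal hp0 hp] at h2
        have h3 := ENNReal.rpow_le_rpow h2 (by positivity : 0 ≤ p.toReal)
        rwa [← ENNReal.rpow_mul, one_div, inv_mul_cancel₀ (by linarith), ENNReal.rpow_one] at h3
    _ = ∫⁻ t, ∫⁻ x, ‖f (x - t)‖ₑ ^ p.toReal ∂volume ∂(bumpMeasure ρ) :=
        lintegral_lintegral_swap hmeas.aemeasurable
    _ = ∫⁻ _, (∫⁻ x, ‖f x‖ₑ ^ p.toReal ∂volume) ∂(bumpMeasure ρ) := by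
        refine lintegral_congr fun t => ?_
        exact lintegral_sub_right_eq_self (fun x => ‖f x‖ₑ ^ p.toReal) t
    _ = _ := by simp

lemma mollify_congr (ρ : ContDiffBump (0 : E N)) {f g : E N → ℂ} (h : f =ᵐ[volume] g) :
    mollify ρ f = mollify ρ g :=
  convolution_congr _ (EventuallyEq.refl _ _) h

lemma eLpNorm_mollify_le (ρ : ContDiffBump (0 : E N)) (hp1 : 1 < p) (hp : p ≠ ⊤) {f : E N → ℂ}
    (hf : AEStronglyMeasurable f volume) :
    eLpNorm (mollify ρ f) p volume ≤ eLpNorm f p volume := by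
  rw [mollify_congr ρ hf.ae_eq_mk, eLpNorm_congr_ae hf.ae_eq_mk]
  exact eLpNorm_mollify_le_of_stronglyMeasurable ρ hp1 hp hf.stronglyMeasurable_mk

lemma mollify_add (ρ : ContDiffBump (0 : E N)) {f g : E N → ℂ} (hf : LocallyIntegrable f)
    (hg : LocallyIntegrable g) : mollify ρ (f + g) = mollify ρ f + mollify ρ g :=
  (ρ.hasCompactSupport_normed.convolutionExists_left _ ρ.continuous_normed hf).distrib_add
    (ρ.hasCompactSupport_normed.convolutionExists_left _ ρ.continuous_normed hg)

lemma support_mollify_subset (ρ : ContDiffBump (0 : E N)) {f : E N → ℂ} {K : Set (E N)}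
    (hf : ∀ x ∉ K, f x = 0) : Function.support (mollify ρ f) ⊆ Metric.cthickening ρ.rOut K := by
  intro x hx
  obtain ⟨a, ha, b, hb, rfl⟩ := support_convolution_subset _ hx
  rw [ρ.support_normed_eq] at ha
  have hbK : b ∈ K := by
    by_contra h
    exact hb (hf b h)
  refine Metric.mem_cthickening_of_dist_le _ b _ _ hbK ?_
  rw [dist_eq_norm, add_sub_cancel_right]
  exact (mem_ball_zero_iff.1 ha).le

lemma tsupport_mollify_subset (ρ : ContDiffBump (0 : E N)) {f : E N → ℂ} {K : Set (E N)}
    (hf : ∀ x ∉ K, f x = 0) : tsupport (mollify ρ f) ⊆ Metric.cthickening ρ.rOut K :=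
  closure_minimal (support_mollify_subset ρ hf) Metric.isClosed_cthickening

lemma contDiff_mollify (ρ : ContDiffBump (0 : E N)) {f : E N → ℂ} (hf : LocallyIntegrable f) :
    ContDiff ℝ ∞ (mollify ρ f) :=
  ρ.hasCompactSupport_normed.contDiff_convolution_left _ ρ.contDiff_normed hf

/-- A sequence of bump functions shrinking to the origin. -/
def bumpSeq (N : ℕ) (n : ℕ) : ContDiffBump (0 : E N) :=
  ⟨1 / (2 * ((n : ℝ) + 1)), 1 / ((n : ℝ) + 1), by positivity,
    one_div_lt_one_div_of_lt (by positivity) (by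
      have : (0 : ℝ) ≤ n := by positivity
      linarith)⟩

lemma tendsto_rOut_bumpSeq : Tendsto (fun n => (bumpSeq N n).rOut) atTop (𝓝 0) :=
  tendsto_one_div_add_atTop_nhds_zero_nat

lemma eventually_isTest_mollify {V K : Set (E N)} (hV : IsOpen V) (hK : IsCompact K) (hKV : K ⊆ V)
    {f : E N → ℂ} (hf : LocallyIntegrable f) (hf0 : ∀ x ∉ K, f x = 0) :
    ∀ᶠ n in atTop, IsTest V (mollify (bumpSeq N n) f) := by
  obtain ⟨δ, hδ, hsub⟩ := hK.exists_cthickening_subset_open hV hKV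
  filter_upwards [tendsto_rOut_bumpSeq.eventually (eventually_le_nhds hδ)] with n hn
  have h := tsupport_mollify_subset (bumpSeq N n) hf0
  refine ⟨contDiff_mollify _ hf, ?_, h.trans ((Metric.cthickening_mono hn K).trans hsub)⟩
  exact hK.cthickening.of_isClosed_subset (isClosed_tsupport _) h

lemma tendsto_eLpNorm_mollify_sub_of_continuous {g : E N → ℂ}
    (hg : Continuous g) (hgc : HasCompactSupport g) (p : ℝ≥0∞) :
    Tendsto (fun n => eLpNorm (mollify (bumpSeq N n) g - g) p volume) atTop (𝓝 0) := by
  set K := Metric.cthickening 1 (tsupport g)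
  have hK : IsCompact K := IsCompact.cthickening hgc
  have hvol : volume K ≠ ⊤ := hK.measure_lt_top.ne
  have huc := hgc.uniformContinuous_of_continuous hg
  rw [ENNReal.tendsto_nhds_zero]
  intro ε hε
  obtain ⟨η, hη, hη2⟩ : ∃ η : ℝ, 0 < η ∧
      volume K ^ p.toReal⁻¹ * ENNReal.ofReal η ≤ ε := by
    have ht : Tendsto (fun η : ℝ => volume K ^ p.toReal⁻¹ * ENNReal.ofReal η) (𝓝[>] 0) (𝓝 0) := by
      have h1 : Tendsto (fun η : ℝ => ENNReal.ofReal η) (𝓝[>] 0) (𝓝 0) := by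
        simpa using (ENNReal.continuous_ofReal.tendsto 0).mono_left nhdsWithin_le_nhds
      simpa using ENNReal.Tendsto.const_mul h1
        (Or.inr (ENNReal.rpow_ne_top_of_nonneg (by positivity) hvol))
    obtain ⟨η, h1, h2⟩ := ((ht.eventually (ge_mem_nhds hε)).and self_mem_nhdsWithin).exists
    exact ⟨η, h2, h1⟩
  obtain ⟨δ, hδ, hδ2⟩ := Metric.uniformContinuous_iff.1 huc η hη
  filter_upwards [tendsto_rOut_bumpSeq.eventually (eventually_le_nhds hδ),
    tendsto_rOut_bumpSeq.eventually (eventually_le_nhds one_pos)] with n hn hn1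
  refine le_trans ?_ hη2
  have hsupp : Function.support (mollify (bumpSeq N n) g - g) ⊆ K := by
    intro x hx
    by_contra hxK
    refine hx ?_
    have h1 : mollify (bumpSeq N n) g x = 0 := by
      by_contra h
      exact hxK (Metric.cthickening_mono hn1 _ (support_mollify_subset _
        (fun y hy => image_eq_zero_of_notMem_tsupport hy) h))
    have h2 : g x = 0 := image_eq_zero_of_notMem_tsupport fun h =>
      hxK (Metric.self_subset_cthickening _ h)
    simp [h1, h2]
  rw [← eLpNorm_restrict_eq_of_support_subset hsupp]
  refine (eLpNorm_le_of_ae_bound (C := η) (Eventually.of_forall fun x => ?_)).trans ?_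
  · rw [Pi.sub_apply, ← dist_eq_norm]
    refine ContDiffBump.dist_normed_convolution_le hg.aestronglyMeasurable fun y hy => ?_
    exact (hδ2 ((Metric.mem_ball.1 hy).trans_le hn)).le
  · rw [Measure.restrict_apply_univ]

/-- Approximation by a continuous compactly supported g: mollification is a contraction of L^p, and
for g itself uniform continuity gives convergence. -/
lemma tendsto_eLpNorm_mollify_sub (hp1 : 1 < p) (hp : p ≠ ⊤) {f : E N → ℂ}
    (hf : MemLp f p volume) :
    Tendsto (fun n => eLpNorm (mollify (bumpSeq N n) f - f) p volume) atTop (𝓝 0) := by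
  rw [ENNReal.tendsto_nhds_zero]
  intro ε hε
  have hε3 : ε / 3 ≠ 0 := (ENNReal.div_pos hε.ne' (by simp)).ne'
  obtain ⟨g, hgc, hfg, hg, hgm⟩ := hf.exists_hasCompactSupport_eLpNorm_sub_le hp hε3
  filter_upwards [(ENNReal.tendsto_nhds_zero.1
    (tendsto_eLpNorm_mollify_sub_of_continuous hg hgc p)) (ε / 3) hε3.bot_lt] with n hn
  have hli : LocallyIntegrable g := hgm.locallyIntegrable hp1.le
  have hli2 : LocallyIntegrable (f - g) := (hf.sub hgm).locallyIntegrable hp1.le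
  have e1 : mollify (bumpSeq N n) f - f = mollify (bumpSeq N n) (f - g) +
      ((mollify (bumpSeq N n) g - g) - (f - g)) := by
    have : mollify (bumpSeq N n) f = mollify (bumpSeq N n) g + mollify (bumpSeq N n) (f - g) := by
      rw [← mollify_add _ hli hli2, add_sub_cancel]
    rw [this]; abel
  have m1 : AEStronglyMeasurable (mollify (bumpSeq N n) (f - g)) volume :=
    (contDiff_mollify _ hli2).continuous.aestronglyMeasurable
  have m2 : AEStronglyMeasurable (mollify (bumpSeq N n) g - g) volume :=
    ((contDiff_mollify _ hli).continuous.sub hg).aestronglyMeasurable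
  rw [e1]
  calc _ ≤ eLpNorm (mollify (bumpSeq N n) (f - g)) p volume +
        eLpNorm ((mollify (bumpSeq N n) g - g) - (f - g)) p volume :=
        eLpNorm_add_le m1 (m2.sub (hf.sub hgm).1) hp1.le
    _ ≤ ε / 3 + (ε / 3 + ε / 3) := by
        refine add_le_add ((eLpNorm_mollify_le _ hp1 hp (hf.sub hgm).1).trans hfg) ?_
        exact (eLpNorm_sub_le m2 (hf.sub hgm).1 hp1.le).trans (add_le_add hn hfg)
    _ = ε := by rw [← add_assoc, ENNReal.add_thirds]

/-- `g` is the weak partial derivative `∂_i u` in `ℝ^N`. -/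
def HasGlobalWeakPartial (i : Fin N) (u g : E N → ℂ) : Prop :=
  ∀ φ : E N → ℂ, IsTest Set.univ φ → ∫ x, u x * partialD i φ x = -∫ x, g x * φ x

/-- The derivative falls on the bump. Testing the weak derivative with t ↦ ρ(x-t), the sign from the
reflection cancels the sign from the definition. -/
lemma partialD_mollify (ρ : ContDiffBump (0 : E N)) {i : Fin N} {u g : E N → ℂ}
    (hu : LocallyIntegrable u) (h : HasGlobalWeakPartial i u g) :
    partialD i (mollify ρ u) = mollify ρ g := by
  ext x
  have hρ1 : ContDiff ℝ 1 (ρ.normed volume) := ρ.contDiff_normed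
  have hd := ρ.hasCompactSupport_normed.hasFDerivAt_convolution_left
    (ContinuousLinearMap.lsmul ℝ ℝ : ℝ →L[ℝ] ℂ →L[ℝ] ℂ) (μ := volume)
    hρ1 hu x
  have hce : ConvolutionExistsAt (fderiv ℝ (ρ.normed volume)) u x
      ((ContinuousLinearMap.lsmul ℝ ℝ : ℝ →L[ℝ] ℂ →L[ℝ] ℂ).precompL (E N)) volume :=
    (ρ.hasCompactSupport_normed.fderiv ℝ).convolutionExists_left _
      (hρ1.continuous_fderiv one_ne_zero) hu x
  set φ : E N → ℂ := fun t => ((ρ.normed volume (x - t) : ℝ) : ℂ)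
  have hφ : IsTest Set.univ φ := by
    refine ⟨?_, ?_, Set.subset_univ _⟩
    · have hρ : ContDiff ℝ ∞ (ρ.normed volume) := ρ.contDiff_normed
      exact Complex.ofRealCLM.contDiff.comp (hρ.comp (contDiff_const.sub contDiff_id))
    · have : HasCompactSupport fun t => ρ.normed volume (x - t) :=
        ρ.hasCompactSupport_normed.comp_homeomorph (Homeomorph.subLeft x)
      exact this.comp_left (g := fun r : ℝ => (r : ℂ)) Complex.ofReal_zero
  have hφd : ∀ t, partialD i φ t =
      -((fderiv ℝ (ρ.normed volume) (x - t) (EuclideanSpace.single i 1) : ℝ) : ℂ) := by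
    intro t
    have h1 : HasFDerivAt (fun t => x - t) (-(ContinuousLinearMap.id ℝ (E N))) t := by
      simpa using (hasFDerivAt_id t).const_sub x
    have h2 : HasFDerivAt (fun t => ρ.normed volume (x - t)) _ t :=
      (hρ1.differentiable one_ne_zero (x - t)).hasFDerivAt.comp t h1
    have h3 : HasFDerivAt φ _ t := Complex.ofRealCLM.hasFDerivAt.comp t h2
    rw [partialD, h3.fderiv]
    change ((fderiv ℝ (ρ.normed volume) (x - t) (-(EuclideanSpace.single i 1)) : ℝ) : ℂ) = _
    rw [map_neg]; push_cast; rfl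
  have key := h φ hφ
  calc partialD i (mollify ρ u) x
      = (fderiv ℝ (ρ.normed volume) ⋆[(ContinuousLinearMap.lsmul ℝ ℝ :
          ℝ →L[ℝ] ℂ →L[ℝ] ℂ).precompL (E N), volume] u) x (EuclideanSpace.single i 1) := by
        rw [partialD]
        exact congrArg (fun L : E N →L[ℝ] ℂ => L (EuclideanSpace.single i 1)) hd.fderiv
    _ = ∫ t, (((ContinuousLinearMap.lsmul ℝ ℝ : ℝ →L[ℝ] ℂ →L[ℝ] ℂ).precompL (E N))
          (fderiv ℝ (ρ.normed volume) (x - t)) (u t)) (EuclideanSpace.single i 1) := by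
        rw [convolution_eq_swap, ContinuousLinearMap.integral_apply]
        exact hce.integrable_swap
    _ = -∫ t, u t * partialD i φ t := by
        rw [← integral_neg]
        refine integral_congr_ae (Eventually.of_forall fun t => ?_)
        simp only [hφd]
        change (fderiv ℝ (ρ.normed volume) (x - t) (EuclideanSpace.single i 1)) • u t = _
        rw [Complex.real_smul]; ring
    _ = ∫ t, g t * φ t := by rw [key, neg_neg]
    _ = mollify ρ g x := by
        rw [mollify, convolution_eq_swap]
        refine integral_congr_ae (Eventually.of_forall fun t => ?_)
        change g t * ((ρ.normed volume (x - t) : ℝ) : ℂ) = ρ.normed volume (x - t) • g t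
        rw [Complex.real_smul]; ring

end Mollification

/-! ### Weighted radial inequalities on the annulus -/

section Radial

variable {N : ℕ} {ε : ℝ}

lemma isOpen_OmegaEps (N : ℕ) (ε : ℝ) : IsOpen (OmegaEps N ε) := by
  have : OmegaEps N ε = Omega N ∩ {x | ε < ‖x‖} ∩ {x | ‖x‖ < ε⁻¹} := by
    ext x
    simp only [OmegaEps, Set.mem_ofPred_eq, Set.mem_inter_iff, and_assoc]
  rw [this]
  exact (isOpen_Omega.inter (isOpen_lt continuous_const continuous_norm)).inter
    (isOpen_lt continuous_norm continuous_const)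

lemma measurableSet_OmegaEps : MeasurableSet (OmegaEps N ε) := (isOpen_OmegaEps N ε).measurableSet

lemma OmegaEps_subset_Omega : OmegaEps N ε ⊆ Omega N := fun _ hx => hx.1

lemma OmegaEps_subset_logAnnulus (hε : 0 < ε) :
    OmegaEps N ε ⊆ logAnnulus N (Real.log ε) (Real.log ε⁻¹) := fun x hx => by
  refine ⟨hx.1, ?_, ?_⟩
  · rw [Real.exp_log hε]; exact hx.2.1.le
  · rw [Real.exp_log (inv_pos.2 hε)]; exact hx.2.2.le

lemma isFiniteMeasure_OmegaEps (hε : 0 < ε) :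
    IsFiniteMeasure ((volume : Measure (E N)).restrict (OmegaEps N ε)) :=
  ⟨by
    rw [Measure.restrict_apply_univ]
    exact (measure_mono (OmegaEps_subset_logAnnulus hε)).trans_lt
      (isCompact_logAnnulus _ _).measure_lt_top⟩

lemma IsTest.mono {V W : Set (E N)} {φ : E N → ℂ} (hφ : IsTest V φ) (h : V ⊆ W) : IsTest W φ :=
  ⟨hφ.1, hφ.2.1, hφ.2.2.trans h⟩

lemma exists_abs_le_OmegaEps (hε : 0 < ε) {k : E N → ℝ} (hk : ContinuousOn k {0}ᶜ) :
    ∃ M, 0 ≤ M ∧ ∀ x ∈ OmegaEps N ε, |k x| ≤ M := by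
  obtain ⟨M, hM⟩ := (isCompact_logAnnulus (N := N) (Real.log ε) (Real.log ε⁻¹)).exists_bound_of_continuousOn
    (hk.mono fun x hx => hx.1.1)
  exact ⟨max M 0, le_max_right _ _, fun x hx =>
    (hM x (OmegaEps_subset_logAnnulus hε hx)).trans (le_max_left _ _)⟩

lemma norm_fderiv_apply_self_le (v : E N → ℂ) (x : E N) :
    ‖fderiv ℝ v x x‖ ≤ ‖x‖ * ∑ i, ‖partialD i v x‖ := by
  rw [← sum_coord_smul_map (fderiv ℝ v x) x, Finset.mul_sum]
  refine (norm_sum_le _ _).trans (Finset.sum_le_sum fun i _ => ?_)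
  rw [norm_smul]
  exact mul_le_mul_of_nonneg_right (PiLp.norm_apply_le x i) (norm_nonneg _)

lemma norm_fderiv_norm_rpow_apply_le {p : ℝ} (hp : 1 < p) (z w : ℂ) :
    |fderiv ℝ (fun z : ℂ => ‖z‖ ^ p) z w| ≤ p * ‖z‖ ^ (p - 1) * ‖w‖ := by
  have h := norm_fderiv_norm_rpow_le (f := fun z : ℂ => z) differentiable_id hp (x := z)
  have h2 := (fderiv ℝ (fun z : ℂ => ‖z‖ ^ p) z).le_opNorm w
  refine h2.trans (mul_le_mul_of_nonneg_right (h.trans ?_) (norm_nonneg _))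
  have : ‖fderiv ℝ (fun z : ℂ => z) z‖ ≤ 1 := by
    rw [fderiv_fun_id]; exact ContinuousLinearMap.norm_id_le
  exact mul_le_of_le_one_right (by positivity) this

lemma integrable_weight_mul_norm_rpow {p : ℝ} (hp : 0 ≤ p) {F : E N → ℝ} {T : Set (E N)}
    (hT : IsCompact T) (h0 : ∀ x ∈ T, x ≠ 0) (hF : Continuous F) (hF0 : ∀ x ∉ T, F x = 0) (hp0 : p ≠ 0)
    {k : ℝ → ℝ} (hk : Continuous k) (a : ℝ) :
    Integrable fun x : E N => ‖x‖ ^ a * (k (‖x‖ ^ 2) * F x ^ p) := by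
  refine integrable_of_continuousOn_compact hT ?_ fun x hx => by
    rw [hF0 x hx, Real.zero_rpow hp0, mul_zero, mul_zero]
  exact (continuousOn_norm_rpow a h0).mul ((hk.comp (continuous_norm.pow 2)).continuousOn.mul
    (hF.rpow_const fun x => Or.inr hp).continuousOn)

/-- A weighted inequality between a function and its gradient, from integrating the radial
derivative of `ψ(|x|²) |G|^p`. -/
lemma integral_radial_le {p : ℝ} (hp : 1 < p) (hε : 0 < ε) {G : E N → ℂ}
    (hG : IsTest (OmegaEps N ε) G) {ψ k₁ k₂ : ℝ → ℝ} (hψ : ContDiff ℝ 1 ψ) (hk₁ : Continuous k₁)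
    (hk₂ : Continuous k₂)
    (h : ∀ x ∈ OmegaEps N ε, ∀ a b : ℝ, 0 ≤ a → 0 ≤ b →
      k₁ (‖x‖ ^ 2) * a ^ p + p * ε⁻¹ * |ψ (‖x‖ ^ 2)| * (a ^ (p - 1) * b) ≤
        2 * deriv ψ (‖x‖ ^ 2) * a ^ p + k₂ (‖x‖ ^ 2) * b ^ p) :
    ∫ x in OmegaEps N ε, ‖x‖ ^ (2 - N : ℝ) * (k₁ (‖x‖ ^ 2) * ‖G x‖ ^ p) ≤
      ∫ x in OmegaEps N ε, ‖x‖ ^ (2 - N : ℝ) * (k₂ (‖x‖ ^ 2) * (∑ i, ‖partialD i G x‖) ^ p) := by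
  have hp0 : p ≠ 0 := by linarith
  set g : E N → ℝ := fun x => ψ (‖x‖ ^ 2) * ‖G x‖ ^ p with hg
  have hnp : ContDiff ℝ 1 fun z : ℂ => ‖z‖ ^ p := contDiff_norm_rpow hp
  have hgc : ContDiff ℝ 1 g :=
    (hψ.comp (contDiff_norm_sq ℝ)).mul (hnp.comp hG.contDiff_one)
  have hsub : tsupport g ⊆ tsupport G := tsupport_subset_tsupport fun x hx => by
    simp [hg, hx, Real.zero_rpow hp0]
  have hgs : HasCompactSupport g := hG.2.1.of_isClosed_subset (isClosed_tsupport _) hsub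
  have hne : ∀ x ∈ tsupport G, x ≠ 0 := fun x hx => (hG.2.2 hx).1.1
  have hg0 : (0 : E N) ∉ tsupport g := fun h => hne 0 (hsub h) rfl
  have hGd : ∀ i, Continuous fun x => ‖partialD i G x‖ := fun i =>
    (contDiff_partialD (m := 0) hG.contDiff_one (by norm_num) i).continuous.norm
  have hi1 : Integrable fun x : E N => ‖x‖ ^ (2 - N : ℝ) * (k₁ (‖x‖ ^ 2) * ‖G x‖ ^ p) :=
    integrable_weight_mul_norm_rpow (by linarith) hG.2.1 hne hG.1.continuous.norm
      (fun x hx => by rw [image_eq_zero_of_notMem_tsupport hx, norm_zero]) hp0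
      hk₁ _
  have hi2 : Integrable fun x : E N =>
      ‖x‖ ^ (2 - N : ℝ) * (k₂ (‖x‖ ^ 2) * (∑ i, ‖partialD i G x‖) ^ p) :=
    integrable_weight_mul_norm_rpow (by linarith) hG.2.1 hne
      (continuous_finsetSum _ fun i _ => hGd i)
      (fun x hx => by simp [partialD, fderiv_eq_zero_of_notMem_tsupport hx]) hp0
      hk₂ _
  have hi3 := integrable_norm_rpow_smul_radial hgc hgs hg0 (-(N : ℝ))
  have h0 := integral_norm_rpow_smul_radial_eq_zero hgc hgs hg0
  -- The vanishing integral of the radial derivative of g is restricted to the annulus and used as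
  -- the zero on the right; only a pointwise comparison then remains.
  rw [← setIntegral_eq_integral_of_forall_compl_eq_zero (s := OmegaEps N ε) fun x hx => by
    rw [fderiv_eq_zero_of_notMem_tsupport fun h => hx (hG.2.2 (hsub h))]; simp] at h0
  rw [← sub_nonpos, ← integral_sub hi1.restrict hi2.restrict, ← h0]
  refine setIntegral_mono_on (hi1.sub hi2).restrict hi3.restrict measurableSet_OmegaEps
    fun x hx => ?_
  have hx0 : 0 < ‖x‖ := norm_pos_iff.2 hx.1.1
  have hd1 : HasFDerivAt (fun y : E N => ψ (‖y‖ ^ 2)) _ x :=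
    (hψ.differentiable one_ne_zero (‖x‖ ^ 2)).hasDerivAt.comp_hasFDerivAt x
      (hasStrictFDerivAt_norm_sq x).hasFDerivAt
  have hd2 : HasFDerivAt (fun y : E N => ‖G y‖ ^ p) _ x :=
    ((hnp.differentiable one_ne_zero) (G x)).hasFDerivAt.comp x
      (hG.contDiff_one.differentiable one_ne_zero x).hasFDerivAt
  have hd : fderiv ℝ g x x = ψ (‖x‖ ^ 2) * fderiv ℝ (fun z : ℂ => ‖z‖ ^ p) (G x) (fderiv ℝ G x x) +
      ‖G x‖ ^ p * (deriv ψ (‖x‖ ^ 2) * (2 * ‖x‖ ^ 2)) := by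
    have hd3 : HasFDerivAt g _ x := hd1.mul hd2
    rw [hd3.fderiv]
    simp
  set D := fderiv ℝ (fun z : ℂ => ‖z‖ ^ p) (G x) (fderiv ℝ G x x) with hD
  set Γ := ∑ i, ‖partialD i G x‖ with hΓ
  have hDle : |D| ≤ p * ‖G x‖ ^ (p - 1) * (‖x‖ * Γ) :=
    (norm_fderiv_norm_rpow_apply_le hp _ _).trans
      (mul_le_mul_of_nonneg_left (norm_fderiv_apply_self_le G x) (by positivity))
  have hΓ0 : 0 ≤ Γ := Finset.sum_nonneg fun i _ => norm_nonneg _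
  have hw : ‖x‖ ^ (-(N : ℝ)) * ‖x‖ ^ 2 = ‖x‖ ^ (2 - N : ℝ) := by
    rw [← Real.rpow_natCast, ← Real.rpow_add hx0]; congr 1; push_cast; ring
  have key := h x hx (‖G x‖) Γ (norm_nonneg _) hΓ0
  -- Since |x| > ε, one power of |x| in the radial derivative is traded for ε⁻¹|x|². All terms then
  -- carry the common weight |x|^(2-N), and the hypothesis `h` takes a form free of |x|-factors.
  have hxinv : ‖x‖ ≤ ‖x‖ ^ 2 * ε⁻¹ := by
    rw [← div_eq_mul_inv, le_div_iff₀ hε]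
    nlinarith [hx.2.1]
  have h4 : -(‖x‖ ^ 2 * (p * ε⁻¹ * |ψ (‖x‖ ^ 2)| * (‖G x‖ ^ (p - 1) * Γ))) ≤ ψ (‖x‖ ^ 2) * D := by
    refine (neg_le_neg ?_).trans (neg_abs_le _)
    rw [abs_mul]
    calc |ψ (‖x‖ ^ 2)| * |D| ≤ |ψ (‖x‖ ^ 2)| * (p * ‖G x‖ ^ (p - 1) * (‖x‖ * Γ)) := by gcongr
      _ = ‖x‖ * (p * |ψ (‖x‖ ^ 2)| * (‖G x‖ ^ (p - 1) * Γ)) := by ring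
      _ ≤ (‖x‖ ^ 2 * ε⁻¹) * (p * |ψ (‖x‖ ^ 2)| * (‖G x‖ ^ (p - 1) * Γ)) := by gcongr
      _ = _ := by ring
  rw [hd, smul_eq_mul, ← hw]
  have h5 := mul_le_mul_of_nonneg_left key (by positivity : 0 ≤ ‖x‖ ^ 2)
  have h6 : 0 ≤ ‖x‖ ^ (-(N : ℝ)) := by positivity
  calc _ = ‖x‖ ^ (-(N : ℝ)) * (‖x‖ ^ 2 * (k₁ (‖x‖ ^ 2) * ‖G x‖ ^ p - k₂ (‖x‖ ^ 2) * Γ ^ p)) := by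
        ring
    _ ≤ _ := mul_le_mul_of_nonneg_left (by linarith) h6

/-! ### Passage to the limit in weighted p-th power integrals -/

section Limit

variable {S : Type*} [MeasurableSpace S] {μ : Measure S} {p : ℝ≥0∞}

/-- Absorbing K^(1/p) into the functions makes the integral the p-th power of an L^p norm, so
continuity of the norm suffices. -/
lemma tendsto_integral_mul_norm_rpow_of_nonneg (hp1 : 1 < p) (hp : p ≠ ⊤)
    {f : ℕ → S → ℂ} {F : S → ℂ} (hf : ∀ n, MemLp (f n) p μ) (hF : MemLp F p μ)
    (h : Tendsto (fun n => eLpNorm (f n - F) p μ) atTop (𝓝 0)) {K : S → ℝ} {M : ℝ}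
    (hK : AEStronglyMeasurable K μ) (hM : ∀ᵐ x ∂μ, K x ≤ M) (hK0 : ∀ x, 0 ≤ K x) :
    Tendsto (fun n => ∫ x, K x * ‖f n x‖ ^ p.toReal ∂μ) atTop
      (𝓝 (∫ x, K x * ‖F x‖ ^ p.toReal ∂μ)) := by
  have h1 := one_lt_toReal hp1 hp
  have : Fact (1 ≤ p) := ⟨hp1.le⟩
  have hKp : AEStronglyMeasurable (fun x => ((K x ^ p.toReal⁻¹ : ℝ) : ℂ)) μ :=
    (Complex.measurable_ofReal.comp_aemeasurable
      (hK.aemeasurable.pow_const _)).aestronglyMeasurable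
  have hb : ∀ᵐ x ∂μ, ‖((K x ^ p.toReal⁻¹ : ℝ) : ℂ)‖ ≤ M ^ p.toReal⁻¹ := by
    filter_upwards [hM] with x hx
    rw [Complex.norm_real, Real.norm_of_nonneg (Real.rpow_nonneg (hK0 x) _)]
    exact Real.rpow_le_rpow (hK0 x) hx (by positivity)
  have hm : ∀ {G : S → ℂ}, MemLp G p μ →
      MemLp (fun x => ((K x ^ p.toReal⁻¹ : ℝ) : ℂ) * G x) p μ := fun {G} hG => by
    refine hG.of_le_mul (c := M ^ p.toReal⁻¹) (hKp.mul hG.1) ?_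
    filter_upwards [hb] with x hx
    rw [norm_mul]
    exact mul_le_mul_of_nonneg_right hx (norm_nonneg _)
  have hpw : ∀ {G : S → ℂ} (hG : MemLp G p μ),
      ‖(hm hG).toLp _‖ ^ p.toReal = ∫ x, K x * ‖G x‖ ^ p.toReal ∂μ := fun {G} hG => by
    rw [norm_rpow_eq_integral hp1 hp]
    refine integral_congr_ae ?_
    filter_upwards [(hm hG).coeFn_toLp] with x hx
    rw [hx, norm_mul, Complex.norm_real, Real.norm_of_nonneg (Real.rpow_nonneg (hK0 x) _),
      Real.mul_rpow (Real.rpow_nonneg (hK0 x) _) (norm_nonneg _), ← Real.rpow_mul (hK0 x),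
      inv_mul_cancel₀ (by linarith), Real.rpow_one]
  have ht : Tendsto (fun n => (hm (hf n)).toLp _) atTop (𝓝 ((hm hF).toLp _)) := by
    rw [Lp.tendsto_Lp_iff_tendsto_eLpNorm'']
    have h2 : Tendsto (fun n => ENNReal.ofReal (M ^ p.toReal⁻¹) * eLpNorm (f n - F) p μ) atTop
        (𝓝 0) := by
      simpa using ENNReal.Tendsto.const_mul h (Or.inr ENNReal.ofReal_ne_top)
    refine tendsto_of_tendsto_of_tendsto_of_le_of_le tendsto_const_nhds h2
      (fun n => zero_le) fun n => ?_
    refine eLpNorm_le_mul_eLpNorm_of_ae_le_mul ?_ p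
    filter_upwards [hb] with x hx
    simp only [Pi.sub_apply]
    rw [← mul_sub, norm_mul]
    exact mul_le_mul_of_nonneg_right hx (norm_nonneg _)
  have := (ht.norm.rpow_const (p := p.toReal) (Or.inr (by linarith)))
  simp_rw [hpw hF, fun n => hpw (hf n)] at this
  exact this

lemma tendsto_integral_mul_norm_rpow (hp1 : 1 < p) (hp : p ≠ ⊤)
    {f : ℕ → S → ℂ} {F : S → ℂ} (hf : ∀ n, MemLp (f n) p μ) (hF : MemLp F p μ)
    (h : Tendsto (fun n => eLpNorm (f n - F) p μ) atTop (𝓝 0)) {K : S → ℝ} {M : ℝ}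
    (hK : AEStronglyMeasurable K μ) (hM : ∀ᵐ x ∂μ, |K x| ≤ M) :
    Tendsto (fun n => ∫ x, K x * ‖f n x‖ ^ p.toReal ∂μ) atTop
      (𝓝 (∫ x, K x * ‖F x‖ ^ p.toReal ∂μ)) := by
  have hintg : ∀ {G : S → ℂ}, MemLp G p μ → ∀ {k : S → ℝ}, AEStronglyMeasurable k μ →
      (∀ᵐ x ∂μ, |k x| ≤ M) → Integrable (fun x => k x * ‖G x‖ ^ p.toReal) μ :=
    fun {G} hG {k} hk hk2 => (integrable_norm_rpow_of_memLp hp1 hp hG).bdd_mul hk hk2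
  have hm1 : AEStronglyMeasurable (fun x => max (K x) 0) μ := hK.sup aestronglyMeasurable_const
  have hm2 : AEStronglyMeasurable (fun x => max (-K x) 0) μ :=
    hK.neg.sup aestronglyMeasurable_const
  have hb1 : ∀ᵐ x ∂μ, |max (K x) 0| ≤ M := by
    filter_upwards [hM] with x hx
    rw [abs_of_nonneg (le_max_right _ _)]
    exact max_le ((le_abs_self _).trans hx) ((abs_nonneg _).trans hx)
  have hb2 : ∀ᵐ x ∂μ, |max (-K x) 0| ≤ M := by
    filter_upwards [hM] with x hx
    rw [abs_of_nonneg (le_max_right _ _)]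
    exact max_le ((neg_le_abs _).trans hx) ((abs_nonneg _).trans hx)
  have hsplit : ∀ {G : S → ℂ}, MemLp G p μ → ∫ x, K x * ‖G x‖ ^ p.toReal ∂μ =
      (∫ x, max (K x) 0 * ‖G x‖ ^ p.toReal ∂μ) - ∫ x, max (-K x) 0 * ‖G x‖ ^ p.toReal ∂μ :=
    fun {G} hG => by
      rw [← integral_sub (hintg hG hm1 hb1) (hintg hG hm2 hb2)]
      refine integral_congr_ae (Eventually.of_forall fun x => ?_)
      simp only []
      rw [← sub_mul, max_zero_sub_max_neg_zero_eq_self]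
  simp_rw [hsplit hF, fun n => hsplit (hf n)]
  refine (tendsto_integral_mul_norm_rpow_of_nonneg hp1 hp hf hF h hm1 (M := M) ?_
    fun x => le_max_right _ _).sub
    (tendsto_integral_mul_norm_rpow_of_nonneg hp1 hp hf hF h hm2 (M := M) ?_
    fun x => le_max_right _ _)
  · filter_upwards [hb1] with x hx using (le_abs_self _).trans hx
  · filter_upwards [hb2] with x hx using (le_abs_self _).trans hx

end Limit

variable {p : ℝ≥0∞}

/-- Both sides are continuous in W^{1,p} because the weights are bounded on the annulus. The
inequality thus reaches limits of test functions: elements of W^{1,p}_0 as well as cut-off Sobolev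
functions. -/
lemma integral_radial_le_of_tendsto (hp1 : 1 < p) (hp : p ≠ ⊤) (hε : 0 < ε) {G : ℕ → E N → ℂ}
    {F : E N → ℂ} {g : Fin N → E N → ℂ} (hG : ∀ n, IsTest (OmegaEps N ε) (G n))
    (hF : MemLp F p (volume.restrict (OmegaEps N ε)))
    (hg : ∀ i, MemLp (g i) p (volume.restrict (OmegaEps N ε)))
    (hGF : Tendsto (fun n => eLpNorm (G n - F) p (volume.restrict (OmegaEps N ε))) atTop (𝓝 0))
    (hGg : ∀ i, Tendsto (fun n => eLpNorm (partialD i (G n) - g i) p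
      (volume.restrict (OmegaEps N ε))) atTop (𝓝 0))
    {ψ k₁ k₂ : ℝ → ℝ} (hψ : ContDiff ℝ 1 ψ) (hk₁ : Continuous k₁) (hk₂ : Continuous k₂)
    (h : ∀ x ∈ OmegaEps N ε, ∀ a b : ℝ, 0 ≤ a → 0 ≤ b →
      k₁ (‖x‖ ^ 2) * a ^ p.toReal + p.toReal * ε⁻¹ * |ψ (‖x‖ ^ 2)| * (a ^ (p.toReal - 1) * b) ≤
        2 * deriv ψ (‖x‖ ^ 2) * a ^ p.toReal + k₂ (‖x‖ ^ 2) * b ^ p.toReal) :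
    ∫ x in OmegaEps N ε, ‖x‖ ^ (2 - N : ℝ) * k₁ (‖x‖ ^ 2) * ‖F x‖ ^ p.toReal ≤
      ∫ x in OmegaEps N ε, ‖x‖ ^ (2 - N : ℝ) * k₂ (‖x‖ ^ 2) * (∑ i, ‖g i x‖) ^ p.toReal := by
  have hp' := one_lt_toReal hp1 hp
  have hfin := isFiniteMeasure_OmegaEps (N := N) hε
  have hbound : ∀ {k : ℝ → ℝ}, Continuous k → ∃ M, ∀ᵐ x ∂(volume.restrict (OmegaEps N ε)),
      |‖x‖ ^ (2 - N : ℝ) * k (‖x‖ ^ 2)| ≤ M := fun {k} hk => by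
    obtain ⟨M, -, hM⟩ := exists_abs_le_OmegaEps (N := N) hε
      (k := fun x => ‖x‖ ^ (2 - N : ℝ) * k (‖x‖ ^ 2))
      ((continuousOn_norm_rpow _ fun x hx => hx).mul
        (hk.comp (continuous_norm.pow 2)).continuousOn)
    exact ⟨M, (ae_restrict_iff' measurableSet_OmegaEps).2 (Eventually.of_forall hM)⟩
  have hmeas : ∀ {k : ℝ → ℝ}, Continuous k → AEStronglyMeasurable
      (fun x : E N => ‖x‖ ^ (2 - N : ℝ) * k (‖x‖ ^ 2)) (volume.restrict (OmegaEps N ε)) :=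
    fun {k} hk => ((measurable_norm.pow_const _).mul
      (hk.measurable.comp (measurable_norm.pow_const 2))).aestronglyMeasurable
  obtain ⟨M₁, hM₁⟩ := hbound hk₁
  obtain ⟨M₂, hM₂⟩ := hbound hk₂
  have hGm : ∀ n, MemLp (G n) p (volume.restrict (OmegaEps N ε)) := fun n =>
    ((hG n).1.continuous.memLp_of_hasCompactSupport (hG n).2.1).restrict _
  have hGdm : ∀ i n, MemLp (partialD i (G n)) p (volume.restrict (OmegaEps N ε)) := fun i n =>
    ((contDiff_partialD (m := 0) (hG n).contDiff_one (by norm_num) i).continuous.memLp_of_hasCompactSupport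
      ((hG n).2.1.of_isClosed_subset (isClosed_tsupport _) (tsupport_partialD_subset i _))).restrict _
  have hsum : ∀ {f : Fin N → E N → ℂ}, (∀ i, MemLp (f i) p (volume.restrict (OmegaEps N ε))) →
      MemLp (fun x => ((∑ i, ‖f i x‖ : ℝ) : ℂ)) p (volume.restrict (OmegaEps N ε)) := fun {f} hf =>
    (memLp_finsetSum Finset.univ fun i _ => (hf i).norm).ofReal
  have hΓ : Tendsto (fun n => eLpNorm ((fun x => ((∑ i, ‖partialD i (G n) x‖ : ℝ) : ℂ)) -
      fun x => ((∑ i, ‖g i x‖ : ℝ) : ℂ)) p (volume.restrict (OmegaEps N ε))) atTop (𝓝 0) := by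
    have h0 : Tendsto (fun n => ∑ i, eLpNorm (partialD i (G n) - g i) p
        (volume.restrict (OmegaEps N ε))) atTop (𝓝 0) := by
      simpa using tendsto_finsetSum Finset.univ fun i _ => hGg i
    refine tendsto_of_tendsto_of_tendsto_of_le_of_le tendsto_const_nhds h0
      (fun n => zero_le) fun n => ?_
    calc _ ≤ eLpNorm (∑ i, fun x => ‖(partialD i (G n) - g i) x‖) p
          (volume.restrict (OmegaEps N ε)) := by
          refine eLpNorm_mono fun x => ?_
          rw [Pi.sub_apply, ← Complex.ofReal_sub, Complex.norm_real, ← Finset.sum_sub_distrib,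
            Finset.sum_apply]
          refine (norm_sum_le _ _).trans (le_trans ?_ (le_abs_self _))
          refine Finset.sum_le_sum fun i _ => ?_
          exact abs_norm_sub_norm_le _ _
      _ ≤ ∑ i, eLpNorm (fun x => ‖(partialD i (G n) - g i) x‖) p
          (volume.restrict (OmegaEps N ε)) :=
          eLpNorm_sum_le (fun i _ => ((hGdm i n).1.sub (hg i).1).norm) hp1.le
      _ = _ := by simp_rw [eLpNorm_norm]
  have t1 := tendsto_integral_mul_norm_rpow hp1 hp hGm hF hGF (hmeas hk₁) hM₁
  have t2 := tendsto_integral_mul_norm_rpow hp1 hp (fun n => hsum fun i => hGdm i n) (hsum hg) hΓ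
    (hmeas hk₂) hM₂
  have hnn : ∀ f : Fin N → E N → ℂ, ∀ x, ‖((∑ i, ‖f i x‖ : ℝ) : ℂ)‖ = ∑ i, ‖f i x‖ :=
    fun f x => by
      rw [Complex.norm_real, Real.norm_of_nonneg (Finset.sum_nonneg fun i _ => norm_nonneg _)]
  simp_rw [fun n => hnn (fun i => partialD i (G n)), hnn g] at t2
  refine le_of_tendsto_of_tendsto' t1 t2 fun n => ?_
  simp_rw [mul_assoc]
  exact integral_radial_le hp' hε (hG n) hψ hk₁ hk₂ h

/-- An exponential weight concentrated near the sphere `|x|² = r`. -/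
def bdryKernel (σ r δ ρ : ℝ) : ℝ := Real.exp (-(σ * (ρ - r)) / δ)

lemma bdryKernel_pos (σ r δ ρ : ℝ) : 0 < bdryKernel σ r δ ρ := Real.exp_pos _

lemma contDiff_bdryKernel (σ r δ : ℝ) : ContDiff ℝ ∞ (bdryKernel σ r δ) :=
  ((contDiff_const.mul (contDiff_id.sub contDiff_const)).neg.div_const _).exp

lemma hasDerivAt_bdryKernel (σ r δ ρ : ℝ) :
    HasDerivAt (bdryKernel σ r δ) (bdryKernel σ r δ ρ * (-σ / δ)) ρ := by
  have h : HasDerivAt (fun ρ : ℝ => -(σ * (ρ - r)) / δ) (-σ / δ) ρ :=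
    ((((hasDerivAt_id ρ).sub_const r).const_mul σ).neg.div_const δ).congr_deriv (by ring)
  exact h.exp

lemma exists_seq_of_memSobolevZero {V : Set (E N)} {u : LpOn p V} {g : Fin N → LpOn p V}
    (h : ∀ δ : ℝ≥0∞, 0 < δ → ∃ φ : E N → ℂ, IsTest V φ ∧
      eLpNorm (fun x => u x - φ x) p (volume.restrict V) < δ ∧
      ∀ i, eLpNorm (fun x => g i x - partialD i φ x) p (volume.restrict V) < δ) :
    ∃ G : ℕ → E N → ℂ, (∀ n, IsTest V (G n)) ∧
      Tendsto (fun n => eLpNorm (G n - ⇑u) p (volume.restrict V)) atTop (𝓝 0) ∧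
      ∀ i, Tendsto (fun n => eLpNorm (partialD i (G n) - ⇑(g i)) p (volume.restrict V)) atTop
        (𝓝 0) := by
  choose G hG h1 h2 using fun n : ℕ => h ((n : ℝ≥0∞) + 1)⁻¹ (by simp)
  have h0 : Tendsto (fun n : ℕ => ((n : ℝ≥0∞) + 1)⁻¹) atTop (𝓝 0) := by
    have := (tendsto_add_atTop_iff_nat 1).2 ENNReal.tendsto_inv_nat_nhds_zero
    simpa using this
  refine ⟨G, hG, ?_, fun i => ?_⟩
  · refine tendsto_of_tendsto_of_tendsto_of_le_of_le tendsto_const_nhds h0 (fun n => zero_le)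
      fun n => ?_
    rw [eLpNorm_sub_comm]
    exact (h1 n).le
  · refine tendsto_of_tendsto_of_tendsto_of_le_of_le tendsto_const_nhds h0 (fun n => zero_le)
      fun n => ?_
    rw [eLpNorm_sub_comm]
    exact (h2 n i).le

/-- A Hardy type inequality near a boundary sphere, for functions vanishing at the boundary. -/
lemma integral_bdryKernel_le_gradient (hp1 : 1 < p) (hp : p ≠ ⊤) (hε : 0 < ε) {σ : ℝ}
    (hσ : σ = 1 ∨ σ = -1) (r : ℝ) {δ : ℝ} (hδ : 0 < δ) {u : LpOn p (OmegaEps N ε)}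
    {g : Fin N → LpOn p (OmegaEps N ε)}
    (h : ∀ δ : ℝ≥0∞, 0 < δ → ∃ φ : E N → ℂ, IsTest (OmegaEps N ε) φ ∧
      eLpNorm (fun x => u x - φ x) p (volume.restrict (OmegaEps N ε)) < δ ∧
      ∀ i, eLpNorm (fun x => g i x - partialD i φ x) p (volume.restrict (OmegaEps N ε)) < δ) :
    ∫ x in OmegaEps N ε, ‖x‖ ^ (2 - N : ℝ) * bdryKernel σ r δ (‖x‖ ^ 2) * ‖u x‖ ^ p.toReal ≤
      (p.toReal * ε⁻¹ * δ) ^ p.toReal *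
      ∫ x in OmegaEps N ε, ‖x‖ ^ (2 - N : ℝ) * bdryKernel σ r δ (‖x‖ ^ 2) *
        (∑ i, ‖g i x‖) ^ p.toReal := by
  have hp' := one_lt_toReal hp1 hp
  obtain ⟨G, hG, h1, h2⟩ := exists_seq_of_memSobolevZero h
  have hσ2 : σ * σ = 1 := by rcases hσ with rfl | rfl <;> norm_num
  have hσa : |σ| = 1 := by rcases hσ with rfl | rfl <;> norm_num
  have hK := contDiff_bdryKernel σ r δ
  -- This multiple of the exponential is chosen to have derivative exactly the kernel.
  -- Differentiating in |x|² yields the kernel twice: one copy is the left side and the other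
  -- absorbs the a^p from Young's inequality.
  have hψ : ContDiff ℝ 1 fun ρ => -(σ * δ) * bdryKernel σ r δ ρ :=
    contDiff_const.mul (hK.of_le (by norm_cast))
  have key := integral_radial_le_of_tendsto hp1 hp hε hG (Lp.memLp u) (fun i => Lp.memLp (g i)) h1 h2
    hψ hK.continuous (k₂ := fun ρ => (p.toReal * ε⁻¹ * δ) ^ p.toReal * bdryKernel σ r δ ρ)
    (continuous_const.mul hK.continuous) fun x hx a b ha hb => ?_
  · refine key.trans (le_of_eq ?_)
    rw [← integral_const_mul]
    refine integral_congr_ae (Eventually.of_forall fun x => ?_)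
    simp only []
    ring
  · have hd : deriv (fun ρ => -(σ * δ) * bdryKernel σ r δ ρ) (‖x‖ ^ 2) =
        bdryKernel σ r δ (‖x‖ ^ 2) := by
      rw [((hasDerivAt_bdryKernel σ r δ (‖x‖ ^ 2)).const_mul (-(σ * δ))).deriv]
      field_simp
      linear_combination bdryKernel σ r δ (‖x‖ ^ 2) * hσ2
    have hKp := bdryKernel_pos σ r δ (‖x‖ ^ 2)
    rw [hd, abs_mul, abs_neg, abs_mul, hσa, one_mul, abs_of_pos hδ, abs_of_pos hKp]
    have h3 := mul_rpow_le hp' ha (b := p.toReal * ε⁻¹ * δ * b) (by positivity)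
    rw [Real.mul_rpow (by positivity) hb] at h3
    nlinarith [mul_le_mul_of_nonneg_left h3 hKp.le]

end Radial

/-! ### Cutoffs on the annulus -/

section Cutoff

variable {N : ℕ} {ε : ℝ}

/-- A smooth monotone profile, `0` on `(-∞, 1]` and `1` on `[2, ∞)`. -/
def cutProfile (t : ℝ) : ℝ := Real.smoothTransition (t - 1)

lemma contDiff_cutProfile : ContDiff ℝ ∞ cutProfile :=
  Real.smoothTransition.contDiff.comp (contDiff_id.sub contDiff_const)

lemma cutProfile_nonneg (t : ℝ) : 0 ≤ cutProfile t := Real.smoothTransition.nonneg _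

lemma cutProfile_le_one (t : ℝ) : cutProfile t ≤ 1 := Real.smoothTransition.le_one _

lemma cutProfile_of_le {t : ℝ} (ht : t ≤ 1) : cutProfile t = 0 :=
  Real.smoothTransition.zero_of_nonpos (by linarith)

lemma cutProfile_of_two_le {t : ℝ} (ht : 2 ≤ t) : cutProfile t = 1 :=
  Real.smoothTransition.one_of_one_le (by linarith)

lemma deriv_cutProfile_nonneg (t : ℝ) : 0 ≤ deriv cutProfile t := by
  have h : Monotone cutProfile := fun a b hab =>
    Real.smoothTransition.monotone (by linarith)
  exact h.deriv_nonneg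

lemma cutProfile_eventuallyEq {t : ℝ} (ht : t ∉ Set.Icc (1 : ℝ) 2) :
    ∃ c, cutProfile =ᶠ[𝓝 t] fun _ => c := by
  rw [Set.mem_Icc, not_and_or, not_le, not_le] at ht
  rcases ht with ht | ht
  · exact ⟨0, by filter_upwards [eventually_lt_nhds ht] with s hs using cutProfile_of_le hs.le⟩
  · exact ⟨1, by filter_upwards [eventually_gt_nhds ht] with s hs using cutProfile_of_two_le hs.le⟩

lemma deriv_cutProfile_eq_zero {t : ℝ} (ht : t ∉ Set.Icc (1 : ℝ) 2) : deriv cutProfile t = 0 := by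
  obtain ⟨c, hc⟩ := cutProfile_eventuallyEq ht
  rw [hc.deriv_eq, deriv_const]

lemma deriv_deriv_cutProfile_eq_zero {t : ℝ} (ht : t ∉ Set.Icc (1 : ℝ) 2) :
    deriv (deriv cutProfile) t = 0 := by
  obtain ⟨c, hc⟩ := cutProfile_eventuallyEq ht
  rw [hc.deriv.deriv_eq]
  simp

lemma contDiff_deriv_cutProfile : ContDiff ℝ ∞ (deriv cutProfile) :=
  ((contDiff_infty_iff_deriv (𝕜 := ℝ)).1 contDiff_cutProfile).2

lemma exists_deriv_cutProfile_le : ∃ C, 0 ≤ C ∧ ∀ t, |deriv cutProfile t| ≤ C ∧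
    |deriv (deriv cutProfile) t| ≤ C := by
  have h2 : Continuous (deriv (deriv cutProfile)) :=
    ((contDiff_infty_iff_deriv (𝕜 := ℝ)).1 contDiff_deriv_cutProfile).2.continuous
  obtain ⟨A, hA⟩ := isCompact_Icc.exists_bound_of_continuousOn (s := Set.Icc (1 : ℝ) 2)
    contDiff_deriv_cutProfile.continuous.continuousOn
  obtain ⟨B, hB⟩ := isCompact_Icc.exists_bound_of_continuousOn (s := Set.Icc (1 : ℝ) 2)
    h2.continuousOn
  refine ⟨max 0 (max A B), le_max_left _ _, fun t => ?_⟩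
  by_cases ht : t ∈ Set.Icc (1 : ℝ) 2
  · exact ⟨(hA t ht).trans ((le_max_left _ _).trans (le_max_right _ _)),
      (hB t ht).trans ((le_max_right _ _).trans (le_max_right _ _))⟩
  · rw [deriv_cutProfile_eq_zero ht, deriv_deriv_cutProfile_eq_zero ht, abs_zero]
    exact ⟨le_max_left _ _, le_max_left _ _⟩

/-- A function of `ρ = |x|²` that vanishes on the boundary of the annulus. -/
def bdryFun (ε ρ : ℝ) : ℝ := (ρ - ε ^ 2) * ((ε⁻¹) ^ 2 - ρ)

lemma contDiff_bdryFun (ε : ℝ) : ContDiff ℝ ∞ (bdryFun ε) :=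
  (contDiff_id.sub contDiff_const).mul (contDiff_const.sub contDiff_id)

lemma hasDerivAt_bdryFun (ε ρ : ℝ) :
    HasDerivAt (bdryFun ε) (2 * ((ε ^ 2 + (ε⁻¹) ^ 2) / 2 - ρ)) ρ := by
  have h : HasDerivAt (bdryFun ε) _ ρ :=
    ((hasDerivAt_id ρ).sub_const (ε ^ 2)).mul ((hasDerivAt_id ρ).const_sub ((ε⁻¹) ^ 2))
  refine h.congr_deriv ?_
  simp only [id]
  ring

lemma sq_lt_inv_sq (hε : 0 < ε) (hε1 : ε < 1) : ε ^ 2 < (ε⁻¹) ^ 2 := by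
  have : 1 < ε⁻¹ := (one_lt_inv₀ hε).2 hε1
  nlinarith

lemma norm_sq_bounds (hε : 0 < ε) {x : E N} (hx : x ∈ OmegaEps N ε) :
    ε ^ 2 < ‖x‖ ^ 2 ∧ ‖x‖ ^ 2 < (ε⁻¹) ^ 2 :=
  ⟨pow_lt_pow_left₀ hx.2.1 hε.le two_ne_zero,
    pow_lt_pow_left₀ hx.2.2 (norm_nonneg _) two_ne_zero⟩

lemma bdryFun_pos (hε : 0 < ε) {x : E N} (hx : x ∈ OmegaEps N ε) : 0 < bdryFun ε (‖x‖ ^ 2) :=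
  mul_pos (sub_pos.2 (norm_sq_bounds hε hx).1) (sub_pos.2 (norm_sq_bounds hε hx).2)

lemma mem_OmegaEps_of_bdryFun_pos (hε : 0 < ε) (hε1 : ε < 1) {x : E N} (hx : x ∈ Omega N)
    (h : 0 < bdryFun ε (‖x‖ ^ 2)) : x ∈ OmegaEps N ε := by
  have h1 := sq_lt_inv_sq hε hε1
  rcases mul_pos_iff.1 h with h | h
  · exact ⟨hx, lt_of_pow_lt_pow_left₀ 2 (norm_nonneg _) (sub_pos.1 h.1),
      lt_of_pow_lt_pow_left₀ 2 (inv_pos.2 hε).le (sub_pos.1 h.2)⟩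
  · linarith [h.1, h.2]

/-- A smooth cutoff on the annulus, vanishing at distance of order `τ` from the boundary. -/
def annCutoff (N : ℕ) (ε τ : ℝ) (x : E N) : ℝ :=
  open scoped Classical in if x ∈ Omega N then cutProfile (bdryFun ε (‖x‖ ^ 2) / τ) else 0

lemma annCutoff_nonneg (τ : ℝ) (x : E N) : 0 ≤ annCutoff N ε τ x := by
  unfold annCutoff; split_ifs
  exacts [cutProfile_nonneg _, le_rfl]

lemma annCutoff_le_one (τ : ℝ) (x : E N) : annCutoff N ε τ x ≤ 1 := by
  unfold annCutoff; split_ifs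
  exacts [cutProfile_le_one _, zero_le_one]

lemma annCutoff_eq {x : E N} (hx : x ∈ Omega N) (τ : ℝ) :
    annCutoff N ε τ x = cutProfile (bdryFun ε (‖x‖ ^ 2) / τ) := if_pos hx

lemma annCutoff_eventuallyEq {x : E N} (hx : x ∈ Omega N) (τ : ℝ) :
    annCutoff N ε τ =ᶠ[𝓝 x] fun y => cutProfile (bdryFun ε (‖y‖ ^ 2) / τ) := by
  filter_upwards [isOpen_Omega.mem_nhds hx] with y hy using annCutoff_eq hy τ

lemma contDiff_bdryFun_norm_sq (ε : ℝ) : ContDiff ℝ ∞ fun x : E N => bdryFun ε (‖x‖ ^ 2) :=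
  (contDiff_bdryFun ε).comp (contDiff_norm_sq ℝ)

lemma tsupport_annCutoff_subset (hε : 0 < ε) (hε1 : ε < 1) {τ : ℝ} (hτ : 0 < τ) :
    tsupport (fun x => (annCutoff N ε τ x : ℂ)) ⊆
      logAnnulus N (Real.log ε) (Real.log ε⁻¹) ∩ {x | τ ≤ bdryFun ε (‖x‖ ^ 2)} := by
  refine closure_minimal (fun x hx => ?_) ((isClosed_logAnnulus _ _).inter
    (isClosed_le continuous_const (contDiff_bdryFun_norm_sq ε).continuous))
  have hne : annCutoff N ε τ x ≠ 0 := fun h => hx (by simp [h])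
  unfold annCutoff at hne
  split_ifs at hne with hΩ
  · have h1 : τ ≤ bdryFun ε (‖x‖ ^ 2) := by
      by_contra h
      refine hne (cutProfile_of_le ?_)
      rw [div_le_one hτ]; exact (not_le.1 h).le
    exact ⟨OmegaEps_subset_logAnnulus hε
      (mem_OmegaEps_of_bdryFun_pos hε hε1 hΩ (hτ.trans_le h1)), h1⟩
  · exact absurd rfl hne

lemma isTest_annCutoff (hε : 0 < ε) (hε1 : ε < 1) {τ : ℝ} (hτ : 0 < τ) :
    IsTest (OmegaEps N ε) fun x => (annCutoff N ε τ x : ℂ) := by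
  have hsub := tsupport_annCutoff_subset (N := N) hε hε1 hτ
  refine ⟨contDiff_of_forall_mem_tsupport fun x hx => ?_,
    (isCompact_logAnnulus _ _).of_isClosed_subset (isClosed_tsupport _)
      (hsub.trans Set.inter_subset_left),
    fun x hx => mem_OmegaEps_of_bdryFun_pos hε hε1 (hsub hx).1.1 (hτ.trans_le (hsub hx).2)⟩
  have hΩ := (hsub hx).1.1
  refine Complex.ofRealCLM.contDiff.contDiffAt.comp x ?_
  refine ContDiffAt.congr_of_eventuallyEq ?_ (annCutoff_eventuallyEq hΩ τ)
  exact (contDiff_cutProfile.comp ((contDiff_bdryFun_norm_sq ε).div_const τ)).contDiffAt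

lemma partialD_ofReal {f : E N → ℝ} {x : E N} (hf : DifferentiableAt ℝ f x) (i : Fin N) :
    partialD i (fun y => (f y : ℂ)) x = ((fderiv ℝ f x (EuclideanSpace.single i 1) : ℝ) : ℂ) := by
  have h : HasFDerivAt (fun y => (f y : ℂ)) _ x :=
    Complex.ofRealCLM.hasFDerivAt.comp x hf.hasFDerivAt
  rw [partialD, h.fderiv]
  rfl

lemma partialD_eventuallyEq {f g : E N → ℂ} {x : E N} (h : f =ᶠ[𝓝 x] g) (i : Fin N) :
    partialD i f =ᶠ[𝓝 x] partialD i g := by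
  filter_upwards [h.fderiv (𝕜 := ℝ)] with y hy
  rw [partialD, partialD, hy]

lemma fderiv_comp_div {χ : ℝ → ℝ} (hχ : Differentiable ℝ χ) {q : E N → ℝ}
    (hq : Differentiable ℝ q) (τ : ℝ) (x v : E N) :
    fderiv ℝ (fun y => χ (q y / τ)) x v = deriv χ (q x / τ) * (fderiv ℝ q x v / τ) := by
  have h1 : HasFDerivAt (fun y => q y / τ) _ x := (hq x).hasFDerivAt.mul_const τ⁻¹
  have h2 : HasFDerivAt (fun y => χ (q y / τ)) _ x :=
    (hχ (q x / τ)).hasDerivAt.comp_hasFDerivAt x h1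
  rw [h2.fderiv]
  simp only [smul_apply, smul_eq_mul]
  ring

/-- Chain rule, with the derivatives of the boundary function bounded on the annulus. The constant
is independent of τ. The last clause localizes all derivatives of the cutoff in the boundary layer.
-/
lemma exists_partialD_annCutoff_le (N : ℕ) (hε : 0 < ε) : ∃ C, 0 ≤ C ∧
    ∀ τ : ℝ, 0 < τ → τ ≤ 1 → ∀ x ∈ OmegaEps N ε, ∀ i,
      ‖partialD i (fun y => (annCutoff N ε τ y : ℂ)) x‖ ≤ C / τ ∧
      ‖partialD i (partialD i (fun y => (annCutoff N ε τ y : ℂ))) x‖ ≤ C / τ ^ 2 ∧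
      (2 * τ < bdryFun ε (‖x‖ ^ 2) → partialD i (fun y => (annCutoff N ε τ y : ℂ)) x = 0 ∧
        partialD i (partialD i (fun y => (annCutoff N ε τ y : ℂ))) x = 0) := by
  set q : E N → ℝ := fun x => bdryFun ε (‖x‖ ^ 2) with hq_def
  have hq : ContDiff ℝ ∞ q := contDiff_bdryFun_norm_sq ε
  have hqd : Differentiable ℝ q := hq.differentiable (by simp)
  set q₁ : Fin N → E N → ℝ := fun i x => fderiv ℝ q x (EuclideanSpace.single i 1) with hq₁_def
  have hq₁ : ∀ i, ContDiff ℝ ∞ (q₁ i) := fun i =>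
    (hq.fderiv_right (m := ∞) le_rfl).clm_apply contDiff_const
  set q₂ : Fin N → E N → ℝ := fun i x => fderiv ℝ (q₁ i) x (EuclideanSpace.single i 1) with hq₂_def
  have hq₂ : ∀ i, ContDiff ℝ ∞ (q₂ i) := fun i =>
    ((hq₁ i).fderiv_right (m := ∞) le_rfl).clm_apply contDiff_const
  obtain ⟨A, hA0, hA⟩ := exists_deriv_cutProfile_le
  obtain ⟨B, hB0, hB⟩ := exists_abs_le_OmegaEps (N := N) hε
    (k := fun x => ∑ i, (|q₁ i x| + q₁ i x ^ 2 + |q₂ i x|))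
    (continuous_finsetSum _ fun i _ => (((hq₁ i).continuous.abs.add ((hq₁ i).continuous.pow 2)).add
      (hq₂ i).continuous.abs)).continuousOn
  have hB' : ∀ x ∈ OmegaEps N ε, ∀ i, |q₁ i x| + q₁ i x ^ 2 + |q₂ i x| ≤ B := fun x hx i =>
    (Finset.single_le_sum (f := fun i => |q₁ i x| + q₁ i x ^ 2 + |q₂ i x|)
      (fun j _ => by positivity) (Finset.mem_univ i)).trans ((le_abs_self _).trans (hB x hx))
  refine ⟨A * B, by positivity, fun τ hτ hτ1 x hx i => ?_⟩
  have hcut : Differentiable ℝ cutProfile := contDiff_cutProfile.differentiable (by simp)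
  have hcut' : Differentiable ℝ (deriv cutProfile) :=
    contDiff_deriv_cutProfile.differentiable (by simp)
  have hqτ : Differentiable ℝ fun y => q y / τ := hqd.mul_const τ⁻¹
  have hcd : Differentiable ℝ fun y => cutProfile (q y / τ) := hcut.comp hqτ
  have hcd' : Differentiable ℝ fun y => deriv cutProfile (q y / τ) := hcut'.comp hqτ
  have he : (fun y => (annCutoff N ε τ y : ℂ)) =ᶠ[𝓝 x] fun y => ((cutProfile (q y / τ) : ℝ) : ℂ) := by
    filter_upwards [annCutoff_eventuallyEq (ε := ε) hx.1 τ] with y hy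
    rw [hy]
  have hf1 : partialD i (fun y => ((cutProfile (q y / τ) : ℝ) : ℂ)) =
      fun y => ((deriv cutProfile (q y / τ) * (q₁ i y / τ) : ℝ) : ℂ) := by
    ext y
    rw [partialD_ofReal (hcd y), fderiv_comp_div hcut hqd]
  have hf2 : partialD i (fun y => ((deriv cutProfile (q y / τ) * (q₁ i y / τ) : ℝ) : ℂ)) x =
      ((deriv (deriv cutProfile) (q x / τ) * (q₁ i x / τ) * (q₁ i x / τ) +
        deriv cutProfile (q x / τ) * (q₂ i x / τ) : ℝ) : ℂ) := by
    have hd2 : HasFDerivAt (fun y => q₁ i y / τ) _ x :=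
      (((hq₁ i).differentiable (by simp)) x).hasFDerivAt.mul_const τ⁻¹
    have hd3 : HasFDerivAt (fun y => deriv cutProfile (q y / τ) * (q₁ i y / τ)) _ x :=
      (hcd' x).hasFDerivAt.mul hd2
    rw [partialD_ofReal hd3.differentiableAt, hd3.fderiv]
    congr 1
    simp only [add_apply, smul_apply, smul_eq_mul]
    rw [fderiv_comp_div hcut' hqd]
    simp only [hq₁_def, hq₂_def]
    ring
  have e1 : partialD i (fun y => (annCutoff N ε τ y : ℂ)) x =
      ((deriv cutProfile (q x / τ) * (q₁ i x / τ) : ℝ) : ℂ) := by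
    rw [(partialD_eventuallyEq he i).eq_of_nhds, hf1]
  have e2 := (partialD_eventuallyEq (partialD_eventuallyEq he i) i).eq_of_nhds
  rw [hf1, hf2] at e2
  have hb := hB' x hx i
  have hb1 : |q₁ i x| ≤ B := by nlinarith [abs_nonneg (q₂ i x), sq_nonneg (q₁ i x)]
  have hb2 : q₁ i x ^ 2 + |q₂ i x| ≤ B := by linarith [abs_nonneg (q₁ i x)]
  rw [e1, e2]
  refine ⟨?_, ?_, fun h => ?_⟩
  · rw [Complex.norm_real, Real.norm_eq_abs, abs_mul, abs_div, abs_of_pos hτ, mul_div_assoc]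
    have := (hA (q x / τ)).1
    gcongr
  · rw [Complex.norm_real, Real.norm_eq_abs]
    have h1 := (hA (q x / τ)).1
    have h2 := (hA (q x / τ)).2
    calc _ ≤ |deriv (deriv cutProfile) (q x / τ)| * (q₁ i x ^ 2 / τ ^ 2) +
          |deriv cutProfile (q x / τ)| * (|q₂ i x| / τ) := by
          refine (abs_add_le _ _).trans (le_of_eq ?_)
          rw [mul_assoc, abs_mul, abs_of_nonneg (mul_self_nonneg (q₁ i x / τ)), abs_mul,
            abs_div (q₂ i x), abs_of_pos hτ, div_mul_div_comm, sq, sq]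
      _ ≤ A * (q₁ i x ^ 2 / τ ^ 2) + A * (|q₂ i x| / τ ^ 2) := by
          have : τ ^ 2 ≤ τ := by nlinarith
          gcongr
      _ = A * (q₁ i x ^ 2 + |q₂ i x|) / τ ^ 2 := by ring
      _ ≤ _ := by gcongr
  · have ht : q x / τ ∉ Set.Icc (1 : ℝ) 2 := fun h' => by
      have := (div_le_iff₀ hτ).1 h'.2
      exact absurd h (not_lt.2 this)
    rw [deriv_cutProfile_eq_zero ht, deriv_deriv_cutProfile_eq_zero ht]
    simp

end Cutoff

/-! ### Cutting off and approximating Sobolev functions -/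

section Approximation

variable {N : ℕ} {p : ℝ≥0∞} {V : Set (E N)}

lemma partialD_mul {f g : E N → ℂ} {x : E N} (hf : DifferentiableAt ℝ f x)
    (hg : DifferentiableAt ℝ g x) (i : Fin N) :
    partialD i (fun y => f y * g y) x = f x * partialD i g x + partialD i f x * g x := by
  have h : HasFDerivAt (fun y => f y * g y) _ x := hf.hasFDerivAt.mul hg.hasFDerivAt
  rw [partialD, h.fderiv]
  simp only [add_apply, smul_apply, smul_eq_mul]
  rw [partialD, partialD]
  ring

lemma IsTest.partialD {φ : E N → ℂ} (hφ : IsTest V φ) (i : Fin N) : IsTest V (partialD i φ) :=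
  ⟨contDiff_partialD hφ.1 (m := ∞) le_rfl i,
    hφ.2.1.of_isClosed_subset (isClosed_tsupport _) (tsupport_partialD_subset i φ),
    (tsupport_partialD_subset i φ).trans hφ.2.2⟩

lemma IsTest.exists_norm_le {φ : E N → ℂ} (hφ : IsTest V φ) : ∃ C, ∀ x, ‖φ x‖ ≤ C :=
  hφ.1.continuous.bounded_above_of_compact_support hφ.2.1

lemma IsTest.eq_zero {φ : E N → ℂ} (hφ : IsTest V φ) {x : E N} (hx : x ∉ V) : φ x = 0 :=
  image_eq_zero_of_notMem_tsupport fun h => hx (hφ.2.2 h)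

lemma IsTest.integrable_mul_Lp [IsFiniteMeasure ((volume : Measure (E N)).restrict V)]
    (hp1 : 1 < p) {ζ : E N → ℂ} (hζ : IsTest Set.univ ζ) (u : LpOn p V) :
    Integrable (fun x => ζ x * u x) (volume.restrict V) := by
  obtain ⟨C, hC⟩ := hζ.exists_norm_le
  exact ((Lp.memLp u).integrable hp1.le).bdd_mul hζ.1.continuous.aestronglyMeasurable
    (Eventually.of_forall hC)

lemma IsTest.memLp_mul_Lp (hV : MeasurableSet V) {ζ : E N → ℂ} (hζ : IsTest V ζ) (u : LpOn p V) :
    MemLp (fun x => ζ x * u x) p volume := by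
  obtain ⟨C, hC⟩ := hζ.exists_norm_le
  have h : MemLp (fun x => ζ x * u x) p (volume.restrict V) :=
    (Lp.memLp u).of_le_mul (c := C) (hζ.1.continuous.aestronglyMeasurable.mul (Lp.memLp u).1)
      (Eventually.of_forall fun x => by
        rw [norm_mul]; exact mul_le_mul_of_nonneg_right (hC x) (norm_nonneg _))
  have h2 : V.indicator (fun x => ζ x * u x) = fun x => ζ x * u x := by
    ext x
    by_cases hx : x ∈ V
    · rw [Set.indicator_of_mem hx]
    · rw [Set.indicator_of_notMem hx, hζ.eq_zero hx, zero_mul]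
  rw [← h2]
  exact (memLp_indicator_iff_restrict hV).2 h

/-- A test function φ on the whole space becomes one in V after multiplication by ζ, and the product
rule for ζφ gives the formula. -/
lemma HasWeakPartial.cutoff [IsFiniteMeasure ((volume : Measure (E N)).restrict V)] (hp1 : 1 < p)
    {i : Fin N} {u g : LpOn p V} (h : HasWeakPartial i u g) {ζ : E N → ℂ} (hζ : IsTest V ζ) :
    HasGlobalWeakPartial i (fun x => ζ x * u x) (fun x => ζ x * g x + partialD i ζ x * u x) := by
  intro φ hφ
  have hζφ : IsTest V fun x => ζ x * φ x :=
    hζ.of_contDiffAt (fun x hx => by simp [hx]) fun x _ => (hζ.1.mul hφ.1).contDiffAt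
  have key := h _ hζφ
  have h1 : IsTest Set.univ fun x => ζ x * partialD i φ x :=
    (hζ.of_contDiffAt (fun x hx => by simp [hx])
      fun x _ => (hζ.1.mul (hφ.partialD i).1).contDiffAt).mono (Set.subset_univ V)
  have h2 : IsTest Set.univ fun x => partialD i ζ x * φ x :=
    ((hζ.partialD i).of_contDiffAt (fun x hx => by simp [hx])
      fun x _ => ((hζ.partialD i).1.mul hφ.1).contDiffAt).mono (Set.subset_univ V)
  have hi1 := h1.integrable_mul_Lp hp1 u
  have hi2 := h2.integrable_mul_Lp hp1 u
  have hi3 := (hζφ.mono (Set.subset_univ V)).integrable_mul_Lp hp1 g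
  have e1 : ∫ x in V, u x * partialD i (fun y => ζ y * φ y) x =
      (∫ x in V, ζ x * partialD i φ x * u x) + ∫ x in V, partialD i ζ x * φ x * u x := by
    rw [← integral_add hi1 hi2]
    refine integral_congr_ae (Eventually.of_forall fun x => ?_)
    simp only []
    rw [partialD_mul (hζ.1.differentiable (by simp) x) (hφ.1.differentiable (by simp) x)]
    ring
  have e2 : ∫ x, ζ x * u x * partialD i φ x = ∫ x in V, ζ x * partialD i φ x * u x := by
    rw [← setIntegral_eq_integral_of_forall_compl_eq_zero (s := V)
      (f := fun x => ζ x * u x * partialD i φ x) fun x hx => by simp [hζ.eq_zero hx]]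
    exact integral_congr_ae (Eventually.of_forall fun x => by simp only []; ring)
  have e3 : ∫ x, (ζ x * g x + partialD i ζ x * u x) * φ x =
      (∫ x in V, ζ x * φ x * g x) + ∫ x in V, partialD i ζ x * φ x * u x := by
    rw [← setIntegral_eq_integral_of_forall_compl_eq_zero (s := V)
      (f := fun x => (ζ x * g x + partialD i ζ x * u x) * φ x) fun x hx => by
        simp [hζ.eq_zero hx, (hζ.partialD i).eq_zero hx], ← integral_add hi3 hi2]
    exact integral_congr_ae (Eventually.of_forall fun x => by simp only []; ring)
  have e4 : ∫ x in V, g x * (ζ x * φ x) = ∫ x in V, ζ x * φ x * g x :=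
    integral_congr_ae (Eventually.of_forall fun x => by simp only []; ring)
  rw [e2, e3]
  rw [e1, e4] at key
  linear_combination key

lemma HasGlobalWeakPartial.add {i : Fin N} {u₁ u₂ g₁ g₂ : E N → ℂ}
    (h₁ : HasGlobalWeakPartial i u₁ g₁) (h₂ : HasGlobalWeakPartial i u₂ g₂)
    (hu₁ : LocallyIntegrable u₁) (hu₂ : LocallyIntegrable u₂) (hg₁ : LocallyIntegrable g₁)
    (hg₂ : LocallyIntegrable g₂) :
    HasGlobalWeakPartial i (fun x => u₁ x + u₂ x) (fun x => g₁ x + g₂ x) := by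
  intro φ hφ
  have hintg : ∀ {f ψ : E N → ℂ}, LocallyIntegrable f → IsTest Set.univ ψ →
      Integrable fun x => f x * ψ x := fun {f ψ} hf hψ => by
    simpa [mul_comm] using hf.integrable_smul_left_of_hasCompactSupport hψ.1.continuous hψ.2.1
  simp_rw [add_mul]
  rw [integral_add (hintg hu₁ (hφ.partialD i)) (hintg hu₂ (hφ.partialD i)),
    integral_add (hintg hg₁ hφ) (hintg hg₂ hφ), h₁ φ hφ, h₂ φ hφ]
  ring

end Approximation

/-! ### The sector condition for compactly supported Sobolev functions -/

section WeakMin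

variable {N : ℕ} {p : ℝ≥0∞}

/-- The differential expression `L` in terms of prescribed second and first derivatives. -/
def opLWeak (α b c : ℝ) (H G : Fin N → E N → ℂ) (U : E N → ℂ) (x : E N) : ℂ :=
  ((‖x‖ ^ α : ℝ) : ℂ) * ∑ i, H i x
    + ((c * ‖x‖ ^ (α - 1) : ℝ) : ℂ) * ∑ i, ((x i / ‖x‖ : ℝ) : ℂ) * G i x
    - ((b * ‖x‖ ^ (α - 2) : ℝ) : ℂ) * U x

lemma opL_eq_opLWeak {α b c : ℝ} {u : E N → ℂ} (hu : ContDiff ℝ 2 u) :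
    opL α b c u = opLWeak α b c (fun i => partialD i (partialD i u)) (fun i => partialD i u) u := by
  ext x
  rw [opL, opLWeak, laplacian_eq_sum_partialD hu, ← sum_coord_smul_map (fderiv ℝ u x) (‖x‖⁻¹ • x)]
  congr 3
  refine Finset.sum_congr rfl fun i _ => ?_
  rw [Complex.real_smul, partialD]
  congr 2
  simp [div_eq_inv_mul]

lemma abs_coord_div_norm_le (x : E N) (i : Fin N) : |x i / ‖x‖| ≤ 1 := by
  rw [abs_div, abs_norm]
  exact div_le_one_of_le₀ (PiLp.norm_apply_le x i) (norm_nonneg _)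

/-- On a compact set away from the origin the coefficients are bounded, so L is continuous from
second order jets to values; this passes convergence of mollified derivatives on to L. -/
lemma norm_opLWeak_sub_le {α b c M : ℝ} {x : E N} (h₁ : ‖x‖ ^ α ≤ M) (h₂ : |c * ‖x‖ ^ (α - 1)| ≤ M)
    (h₃ : |b * ‖x‖ ^ (α - 2)| ≤ M) (H G H' G' : Fin N → E N → ℂ) (U U' : E N → ℂ) :
    ‖opLWeak α b c H G U x - opLWeak α b c H' G' U' x‖ ≤
      M * (∑ i, ‖H i x - H' i x‖ + ∑ i, ‖G i x - G' i x‖ + ‖U x - U' x‖) := by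
  have hM : 0 ≤ M := (by positivity : (0 : ℝ) ≤ ‖x‖ ^ α).trans h₁
  have e : opLWeak α b c H G U x - opLWeak α b c H' G' U' x =
      ((‖x‖ ^ α : ℝ) : ℂ) * (∑ i, (H i x - H' i x)) +
      ((c * ‖x‖ ^ (α - 1) : ℝ) : ℂ) * (∑ i, ((x i / ‖x‖ : ℝ) : ℂ) * (G i x - G' i x)) -
      ((b * ‖x‖ ^ (α - 2) : ℝ) : ℂ) * (U x - U' x) := by
    simp only [opLWeak, mul_sub, Finset.sum_sub_distrib]
    ring
  rw [e]
  refine (norm_sub_le _ _).trans ?_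
  rw [mul_add, mul_add]
  refine add_le_add ((norm_add_le _ _).trans (add_le_add ?_ ?_)) ?_
  · rw [norm_mul, Complex.norm_real, Real.norm_of_nonneg (by positivity)]
    exact mul_le_mul h₁ (norm_sum_le _ _) (norm_nonneg _) hM
  · rw [norm_mul, Complex.norm_real]
    refine mul_le_mul h₂ ((norm_sum_le _ _).trans (Finset.sum_le_sum fun i _ => ?_))
      (norm_nonneg _) hM
    rw [norm_mul, Complex.norm_real]
    exact mul_le_of_le_one_left (norm_nonneg _) (abs_coord_div_norm_le x i)
  · rw [norm_mul, Complex.norm_real]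
    exact mul_le_mul_of_nonneg_right h₃ (norm_nonneg _)

lemma exists_weight_bound (α b c : ℝ) {K : Set (E N)} (hK : IsCompact K) (h0 : ∀ x ∈ K, x ≠ 0) :
    ∃ M, 0 ≤ M ∧ ∀ x ∈ K, ‖x‖ ^ α ≤ M ∧ |c * ‖x‖ ^ (α - 1)| ≤ M ∧ |b * ‖x‖ ^ (α - 2)| ≤ M := by
  obtain ⟨M₁, h₁⟩ := hK.exists_bound_of_continuousOn (continuousOn_norm_rpow α h0)
  obtain ⟨M₂, h₂⟩ := hK.exists_bound_of_continuousOn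
    (continuousOn_const (c := c) |>.mul (continuousOn_norm_rpow (α - 1) h0))
  obtain ⟨M₃, h₃⟩ := hK.exists_bound_of_continuousOn
    (continuousOn_const (c := b) |>.mul (continuousOn_norm_rpow (α - 2) h0))
  refine ⟨max 0 (max M₁ (max M₂ M₃)), le_max_left _ _, fun x hx =>
    ⟨?_, ?_, ?_⟩⟩
  · exact (le_abs_self _).trans ((h₁ x hx).trans ((le_max_left _ _).trans (le_max_right _ _)))
  · exact (h₂ x hx).trans ((le_max_left _ _).trans ((le_max_right _ _).trans (le_max_right _ _)))
  · exact (h₃ x hx).trans ((le_max_right _ _).trans ((le_max_right _ _).trans (le_max_right _ _)))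

lemma measurable_ofReal_norm_rpow (k a : ℝ) :
    Measurable fun x : E N => ((k * ‖x‖ ^ a : ℝ) : ℂ) :=
  Complex.measurable_ofReal.comp (measurable_const.mul (measurable_norm.pow_const a))

lemma aestronglyMeasurable_opLWeak {μ : Measure (E N)} (α b c : ℝ) {H G : Fin N → E N → ℂ}
    {U : E N → ℂ} (hH : ∀ i, AEStronglyMeasurable (H i) μ)
    (hG : ∀ i, AEStronglyMeasurable (G i) μ) (hU : AEStronglyMeasurable U μ) :
    AEStronglyMeasurable (opLWeak α b c H G U) μ := by
  have h1 : AEStronglyMeasurable (fun x : E N => ((‖x‖ ^ α : ℝ) : ℂ)) μ := by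
    simpa using (measurable_ofReal_norm_rpow (N := N) 1 α).aestronglyMeasurable
  have h2 := fun k a => (measurable_ofReal_norm_rpow (N := N) k a).aestronglyMeasurable (μ := μ)
  have h3 : ∀ i, AEStronglyMeasurable (fun x : E N => ((x i / ‖x‖ : ℝ) : ℂ)) μ := fun i =>
    (Complex.measurable_ofReal.comp
      (((EuclideanSpace.proj i : E N →L[ℝ] ℝ).continuous.measurable).div
        measurable_norm)).aestronglyMeasurable
  refine ((h1.mul ?_).add ((h2 _ _).mul ?_)).sub ((h2 _ _).mul hU)
  · exact Finset.aestronglyMeasurable_fun_sum _ fun i _ => hH i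
  · exact Finset.aestronglyMeasurable_fun_sum _ fun i _ => (h3 i).mul (hG i)

lemma memLp_sum_norm {μ : Measure (E N)} {H G : Fin N → E N → ℂ} {U : E N → ℂ}
    (hH : ∀ i, MemLp (H i) p μ) (hG : ∀ i, MemLp (G i) p μ) (hU : MemLp U p μ) :
    MemLp (fun x => ∑ i, ‖H i x‖ + ∑ i, ‖G i x‖ + ‖U x‖) p μ :=
  ((memLp_finsetSum Finset.univ fun i _ => (hH i).norm).add
    (memLp_finsetSum Finset.univ fun i _ => (hG i).norm)).add hU.norm

lemma eLpNorm_sum_norm_le {μ : Measure (E N)} (hp1 : 1 < p) {H G : Fin N → E N → ℂ} {U : E N → ℂ}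
    (hH : ∀ i, AEStronglyMeasurable (H i) μ) (hG : ∀ i, AEStronglyMeasurable (G i) μ)
    (hU : AEStronglyMeasurable U μ) :
    eLpNorm (fun x => ∑ i, ‖H i x‖ + ∑ i, ‖G i x‖ + ‖U x‖) p μ ≤
      ∑ i, eLpNorm (H i) p μ + ∑ i, eLpNorm (G i) p μ + eLpNorm U p μ := by
  have hs : ∀ {F : Fin N → E N → ℂ}, (∀ i, AEStronglyMeasurable (F i) μ) →
      AEStronglyMeasurable (fun x => ∑ i, ‖F i x‖) μ ∧
      eLpNorm (fun x => ∑ i, ‖F i x‖) p μ ≤ ∑ i, eLpNorm (F i) p μ := fun {F} hF => by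
    refine ⟨Finset.aestronglyMeasurable_fun_sum _ fun i _ => (hF i).norm, ?_⟩
    have := eLpNorm_sum_le (p := p) (μ := μ) (s := Finset.univ) (f := fun i x => ‖F i x‖)
      (fun i _ => (hF i).norm) hp1.le
    simp_rw [eLpNorm_norm] at this
    refine le_trans (le_of_eq ?_) this
    congr 1
    ext x
    rw [Finset.sum_apply]
  refine (eLpNorm_add_le ((hs hH).1.add (hs hG).1) hU.norm hp1.le).trans ?_
  rw [eLpNorm_norm]
  exact add_le_add ((eLpNorm_add_le (hs hH).1 (hs hG).1 hp1.le).trans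
    (add_le_add (hs hH).2 (hs hG).2)) le_rfl

/-- The sector condition for compactly supported Sobolev functions, by mollification. -/
lemma neg_integral_opLWeak_mem_sector [Fact (1 ≤ p)] (hp1 : 1 < p) (hp : p ≠ ⊤)
    {α b c l s : ℝ} (hs : s * p.toReal = N - 2 + α) (hf : 0 ≤ quadF N b c s) (hl : 0 ≤ l)
    (hl1 : |p.toReal - 2| + |2 - N + 2 * s - c| / 2 ≤ l * min 1 (p.toReal - 1))
    (hl2 : |2 - N + 2 * s - c| / 2 ≤ l * quadF N b c s)
    {K : Set (E N)} (hK : IsCompact K) (hKΩ : K ⊆ Omega N) {U : E N → ℂ} {G H : Fin N → E N → ℂ}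
    (hU : MemLp U p volume) (hG : ∀ i, MemLp (G i) p volume) (hH : ∀ i, MemLp (H i) p volume)
    (hU0 : ∀ x ∉ K, U x = 0) (hG0 : ∀ i, ∀ x ∉ K, G i x = 0) (hH0 : ∀ i, ∀ x ∉ K, H i x = 0)
    (hUG : ∀ i, HasGlobalWeakPartial i U (G i)) (hGH : ∀ i, HasGlobalWeakPartial i (G i) (H i)) :
    -∫ x, opLWeak α b c H G U x * dualFun p.toReal (U x) ∈ sector l := by
  have hUl := hU.locallyIntegrable hp1.le
  have hGl := fun i => (hG i).locallyIntegrable hp1.le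
  have hHl := fun i => (hH i).locallyIntegrable hp1.le
  obtain ⟨δ, hδ, hsub⟩ := hK.exists_cthickening_subset_open isOpen_Omega hKΩ
  set K' := Metric.cthickening δ K with hK'
  have hK'c : IsCompact K' := hK.cthickening
  have hKK' : K ⊆ K' := Metric.self_subset_cthickening K
  obtain ⟨M, hM0, hM⟩ := exists_weight_bound α b c hK'c fun x hx => (hsub hx).1
  have hW0 : ∀ x ∉ K, opLWeak α b c H G U x = 0 := fun x hx => by
    simp [opLWeak, hU0 x hx, hG0 _ x hx, hH0 _ x hx]
  have hWm : MemLp (opLWeak α b c H G U) p volume := by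
    refine (memLp_sum_norm hH hG hU).of_le_mul (c := M)
      (aestronglyMeasurable_opLWeak α b c (fun i => (hH i).1) (fun i => (hG i).1) hU.1)
      (Eventually.of_forall fun x => ?_)
    by_cases hx : x ∈ K
    · have hMx := hM x (hKK' hx)
      have := norm_opLWeak_sub_le hMx.1 hMx.2.1 hMx.2.2 H G 0 0 U 0
      simp only [Pi.zero_apply, sub_zero] at this
      have hz : opLWeak α b c (0 : Fin N → E N → ℂ) 0 0 x = 0 := by simp [opLWeak]
      rw [hz, sub_zero] at this
      exact this.trans (mul_le_mul_of_nonneg_left (le_abs_self _) hM0)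
    · rw [hW0 x hx, norm_zero]; positivity
  set μ := (volume : Measure (E N)).restrict (Omega N) with hμ
  have hUμ : MemLp U p μ := hU.restrict _
  have hWμ : MemLp (opLWeak α b c H G U) p μ := hWm.restrict _
  -- The pair (U, LU) is a limit of pairs from the test graph. On K' the derivatives of the
  -- mollified function are the mollified weak derivatives and the coefficients are bounded by M;
  -- off K' both sides vanish.
  have hmem : (hUμ.toLp U, hWμ.toLp _) ∈ Lmin N p α b c := by
    have hev : ∀ᶠ n in atTop, IsTest K' (mollify (bumpSeq N n) U) ∧
        IsTest (Omega N) (mollify (bumpSeq N n) U) := by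
      filter_upwards [eventually_isTest_mollify isOpen_Omega hK hKΩ hUl hU0,
        tendsto_rOut_bumpSeq.eventually (eventually_le_nhds hδ)] with n hn hn2
      exact ⟨⟨hn.1, hn.2.1, (tsupport_mollify_subset _ hU0).trans
        (Metric.cthickening_mono hn2 K)⟩, hn⟩
    obtain ⟨n₀, hn₀⟩ := eventually_atTop.1 hev
    set u : ℕ → E N → ℂ := fun n => mollify (bumpSeq N (n + n₀)) U with hu
    have ht : ∀ n, IsTest (Omega N) (u n) := fun n => (hn₀ _ (Nat.le_add_left _ _)).2
    have ht' : ∀ n, IsTest K' (u n) := fun n => (hn₀ _ (Nat.le_add_left _ _)).1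
    have hum : ∀ n, MemLp (u n) p μ := fun n =>
      ((ht n).1.continuous.memLp_of_hasCompactSupport (ht n).2.1).restrict _
    have hLm : ∀ n, MemLp (opL α b c (u n)) p μ := fun n =>
      ((continuous_opL (ht n)).memLp_of_hasCompactSupport (hasCompactSupport_opL (ht n))).restrict _
    have hconv : ∀ {F : E N → ℂ}, MemLp F p volume →
        Tendsto (fun n => eLpNorm (mollify (bumpSeq N (n + n₀)) F - F) p volume) atTop (𝓝 0) :=
      fun {F} hF => (tendsto_add_atTop_iff_nat n₀).2 (tendsto_eLpNorm_mollify_sub hp1 hp hF)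
    have c1 : Tendsto (fun n => (hum n).toLp _) atTop (𝓝 (hUμ.toLp U)) := by
      rw [Lp.tendsto_Lp_iff_tendsto_eLpNorm'']
      exact tendsto_of_tendsto_of_tendsto_of_le_of_le tendsto_const_nhds (hconv hU)
        (fun n => zero_le) fun n => eLpNorm_mono_measure _ Measure.restrict_le_self
    have c2 : Tendsto (fun n => (hLm n).toLp _) atTop (𝓝 (hWμ.toLp _)) := by
      rw [Lp.tendsto_Lp_iff_tendsto_eLpNorm'']
      have h0 : Tendsto (fun n => ENNReal.ofReal M *
          (∑ i, eLpNorm (mollify (bumpSeq N (n + n₀)) (H i) - H i) p volume +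
            ∑ i, eLpNorm (mollify (bumpSeq N (n + n₀)) (G i) - G i) p volume +
            eLpNorm (mollify (bumpSeq N (n + n₀)) U - U) p volume)) atTop (𝓝 0) := by
        have := ((tendsto_finsetSum Finset.univ fun i _ => hconv (hH i)).add
          (tendsto_finsetSum Finset.univ fun i _ => hconv (hG i))).add (hconv hU)
        simp only [Finset.sum_const_zero, add_zero] at this
        simpa using ENNReal.Tendsto.const_mul this (Or.inr ENNReal.ofReal_ne_top)
      refine tendsto_of_tendsto_of_tendsto_of_le_of_le tendsto_const_nhds h0
        (fun n => zero_le) fun n => (eLpNorm_mono_measure _ Measure.restrict_le_self).trans ?_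
      have hm : ∀ {F : E N → ℂ}, MemLp F p volume → AEStronglyMeasurable
          (mollify (bumpSeq N (n + n₀)) F - F) volume := fun {F} hF =>
        (contDiff_mollify _ (hF.locallyIntegrable hp1.le)).continuous.aestronglyMeasurable.sub hF.1
      refine le_trans ?_ (mul_le_mul_right (eLpNorm_sum_norm_le hp1 (fun i => hm (hH i))
        (fun i => hm (hG i)) (hm hU)) _)
      refine eLpNorm_le_mul_eLpNorm_of_ae_le_mul (Eventually.of_forall fun x => ?_) p
      refine le_trans ?_ (mul_le_mul_of_nonneg_left (le_abs_self _) hM0)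
      rw [Pi.sub_apply]
      by_cases hx : x ∈ K'
      · have hMx := hM x hx
        rw [opL_eq_opLWeak (ht n).contDiff_two]
        simp_rw [hu, fun i => partialD_mollify (bumpSeq N (n + n₀)) hUl (hUG i),
          fun i => partialD_mollify (bumpSeq N (n + n₀)) (hGl i) (hGH i)]
        exact norm_opLWeak_sub_le hMx.1 hMx.2.1 hMx.2.2 _ _ _ _ _ _
      · rw [hW0 x fun h => hx (hKK' h), opL_eq_zero (ht n).contDiff_two fun h => hx ((ht' n).2.2 h),
          sub_zero, norm_zero]
        positivity
    refine mem_closure_of_tendsto (c1.prodMk_nhds c2) (Eventually.of_forall fun n => ?_)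
    exact ⟨u n, ht n, (hum n).coeFn_toLp, (hLm n).coeFn_toLp⟩
  have key := neg_dualPairing_Lmin_mem_sector hp1 hp hs hf hl hl1 hl2 hmem
  have e : dualPairing (hUμ.toLp U) (hWμ.toLp (opLWeak α b c H G U)) =
      ∫ x, opLWeak α b c H G U x * dualFun p.toReal (U x) := by
    rw [← setIntegral_eq_integral_of_forall_compl_eq_zero (s := Omega N)
      (f := fun x => opLWeak α b c H G U x * dualFun p.toReal (U x)) fun x hx => by
        rw [hW0 x fun h => hx (hKΩ h), zero_mul]]
    refine integral_congr_ae ?_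
    filter_upwards [hUμ.coeFn_toLp, hWμ.coeFn_toLp] with x h1 h2
    rw [h1, h2]
  rwa [e] at key

end WeakMin

/-! ### Boundary layer estimates -/

section BoundaryLayer

variable {N : ℕ} {p : ℝ≥0∞} {ε : ℝ}

lemma exists_abs_weight_le (hε : 0 < ε) {k : ℝ → ℝ} (hk : Continuous k) :
    ∃ M, ∀ᵐ x ∂((volume : Measure (E N)).restrict (OmegaEps N ε)),
      ‖‖x‖ ^ (2 - N : ℝ) * k (‖x‖ ^ 2)‖ ≤ M := by
  obtain ⟨M, -, hM⟩ := exists_abs_le_OmegaEps (N := N) hε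
    (k := fun x => ‖x‖ ^ (2 - N : ℝ) * k (‖x‖ ^ 2))
    ((continuousOn_norm_rpow _ fun x hx => hx).mul
      (hk.comp (continuous_norm.pow 2)).continuousOn)
  exact ⟨M, (ae_restrict_iff' measurableSet_OmegaEps).2 (Eventually.of_forall hM)⟩

lemma aestronglyMeasurable_weight {μ : Measure (E N)} {k : ℝ → ℝ} (hk : Continuous k) :
    AEStronglyMeasurable (fun x : E N => ‖x‖ ^ (2 - N : ℝ) * k (‖x‖ ^ 2)) μ :=
  ((measurable_norm.pow_const _).mul
    (hk.measurable.comp (measurable_norm.pow_const 2))).aestronglyMeasurable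

lemma integrable_weight_mul_rpow (hp1 : 1 < p) (hp : p ≠ ⊤) (hε : 0 < ε) {F : E N → ℂ}
    (hF : MemLp F p (volume.restrict (OmegaEps N ε))) {k : ℝ → ℝ} (hk : Continuous k) :
    Integrable (fun x => ‖x‖ ^ (2 - N : ℝ) * k (‖x‖ ^ 2) * ‖F x‖ ^ p.toReal)
      (volume.restrict (OmegaEps N ε)) := by
  obtain ⟨M, hM⟩ := exists_abs_weight_le (N := N) hε hk
  exact (integrable_norm_rpow_of_memLp hp1 hp hF).bdd_mul (aestronglyMeasurable_weight hk) hM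

lemma integrable_weight_mul_sum_rpow (hp1 : 1 < p) (hp : p ≠ ⊤) (hε : 0 < ε)
    {g : Fin N → E N → ℂ} (hg : ∀ i, MemLp (g i) p (volume.restrict (OmegaEps N ε))) {k : ℝ → ℝ}
    (hk : Continuous k) :
    Integrable (fun x => ‖x‖ ^ (2 - N : ℝ) * k (‖x‖ ^ 2) * (∑ i, ‖g i x‖) ^ p.toReal)
      (volume.restrict (OmegaEps N ε)) := by
  have h : MemLp (fun x => ((∑ i, ‖g i x‖ : ℝ) : ℂ)) p (volume.restrict (OmegaEps N ε)) :=
    (memLp_finsetSum Finset.univ fun i _ => (hg i).norm).ofReal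
  have h2 := integrable_weight_mul_rpow hp1 hp hε h hk
  refine h2.congr (Eventually.of_forall fun x => ?_)
  simp only []
  rw [Complex.norm_real, Real.norm_of_nonneg (Finset.sum_nonneg fun i _ => norm_nonneg _)]

/-- The radial multiplier used for the boundary trace estimate. -/
def traceProfile (ε τ σ r δ ρ : ℝ) : ℝ :=
  cutProfile (bdryFun ε ρ / τ) * (1 - bdryKernel σ r δ ρ) * ((ε ^ 2 + (ε⁻¹) ^ 2) / 2 - ρ)

lemma contDiff_cutProfile_bdryFun (ε τ : ℝ) :
    ContDiff ℝ ∞ fun ρ => cutProfile (bdryFun ε ρ / τ) :=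
  contDiff_cutProfile.comp ((contDiff_bdryFun ε).div_const τ)

lemma contDiff_traceProfile (ε τ σ r δ : ℝ) : ContDiff ℝ ∞ (traceProfile ε τ σ r δ) :=
  ((contDiff_cutProfile_bdryFun ε τ).mul (contDiff_const.sub (contDiff_bdryKernel σ r δ))).mul
    (contDiff_const.sub contDiff_id)

/-- The factor m-ρ, with m the midpoint of ε² and ε⁻², is half the derivative of `bdryFun`. The term
where the cutoff is differentiated thus contains (m-ρ)² and is nonnegative wherever the kernel is at
most 1. -/
lemma deriv_traceProfile (ε τ σ r δ ρ : ℝ) : deriv (traceProfile ε τ σ r δ) ρ =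
    deriv cutProfile (bdryFun ε ρ / τ) * (2 / τ) * (1 - bdryKernel σ r δ ρ) *
      ((ε ^ 2 + (ε⁻¹) ^ 2) / 2 - ρ) ^ 2 +
    cutProfile (bdryFun ε ρ / τ) * (bdryKernel σ r δ ρ *
      (σ * ((ε ^ 2 + (ε⁻¹) ^ 2) / 2 - ρ) / δ) - (1 - bdryKernel σ r δ ρ)) := by
  have h1 : HasDerivAt (fun ρ => cutProfile (bdryFun ε ρ / τ)) _ ρ :=
    HasDerivAt.comp (h₂ := cutProfile) (h := fun ρ => bdryFun ε ρ / τ) ρ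
      ((contDiff_cutProfile.differentiable (by simp)) (bdryFun ε ρ / τ)).hasDerivAt
      ((hasDerivAt_bdryFun ε ρ).div_const τ)
  have h2 : HasDerivAt (fun ρ => 1 - bdryKernel σ r δ ρ) _ ρ :=
    (hasDerivAt_bdryKernel σ r δ ρ).const_sub 1
  have h3 : HasDerivAt (fun ρ => (ε ^ 2 + (ε⁻¹) ^ 2) / 2 - ρ) (-1) ρ :=
    (hasDerivAt_id ρ).const_sub _
  have h4 : HasDerivAt (traceProfile ε τ σ r δ) _ ρ := (h1.mul h2).mul h3
  rw [h4.deriv]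
  simp only [Pi.mul_apply]
  ring

/-- The potentially large term of order 1/τ has a good sign and is dropped, so no constant depends
on τ. By `hr`, σ(m-ρ) = Λ/2 - σ(ρ-r) with Λ = ε⁻² - ε², and t e^(-t) ≤ 1 bounds the correction. What
is left is the main term Λ/δ times the kernel, minus a constant. -/
lemma traceProfile_estimate {q τ σ r δ : ℝ} (hq : 1 < q) (hε : 0 < ε) (hτ : 0 < τ) (hδ : 0 < δ)
    (hr : σ * ((ε ^ 2 + (ε⁻¹) ^ 2) / 2 - r) = ((ε⁻¹) ^ 2 - ε ^ 2) / 2) {ρ : ℝ}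
    (hρ : 0 ≤ σ * (ρ - r)) (hρ1 : ε ^ 2 < ρ) (hρ2 : ρ < (ε⁻¹) ^ 2) {a b : ℝ} (ha : 0 ≤ a)
    (hb : 0 ≤ b) :
    cutProfile (bdryFun ε ρ / τ) * (((ε⁻¹) ^ 2 - ε ^ 2) / δ * bdryKernel σ r δ ρ -
        (4 + q * ε⁻¹ * (((ε⁻¹) ^ 2 - ε ^ 2) / 2))) * a ^ q +
      q * ε⁻¹ * |traceProfile ε τ σ r δ ρ| * (a ^ (q - 1) * b) ≤
    2 * deriv (traceProfile ε τ σ r δ) ρ * a ^ q +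
      q * ε⁻¹ * (((ε⁻¹) ^ 2 - ε ^ 2) / 2) * cutProfile (bdryFun ε ρ / τ) * b ^ q := by
  set m := (ε ^ 2 + (ε⁻¹) ^ 2) / 2 with hm
  set Λ := (ε⁻¹) ^ 2 - ε ^ 2 with hΛ
  set χ := cutProfile (bdryFun ε ρ / τ) with hχ
  set e := bdryKernel σ r δ ρ with he
  have hχ0 : 0 ≤ χ := cutProfile_nonneg _
  have he0 : 0 < e := bdryKernel_pos _ _ _ _
  have he1 : e ≤ 1 := Real.exp_le_one_iff.2 (div_nonpos_of_nonpos_of_nonneg (by linarith) hδ.le)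
  have hde : e * (σ * (ρ - r) / δ) ≤ 1 := by
    have h1 : σ * (ρ - r) / δ ≤ Real.exp (σ * (ρ - r) / δ) := by
      linarith [Real.add_one_le_exp (σ * (ρ - r) / δ)]
    calc e * (σ * (ρ - r) / δ) ≤ e * Real.exp (σ * (ρ - r) / δ) :=
          mul_le_mul_of_nonneg_left h1 he0.le
      _ = 1 := by rw [he, bdryKernel, ← Real.exp_add, neg_div, neg_add_cancel, Real.exp_zero]
  have hψ : |traceProfile ε τ σ r δ ρ| ≤ Λ / 2 * χ := by
    have hmρ : |m - ρ| ≤ Λ / 2 := by rw [abs_le]; constructor <;> linarith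
    rw [traceProfile, abs_mul, abs_mul, abs_of_nonneg hχ0, abs_of_nonneg (by linarith : 0 ≤ 1 - e)]
    calc χ * (1 - e) * |m - ρ| ≤ χ * 1 * (Λ / 2) := by gcongr; linarith
      _ = _ := by ring
  have hd : χ * (Λ / 2 / δ * e - 2) ≤ deriv (traceProfile ε τ σ r δ) ρ := by
    rw [deriv_traceProfile]
    have h1 : 0 ≤ deriv cutProfile (bdryFun ε ρ / τ) * (2 / τ) * (1 - e) * (m - ρ) ^ 2 := by
      have := deriv_cutProfile_nonneg (bdryFun ε ρ / τ)
      have : 0 ≤ 1 - e := by linarith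
      positivity
    have h2 : e * (σ * (m - ρ) / δ) = Λ / 2 / δ * e - e * (σ * (ρ - r) / δ) := by
      rw [show σ * (m - ρ) = Λ / 2 - σ * (ρ - r) by linear_combination hr]
      ring
    refine le_trans ?_ (le_add_of_nonneg_left h1)
    refine mul_le_mul_of_nonneg_left ?_ hχ0
    rw [h2]
    linarith
  have hy := mul_rpow_le hq ha hb
  have hap : 0 ≤ a ^ q := by positivity
  have hB : 0 ≤ q * ε⁻¹ := by positivity
  have hΛ0 : 0 ≤ Λ := by linarith
  have s1 : q * ε⁻¹ * |traceProfile ε τ σ r δ ρ| * (a ^ (q - 1) * b) ≤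
      q * ε⁻¹ * (Λ / 2 * χ) * (a ^ q + b ^ q) := by gcongr
  have s2 := mul_le_mul_of_nonneg_right hd hap
  have e1 : Λ / δ * e = 2 * (Λ / 2 / δ * e) := by ring
  rw [e1]
  nlinarith [s1, s2]

lemma partialD_annCutoff_eq_zero (hε : 0 < ε) {τ : ℝ} (hτ : 0 < τ) (hτ1 : τ ≤ 1) {x : E N}
    (hx : x ∈ OmegaEps N ε) (h : 2 * τ < bdryFun ε (‖x‖ ^ 2)) (i : Fin N) :
    partialD i (fun y => (annCutoff N ε τ y : ℂ)) x = 0 := by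
  obtain ⟨C, -, hC⟩ := exists_partialD_annCutoff_le N hε
  exact ((hC τ hτ hτ1 x hx i).2.2 h).1

/-- Here g has no boundary condition, so the radial inequality is applied to a compactly supported
truncation of g, which coincides with g wherever the cutoff in the profile is nonzero. -/
lemma integral_cutoff_bdryKernel_le (hp1 : 1 < p) (hp : p ≠ ⊤) (hε : 0 < ε) (hε1 : ε < 1)
    {τ σ r δ : ℝ} (hτ : 0 < τ) (hτ1 : τ ≤ 1) (hδ : 0 < δ)
    (hr : σ * ((ε ^ 2 + (ε⁻¹) ^ 2) / 2 - r) = ((ε⁻¹) ^ 2 - ε ^ 2) / 2)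
    (h0 : ∀ x ∈ OmegaEps N ε, 0 ≤ σ * (‖x‖ ^ 2 - r)) {g : LpOn p (OmegaEps N ε)}
    {h : Fin N → LpOn p (OmegaEps N ε)} (hw : ∀ j, HasWeakPartial j g (h j)) :
    ∫ x in OmegaEps N ε, ‖x‖ ^ (2 - N : ℝ) * (cutProfile (bdryFun ε (‖x‖ ^ 2) / τ) *
        (((ε⁻¹) ^ 2 - ε ^ 2) / δ * bdryKernel σ r δ (‖x‖ ^ 2) -
          (4 + p.toReal * ε⁻¹ * (((ε⁻¹) ^ 2 - ε ^ 2) / 2)))) * ‖g x‖ ^ p.toReal ≤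
      ∫ x in OmegaEps N ε, ‖x‖ ^ (2 - N : ℝ) * (p.toReal * ε⁻¹ * (((ε⁻¹) ^ 2 - ε ^ 2) / 2) *
        cutProfile (bdryFun ε (‖x‖ ^ 2) / τ)) * (∑ i, ‖h i x‖) ^ p.toReal := by
  have hp' := one_lt_toReal hp1 hp
  have hfin := isFiniteMeasure_OmegaEps (N := N) hε
  -- The truncation at scale τ/4 is constantly 1 once `bdryFun` exceeds τ/2, hence throughout the
  -- set where the profile at scale τ is nonzero.
  have hτ4 : 0 < τ / 4 := by positivity
  set η : E N → ℂ := fun x => (annCutoff N ε (τ / 4) x : ℂ) with hη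
  have hηt : IsTest (OmegaEps N ε) η := isTest_annCutoff hε hε1 hτ4
  set F : E N → ℂ := fun x => η x * g x with hF
  set H : Fin N → E N → ℂ := fun i x => η x * h i x + partialD i η x * g x with hH
  have hFm : MemLp F p volume := hηt.memLp_mul_Lp measurableSet_OmegaEps g
  have hHm : ∀ i, MemLp (H i) p volume := fun i =>
    (hηt.memLp_mul_Lp measurableSet_OmegaEps (h i)).add
      ((hηt.partialD i).memLp_mul_Lp measurableSet_OmegaEps g)
  have hFl := hFm.locallyIntegrable hp1.le
  have hF0 : ∀ x ∉ tsupport η, F x = 0 := fun x hx => by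
    simp [hF, image_eq_zero_of_notMem_tsupport hx]
  obtain ⟨n₀, hn₀⟩ := eventually_atTop.1 (eventually_isTest_mollify (isOpen_OmegaEps N ε) hηt.2.1
    hηt.2.2 hFl hF0)
  have hconv : ∀ {f : E N → ℂ}, MemLp f p volume → Tendsto (fun n =>
      eLpNorm (mollify (bumpSeq N (n + n₀)) f - f) p (volume.restrict (OmegaEps N ε))) atTop
      (𝓝 0) := fun {f} hf =>
    tendsto_of_tendsto_of_tendsto_of_le_of_le tendsto_const_nhds
      ((tendsto_add_atTop_iff_nat n₀).2 (tendsto_eLpNorm_mollify_sub hp1 hp hf))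
      (fun n => zero_le) fun n => eLpNorm_mono_measure _ Measure.restrict_le_self
  have hpd : ∀ i n, partialD i (mollify (bumpSeq N (n + n₀)) F) =
      mollify (bumpSeq N (n + n₀)) (H i) := fun i n =>
    partialD_mollify _ hFl ((hw i).cutoff hp1 hηt)
  have hcc := (contDiff_cutProfile_bdryFun ε τ).continuous
  have key := integral_radial_le_of_tendsto hp1 hp hε
    (G := fun n => mollify (bumpSeq N (n + n₀)) F) (F := F) (g := H)
    (fun n => hn₀ _ (Nat.le_add_left _ _)) (hFm.restrict _) (fun i => (hHm i).restrict _)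
    (hconv hFm) (fun i => by simp_rw [hpd i]; exact hconv (hHm i))
    (ψ := traceProfile ε τ σ r δ)
    (k₁ := fun ρ => cutProfile (bdryFun ε ρ / τ) * (((ε⁻¹) ^ 2 - ε ^ 2) / δ * bdryKernel σ r δ ρ -
        (4 + p.toReal * ε⁻¹ * (((ε⁻¹) ^ 2 - ε ^ 2) / 2))))
    (k₂ := fun ρ => p.toReal * ε⁻¹ * (((ε⁻¹) ^ 2 - ε ^ 2) / 2) * cutProfile (bdryFun ε ρ / τ))
    ((contDiff_traceProfile ε τ σ r δ).of_le (by norm_cast))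
    (hcc.mul ((continuous_const.mul (contDiff_bdryKernel σ r δ).continuous).sub continuous_const))
    (continuous_const.mul hcc)
    fun x hx a b ha hb => traceProfile_estimate hp' hε hτ hδ hr (h0 x hx)
      (norm_sq_bounds hε hx).1 (norm_sq_bounds hε hx).2 ha hb
  have hcut : ∀ x ∈ OmegaEps N ε, cutProfile (bdryFun ε (‖x‖ ^ 2) / τ) ≠ 0 →
      F x = g x ∧ ∀ i, H i x = h i x := fun x hx hne => by
    have hD : τ < bdryFun ε (‖x‖ ^ 2) := by
      by_contra hcon
      exact hne (cutProfile_of_le ((div_le_one hτ).2 (not_lt.1 hcon)))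
    have h1 : η x = 1 := by
      simp only [hη]
      rw [annCutoff_eq hx.1, cutProfile_of_two_le, Complex.ofReal_one]
      rw [le_div_iff₀ hτ4]; linarith
    refine ⟨by simp [hF, h1], fun i => ?_⟩
    have h2 : partialD i η x = 0 :=
      partialD_annCutoff_eq_zero hε hτ4 (by linarith) hx (by linarith) i
    simp [hH, h1, h2]
  refine le_trans (le_of_eq ?_) (key.trans (le_of_eq ?_))
  · refine setIntegral_congr_fun measurableSet_OmegaEps fun x hx => ?_
    by_cases hne : cutProfile (bdryFun ε (‖x‖ ^ 2) / τ) = 0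
    · simp [hne]
    · rw [(hcut x hx hne).1]
  · refine setIntegral_congr_fun measurableSet_OmegaEps fun x hx => ?_
    by_cases hne : cutProfile (bdryFun ε (‖x‖ ^ 2) / τ) = 0
    · simp [hne]
    · simp_rw [(hcut x hx hne).2]

/-- A boundary trace estimate: functions in `W^{1,p}` do not concentrate at the boundary. -/
lemma exists_integral_bdryKernel_le (hp1 : 1 < p) (hp : p ≠ ⊤) (hε : 0 < ε) (hε1 : ε < 1)
    {σ r : ℝ}
    (hr : σ * ((ε ^ 2 + (ε⁻¹) ^ 2) / 2 - r) = ((ε⁻¹) ^ 2 - ε ^ 2) / 2)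
    (h0 : ∀ x ∈ OmegaEps N ε, 0 ≤ σ * (‖x‖ ^ 2 - r)) {g : LpOn p (OmegaEps N ε)}
    {h : Fin N → LpOn p (OmegaEps N ε)} (hw : ∀ j, HasWeakPartial j g (h j)) :
    ∃ C, 0 ≤ C ∧ ∀ δ, 0 < δ → ∫ x in OmegaEps N ε,
      ‖x‖ ^ (2 - N : ℝ) * bdryKernel σ r δ (‖x‖ ^ 2) * ‖g x‖ ^ p.toReal ≤ C * δ := by
  have hp' := one_lt_toReal hp1 hp
  set Λ := (ε⁻¹) ^ 2 - ε ^ 2 with hΛ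
  have hΛ0 : 0 < Λ := sub_pos.2 (sq_lt_inv_sq hε hε1)
  set B := p.toReal * ε⁻¹ * (Λ / 2) with hB
  have hB0 : 0 ≤ B := by positivity
  set I := ∫ x in OmegaEps N ε, ‖x‖ ^ (2 - N : ℝ) * 1 * ‖g x‖ ^ p.toReal with hI
  set J := ∫ x in OmegaEps N ε, ‖x‖ ^ (2 - N : ℝ) * 1 * (∑ i, ‖h i x‖) ^ p.toReal with hJ
  have hI0 : 0 ≤ I := integral_nonneg fun x => by positivity
  have hJ0 : 0 ≤ J := integral_nonneg fun x => by positivity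
  have hgm : MemLp g p (volume.restrict (OmegaEps N ε)) := Lp.memLp g
  have hhm : ∀ i, MemLp (h i) p (volume.restrict (OmegaEps N ε)) := fun i => Lp.memLp (h i)
  -- The main term Λ/δ stays on the left; the lower order terms are bounded by replacing the cutoff
  -- with 1. Division by Λ/δ produces the factor δ.
  refine ⟨(B * J + (4 + B) * I) / Λ, by positivity, fun δ hδ => ?_⟩
  have hKc := (contDiff_bdryKernel σ r δ).continuous
  have step : ∀ τ, 0 < τ → τ ≤ 1 → ∫ x in OmegaEps N ε, ‖x‖ ^ (2 - N : ℝ) *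
      (cutProfile (bdryFun ε (‖x‖ ^ 2) / τ) * bdryKernel σ r δ (‖x‖ ^ 2)) * ‖g x‖ ^ p.toReal ≤
      (B * J + (4 + B) * I) / Λ * δ := fun τ hτ hτ1 => by
    have hcc := (contDiff_cutProfile_bdryFun ε τ).continuous
    have key := integral_cutoff_bdryKernel_le hp1 hp hε hε1 hτ hτ1 hδ hr h0 hw
    have i1 : Integrable (fun x => ‖x‖ ^ (2 - N : ℝ) *
        (cutProfile (bdryFun ε (‖x‖ ^ 2) / τ) * bdryKernel σ r δ (‖x‖ ^ 2)) * ‖g x‖ ^ p.toReal)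
        (volume.restrict (OmegaEps N ε)) :=
      integrable_weight_mul_rpow hp1 hp hε hgm (hcc.mul hKc)
    have i2 : Integrable (fun x => ‖x‖ ^ (2 - N : ℝ) *
        (cutProfile (bdryFun ε (‖x‖ ^ 2) / τ)) * ‖g x‖ ^ p.toReal) (volume.restrict (OmegaEps N ε)) :=
      integrable_weight_mul_rpow hp1 hp hε hgm hcc
    have i3 : Integrable (fun x => ‖x‖ ^ (2 - N : ℝ) * 1 * ‖g x‖ ^ p.toReal)
        (volume.restrict (OmegaEps N ε)) :=
      integrable_weight_mul_rpow hp1 hp hε hgm (k := fun _ => 1) continuous_const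
    have i4 : Integrable (fun x => ‖x‖ ^ (2 - N : ℝ) *
        (cutProfile (bdryFun ε (‖x‖ ^ 2) / τ)) * (∑ i, ‖h i x‖) ^ p.toReal)
        (volume.restrict (OmegaEps N ε)) :=
      integrable_weight_mul_sum_rpow hp1 hp hε hhm hcc
    have i5 : Integrable (fun x => ‖x‖ ^ (2 - N : ℝ) * 1 * (∑ i, ‖h i x‖) ^ p.toReal)
        (volume.restrict (OmegaEps N ε)) :=
      integrable_weight_mul_sum_rpow hp1 hp hε hhm (k := fun _ => 1) continuous_const
    have e1 : ∫ x in OmegaEps N ε, ‖x‖ ^ (2 - N : ℝ) * (cutProfile (bdryFun ε (‖x‖ ^ 2) / τ) *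
        (Λ / δ * bdryKernel σ r δ (‖x‖ ^ 2) - (4 + B))) * ‖g x‖ ^ p.toReal =
        Λ / δ * (∫ x in OmegaEps N ε, ‖x‖ ^ (2 - N : ℝ) * (cutProfile (bdryFun ε (‖x‖ ^ 2) / τ) *
          bdryKernel σ r δ (‖x‖ ^ 2)) * ‖g x‖ ^ p.toReal) -
        (4 + B) * ∫ x in OmegaEps N ε, ‖x‖ ^ (2 - N : ℝ) * (cutProfile (bdryFun ε (‖x‖ ^ 2) / τ)) *
          ‖g x‖ ^ p.toReal := by
      rw [← integral_const_mul, ← integral_const_mul,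
        ← integral_sub (i1.const_mul _) (i2.const_mul _)]
      exact integral_congr_ae (Eventually.of_forall fun x => by simp only []; ring)
    have e2 : ∫ x in OmegaEps N ε, ‖x‖ ^ (2 - N : ℝ) * (B * cutProfile (bdryFun ε (‖x‖ ^ 2) / τ)) *
        (∑ i, ‖h i x‖) ^ p.toReal = B * ∫ x in OmegaEps N ε, ‖x‖ ^ (2 - N : ℝ) *
        (cutProfile (bdryFun ε (‖x‖ ^ 2) / τ)) * (∑ i, ‖h i x‖) ^ p.toReal := by
      rw [← integral_const_mul]
      exact integral_congr_ae (Eventually.of_forall fun x => by simp only []; ring)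
    rw [← hΛ, ← hB, e1, e2] at key
    have l1 : ∫ x in OmegaEps N ε, ‖x‖ ^ (2 - N : ℝ) * (cutProfile (bdryFun ε (‖x‖ ^ 2) / τ)) *
          ‖g x‖ ^ p.toReal ≤ I := by
      refine integral_mono i2 i3 fun x => ?_
      have := cutProfile_le_one (bdryFun ε (‖x‖ ^ 2) / τ)
      simp only []
      gcongr
    have l2 : ∫ x in OmegaEps N ε, ‖x‖ ^ (2 - N : ℝ) * (cutProfile (bdryFun ε (‖x‖ ^ 2) / τ)) *
          (∑ i, ‖h i x‖) ^ p.toReal ≤ J := by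
      refine integral_mono i4 i5 fun x => ?_
      have := cutProfile_le_one (bdryFun ε (‖x‖ ^ 2) / τ)
      simp only []
      gcongr
    have l3 := mul_le_mul_of_nonneg_left l1 (by positivity : 0 ≤ 4 + B)
    have l4 := mul_le_mul_of_nonneg_left l2 hB0
    rw [div_mul_eq_mul_div, le_div_iff₀ hΛ0]
    have l5 : Λ / δ * (∫ x in OmegaEps N ε, ‖x‖ ^ (2 - N : ℝ) * (cutProfile (bdryFun ε (‖x‖ ^ 2) / τ) *
          bdryKernel σ r δ (‖x‖ ^ 2)) * ‖g x‖ ^ p.toReal) ≤ B * J + (4 + B) * I := by linarith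
    rw [div_mul_eq_mul_div, div_le_iff₀ hδ] at l5
    linarith
  -- The bound is uniform in τ and the cutoff is eventually 1 at each point, so dominated
  -- convergence removes it.
  have hlim : Tendsto (fun n : ℕ => ∫ x in OmegaEps N ε, ‖x‖ ^ (2 - N : ℝ) *
      (cutProfile (bdryFun ε (‖x‖ ^ 2) / (1 / ((n : ℝ) + 1))) * bdryKernel σ r δ (‖x‖ ^ 2)) *
        ‖g x‖ ^ p.toReal) atTop
      (𝓝 (∫ x in OmegaEps N ε, ‖x‖ ^ (2 - N : ℝ) * bdryKernel σ r δ (‖x‖ ^ 2) * ‖g x‖ ^ p.toReal)) := by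
    have i0 : Integrable (fun x => ‖x‖ ^ (2 - N : ℝ) * bdryKernel σ r δ (‖x‖ ^ 2) *
        ‖g x‖ ^ p.toReal) (volume.restrict (OmegaEps N ε)) := integrable_weight_mul_rpow hp1 hp hε hgm hKc
    refine tendsto_integral_of_dominated_convergence _
      (fun n => (integrable_weight_mul_rpow hp1 hp hε hgm
        ((contDiff_cutProfile_bdryFun ε _).continuous.mul hKc)).1) i0
      (fun n => Eventually.of_forall fun x => ?_) ?_
    · have hK0 := bdryKernel_pos σ r δ (‖x‖ ^ 2)
      have hc0 := cutProfile_nonneg (bdryFun ε (‖x‖ ^ 2) / (1 / ((n : ℝ) + 1)))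
      have hc1 := cutProfile_le_one (bdryFun ε (‖x‖ ^ 2) / (1 / ((n : ℝ) + 1)))
      rw [Real.norm_of_nonneg (by positivity)]
      gcongr
      exact mul_le_of_le_one_left hK0.le hc1
    · refine (ae_restrict_iff' measurableSet_OmegaEps).2 (Eventually.of_forall fun x hx => ?_)
      refine tendsto_const_nhds.congr' ?_
      have hD := bdryFun_pos hε hx
      filter_upwards [(tendsto_natCast_atTop_atTop (R := ℝ)).eventually_ge_atTop
        (2 / bdryFun ε (‖x‖ ^ 2))] with n hn
      rw [cutProfile_of_two_le, one_mul]
      rw [div_div_eq_mul_div, div_one]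
      rw [div_le_iff₀ hD] at hn
      nlinarith
  refine le_of_tendsto' hlim fun n => step (1 / ((n : ℝ) + 1)) (by positivity) ?_
  rw [div_le_one (by positivity)]
  have : (0 : ℝ) ≤ n := by positivity
  linarith

end BoundaryLayer

/-! ### The numerical range of `L_ε` -/

section AnnulusOperator

variable {N : ℕ} {p : ℝ≥0∞} {ε : ℝ}

/-- Needed because membership in W^{1,p}_0 supplies its own gradient, which must be identified with
the one from W^{2,p}. -/
lemma HasWeakPartial.unique {V : Set (E N)} (hV : IsOpen V)
    [IsFiniteMeasure ((volume : Measure (E N)).restrict V)] (hp1 : 1 < p) {i : Fin N}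
    {u g g' : LpOn p V} (h : HasWeakPartial i u g) (h' : HasWeakPartial i u g') : g = g' := by
  have hintg : Integrable (fun x => g x - g' x) (volume.restrict V) :=
    ((Lp.memLp g).integrable hp1.le).sub ((Lp.memLp g').integrable hp1.le)
  have hz := hV.ae_eq_zero_of_integral_contDiff_smul_eq_zero (μ := volume.restrict V)
    (f := fun x => g x - g' x) (hintg.locallyIntegrable.locallyIntegrableOn V) fun φ hφ hφc hφV => by
      have hφt : IsTest V fun x => (φ x : ℂ) := by
        refine ⟨Complex.ofRealCLM.contDiff.comp hφ,
          hφc.comp_left (g := fun r : ℝ => (r : ℂ)) Complex.ofReal_zero, ?_⟩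
        exact (tsupport_subset_tsupport fun x hx => by simp [hx]).trans hφV
      have e : (∫ x in V, g x * (φ x : ℂ)) = ∫ x in V, g' x * (φ x : ℂ) := by
        have := (h _ hφt).symm.trans (h' _ hφt)
        exact neg_injective this
      have hm := hφt.mono (Set.subset_univ V)
      have i1 := hm.integrable_mul_Lp hp1 g
      have i2 := hm.integrable_mul_Lp hp1 g'
      have e3 : ∫ x in V, φ x • (g x - g' x) =
          (∫ x in V, (φ x : ℂ) * g x) - ∫ x in V, (φ x : ℂ) * g' x := by
        rw [← integral_sub i1 i2]
        refine integral_congr_ae (Eventually.of_forall fun x => ?_)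
        simp only [Complex.real_smul]
        ring
      rw [e3, sub_eq_zero]
      simpa only [mul_comm] using e
  refine Lp.ext ?_
  filter_upwards [hz, ae_restrict_mem hV.measurableSet] with x hx hxV
  exact sub_eq_zero.1 (hx hxV)

/-- The sum of the exponential weights at the two boundary spheres. -/
def layerKernel (ε τ ρ : ℝ) : ℝ := bdryKernel 1 (ε ^ 2) τ ρ + bdryKernel (-1) ((ε⁻¹) ^ 2) τ ρ

/-- `bdryFun` is the product of the distances, in |x|², to the two boundary spheres, and one of them
is at least Λ/2 with Λ = ε⁻² - ε². If the product is at most 2τ, the other is at most 4τ/Λ, so its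
exponential weight is at least e^(-4/Λ). -/
lemma one_le_layerKernel (hε : 0 < ε) (hε1 : ε < 1) {τ : ℝ} (hτ : 0 < τ) {x : E N}
    (hx : x ∈ OmegaEps N ε) (h : bdryFun ε (‖x‖ ^ 2) ≤ 2 * τ) :
    1 ≤ Real.exp (4 / ((ε⁻¹) ^ 2 - ε ^ 2)) * layerKernel ε τ (‖x‖ ^ 2) := by
  obtain ⟨h1, h2⟩ := norm_sq_bounds hε hx
  have hΛ : 0 < (ε⁻¹) ^ 2 - ε ^ 2 := sub_pos.2 (sq_lt_inv_sq hε hε1)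
  set Λ := (ε⁻¹) ^ 2 - ε ^ 2 with hΛd
  have aux : ∀ {d d' : ℝ}, 0 < d → d * d' ≤ 2 * τ → Λ / 2 ≤ d' →
      1 ≤ Real.exp (4 / Λ) * Real.exp (-d / τ) := fun {d d'} hd hdd hd' => by
    rw [← Real.exp_add]
    refine Real.one_le_exp ?_
    have : d / τ ≤ 4 / Λ := by
      rw [div_le_div_iff₀ hτ hΛ]
      nlinarith
    rw [neg_div]; linarith
  unfold layerKernel
  rw [mul_add]
  have p1 := mul_pos (Real.exp_pos (4 / Λ)) (bdryKernel_pos 1 (ε ^ 2) τ (‖x‖ ^ 2))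
  have p2 := mul_pos (Real.exp_pos (4 / Λ)) (bdryKernel_pos (-1) ((ε⁻¹) ^ 2) τ (‖x‖ ^ 2))
  rcases le_total (Λ / 2) ((ε⁻¹) ^ 2 - ‖x‖ ^ 2) with h3 | h3
  · have := aux (sub_pos.2 h1) h h3
    have e : bdryKernel 1 (ε ^ 2) τ (‖x‖ ^ 2) = Real.exp (-(‖x‖ ^ 2 - ε ^ 2) / τ) := by
      rw [bdryKernel, one_mul]
    rw [← e] at this
    linarith
  · have := aux (sub_pos.2 h2) (by rw [mul_comm]; exact h)
      (show Λ / 2 ≤ ‖x‖ ^ 2 - ε ^ 2 by linarith)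
    have e : bdryKernel (-1) ((ε⁻¹) ^ 2) τ (‖x‖ ^ 2) = Real.exp (-((ε⁻¹) ^ 2 - ‖x‖ ^ 2) / τ) := by
      rw [bdryKernel]; congr 2; ring
    rw [← e] at this
    linarith

/-- The trace estimate applied to each component of ∇u gives one power of τ, and the Hardy
inequality gives τ^p for |u|^p relative to |∇u|^p. Together these are the exponent p+1. -/
lemma exists_integral_bdryKernel_gradient_le (hp1 : 1 < p) (hp : p ≠ ⊤) (hε : 0 < ε) (hε1 : ε < 1)
    {σ r : ℝ} (hσ : σ = 1 ∨ σ = -1)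
    (hr : σ * ((ε ^ 2 + (ε⁻¹) ^ 2) / 2 - r) = ((ε⁻¹) ^ 2 - ε ^ 2) / 2)
    (h0 : ∀ x ∈ OmegaEps N ε, 0 ≤ σ * (‖x‖ ^ 2 - r)) {u : LpOn p (OmegaEps N ε)}
    {g : Fin N → LpOn p (OmegaEps N ε)} {h : Fin N → Fin N → LpOn p (OmegaEps N ε)}
    (hw : ∀ i j, HasWeakPartial j (g i) (h i j))
    (hu0 : ∀ δ : ℝ≥0∞, 0 < δ → ∃ φ : E N → ℂ, IsTest (OmegaEps N ε) φ ∧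
      eLpNorm (fun x => u x - φ x) p (volume.restrict (OmegaEps N ε)) < δ ∧
      ∀ i, eLpNorm (fun x => g i x - partialD i φ x) p (volume.restrict (OmegaEps N ε)) < δ) :
    ∃ C, 0 ≤ C ∧ ∀ τ, 0 < τ → ∫ x in OmegaEps N ε,
      ‖x‖ ^ (2 - N : ℝ) * bdryKernel σ r τ (‖x‖ ^ 2) *
        (τ ^ p.toReal * (∑ i, ‖g i x‖) ^ p.toReal + 2 * ‖u x‖ ^ p.toReal) ≤
      C * τ ^ (p.toReal + 1) := by
  have hp' := one_lt_toReal hp1 hp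
  have hgm := fun i => Lp.memLp (g i)
  have hum := Lp.memLp u
  choose C hC0 hC using fun i => exists_integral_bdryKernel_le hp1 hp hε hε1 hr h0 (hw i)
  refine ⟨(1 + 2 * (p.toReal * ε⁻¹) ^ p.toReal) * ((N : ℝ) ^ (p.toReal - 1) * ∑ i, C i),
    mul_nonneg (by positivity) (mul_nonneg (by positivity) (Finset.sum_nonneg fun i _ => hC0 i)),
    fun τ hτ => ?_⟩
  have hKc := (contDiff_bdryKernel σ r τ).continuous
  have i1 := integrable_weight_mul_sum_rpow hp1 hp hε hgm hKc
  have i2 := integrable_weight_mul_rpow hp1 hp hε hum hKc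
  have i3 := fun i => integrable_weight_mul_rpow hp1 hp hε (hgm i) hKc
  have hardy := integral_bdryKernel_le_gradient hp1 hp hε hσ r hτ hu0
  set J := ∫ x in OmegaEps N ε, ‖x‖ ^ (2 - N : ℝ) * bdryKernel σ r τ (‖x‖ ^ 2) *
        (∑ i, ‖g i x‖) ^ p.toReal with hJ
  have e1 : ∫ x in OmegaEps N ε, ‖x‖ ^ (2 - N : ℝ) * bdryKernel σ r τ (‖x‖ ^ 2) *
        (τ ^ p.toReal * (∑ i, ‖g i x‖) ^ p.toReal + 2 * ‖u x‖ ^ p.toReal) =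
      τ ^ p.toReal * J + 2 * ∫ x in OmegaEps N ε, ‖x‖ ^ (2 - N : ℝ) *
        bdryKernel σ r τ (‖x‖ ^ 2) * ‖u x‖ ^ p.toReal := by
    rw [hJ, ← integral_const_mul, ← integral_const_mul,
      ← integral_add (i1.const_mul _) (i2.const_mul _)]
    exact integral_congr_ae (Eventually.of_forall fun x => by simp only []; ring)
  have hJle : J ≤ (N : ℝ) ^ (p.toReal - 1) * ((∑ i, C i) * τ) := by
    have : J ≤ ∫ x in OmegaEps N ε, (N : ℝ) ^ (p.toReal - 1) *
        ∑ i, ‖x‖ ^ (2 - N : ℝ) * bdryKernel σ r τ (‖x‖ ^ 2) * ‖g i x‖ ^ p.toReal := by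
      refine integral_mono i1 ((integrable_finsetSum _ fun i _ => i3 i).const_mul _) fun x => ?_
      have hs := Real.rpow_sum_le_const_mul_sum_rpow Finset.univ (fun i => ‖g i x‖) hp'.le
      simp only [abs_norm, Finset.card_univ, Fintype.card_fin] at hs
      have hK0 := bdryKernel_pos σ r τ (‖x‖ ^ 2)
      simp only []
      rw [← Finset.mul_sum, mul_left_comm]
      exact mul_le_mul_of_nonneg_left hs (by positivity)
    refine this.trans ?_
    rw [integral_const_mul, integral_finsetSum _ fun i _ => i3 i, Finset.sum_mul]
    exact mul_le_mul_of_nonneg_left (Finset.sum_le_sum fun i _ => hC i τ hτ) (by positivity)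
  rw [e1, Real.rpow_add hτ, Real.rpow_one]
  rw [Real.mul_rpow (by positivity) hτ.le] at hardy
  calc _ ≤ τ ^ p.toReal * J + 2 * ((p.toReal * ε⁻¹) ^ p.toReal * τ ^ p.toReal * J) := by linarith
    _ = (τ ^ p.toReal * (1 + 2 * (p.toReal * ε⁻¹) ^ p.toReal)) * J := by ring
    _ ≤ (τ ^ p.toReal * (1 + 2 * (p.toReal * ε⁻¹) ^ p.toReal)) *
        ((N : ℝ) ^ (p.toReal - 1) * ((∑ i, C i) * τ)) := by gcongr
    _ = _ := by ring

/-- Both boundary spheres are treated, with σ = 1 for the inner and σ = -1 for the outer one. The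
weight |x|^(2-N) is removed because its inverse is bounded on the annulus. -/
lemma exists_integral_layerKernel_le (hp1 : 1 < p) (hp : p ≠ ⊤) (hε : 0 < ε) (hε1 : ε < 1)
    {u : LpOn p (OmegaEps N ε)}
    {g : Fin N → LpOn p (OmegaEps N ε)} {h : Fin N → Fin N → LpOn p (OmegaEps N ε)}
    (hw : ∀ i j, HasWeakPartial j (g i) (h i j))
    (hu0 : ∀ δ : ℝ≥0∞, 0 < δ → ∃ φ : E N → ℂ, IsTest (OmegaEps N ε) φ ∧
      eLpNorm (fun x => u x - φ x) p (volume.restrict (OmegaEps N ε)) < δ ∧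
      ∀ i, eLpNorm (fun x => g i x - partialD i φ x) p (volume.restrict (OmegaEps N ε)) < δ) :
    ∃ C, 0 ≤ C ∧ ∀ τ, 0 < τ →
      Integrable (fun x => layerKernel ε τ (‖x‖ ^ 2) *
        (τ ^ p.toReal * (∑ i, ‖g i x‖) ^ p.toReal + 2 * ‖u x‖ ^ p.toReal))
        (volume.restrict (OmegaEps N ε)) ∧
      ∫ x in OmegaEps N ε, layerKernel ε τ (‖x‖ ^ 2) *
        (τ ^ p.toReal * (∑ i, ‖g i x‖) ^ p.toReal + 2 * ‖u x‖ ^ p.toReal) ≤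
      C * τ ^ (p.toReal + 1) := by
  have hp' := one_lt_toReal hp1 hp
  obtain ⟨C₁, hC₁0, hC₁⟩ := exists_integral_bdryKernel_gradient_le (σ := 1) (r := ε ^ 2) hp1 hp hε
    hε1 (Or.inl rfl) (by ring) (fun x hx => by linarith [(norm_sq_bounds hε hx).1]) hw hu0
  obtain ⟨C₂, hC₂0, hC₂⟩ := exists_integral_bdryKernel_gradient_le (σ := -1) (r := (ε⁻¹) ^ 2) hp1 hp
    hε hε1 (Or.inr rfl) (by ring) (fun x hx => by linarith [(norm_sq_bounds hε hx).2]) hw hu0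
  obtain ⟨M, hM0, hM⟩ := exists_abs_le_OmegaEps (N := N) hε (k := fun x => ‖x‖ ^ ((N : ℝ) - 2))
    (continuousOn_norm_rpow _ fun x hx => hx)
  refine ⟨M * (C₁ + C₂), by positivity, fun τ hτ => ?_⟩
  have hgm := fun i => Lp.memLp (g i)
  have hum := Lp.memLp u
  have hK₁ := (contDiff_bdryKernel 1 (ε ^ 2) τ).continuous
  have hK₂ := (contDiff_bdryKernel (-1) ((ε⁻¹) ^ 2) τ).continuous
  have hi : ∀ {k : ℝ → ℝ}, Continuous k → Integrable (fun x => ‖x‖ ^ (2 - N : ℝ) * k (‖x‖ ^ 2) *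
      (τ ^ p.toReal * (∑ i, ‖g i x‖) ^ p.toReal + 2 * ‖u x‖ ^ p.toReal))
      (volume.restrict (OmegaEps N ε)) := fun {k} hk => by
    refine (((integrable_weight_mul_sum_rpow hp1 hp hε hgm hk).const_mul (τ ^ p.toReal)).add
      ((integrable_weight_mul_rpow hp1 hp hε hum hk).const_mul 2)).congr
      (Eventually.of_forall fun x => ?_)
    simp only [Pi.add_apply]
    ring
  set T : E N → ℝ := fun x => τ ^ p.toReal * (∑ i, ‖g i x‖) ^ p.toReal + 2 * ‖u x‖ ^ p.toReal
    with hT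
  have hT0 : ∀ x, 0 ≤ T x := fun x => by positivity
  have hL : Continuous (layerKernel ε τ) := hK₁.add hK₂
  have hL0 : ∀ ρ, 0 ≤ layerKernel ε τ ρ := fun ρ =>
    (add_pos (bdryKernel_pos _ _ _ _) (bdryKernel_pos _ _ _ _)).le
  have hpt : ∀ x ∈ OmegaEps N ε, layerKernel ε τ (‖x‖ ^ 2) * T x ≤
      M * (‖x‖ ^ (2 - N : ℝ) * layerKernel ε τ (‖x‖ ^ 2) * T x) := fun x hx => by
    have hx0 : 0 < ‖x‖ := norm_pos_iff.2 hx.1.1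
    have h1 : 1 ≤ M * ‖x‖ ^ (2 - N : ℝ) := by
      have : ‖x‖ ^ ((N : ℝ) - 2) * ‖x‖ ^ (2 - N : ℝ) = 1 := by
        rw [← Real.rpow_add hx0]; simp
      rw [← this]
      exact mul_le_mul_of_nonneg_right ((le_abs_self _).trans (hM x hx)) (by positivity)
    calc _ = 1 * (layerKernel ε τ (‖x‖ ^ 2) * T x) := (one_mul _).symm
      _ ≤ (M * ‖x‖ ^ (2 - N : ℝ)) * (layerKernel ε τ (‖x‖ ^ 2) * T x) :=
          mul_le_mul_of_nonneg_right h1 (mul_nonneg (hL0 _) (hT0 x))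
      _ = _ := by ring
  have hTm : AEStronglyMeasurable T (volume.restrict (OmegaEps N ε)) :=
    ((((Finset.aestronglyMeasurable_fun_sum _ fun i _ => (hgm i).1.norm).aemeasurable.pow_const
      p.toReal).const_mul (τ ^ p.toReal)).add
      ((hum.1.norm.aemeasurable.pow_const p.toReal).const_mul 2)).aestronglyMeasurable
  have hintg : Integrable (fun x => layerKernel ε τ (‖x‖ ^ 2) * T x)
      (volume.restrict (OmegaEps N ε)) := by
    refine ((hi hL).const_mul M).mono'
      ((hL.comp (continuous_norm.pow 2)).aestronglyMeasurable.mul hTm) ?_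
    filter_upwards [ae_restrict_mem measurableSet_OmegaEps] with x hx
    rw [Real.norm_of_nonneg (mul_nonneg (hL0 _) (hT0 x))]
    exact hpt x hx
  refine ⟨hintg, ?_⟩
  calc ∫ x in OmegaEps N ε, layerKernel ε τ (‖x‖ ^ 2) * T x
      ≤ ∫ x in OmegaEps N ε, M * (‖x‖ ^ (2 - N : ℝ) * layerKernel ε τ (‖x‖ ^ 2) * T x) :=
        setIntegral_mono_on hintg ((hi hL).const_mul M) measurableSet_OmegaEps hpt
    _ = M * ((∫ x in OmegaEps N ε, ‖x‖ ^ (2 - N : ℝ) * bdryKernel 1 (ε ^ 2) τ (‖x‖ ^ 2) * T x) +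
        ∫ x in OmegaEps N ε, ‖x‖ ^ (2 - N : ℝ) * bdryKernel (-1) ((ε⁻¹) ^ 2) τ (‖x‖ ^ 2) * T x) := by
        rw [integral_const_mul, ← integral_add (hi hK₁) (hi hK₂)]
        congr 1
        refine integral_congr_ae (Eventually.of_forall fun x => ?_)
        simp only [layerKernel]
        ring
    _ ≤ M * (C₁ * τ ^ (p.toReal + 1) + C₂ * τ ^ (p.toReal + 1)) :=
        mul_le_mul_of_nonneg_left (add_le_add (hC₁ τ hτ) (hC₂ τ hτ)) hM0
    _ = _ := by ring

end AnnulusOperator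

/-! ### Removing the cutoff for the operator on the annulus -/

section AnnulusSector

variable {N : ℕ} {p : ℝ≥0∞} {ε : ℝ}

lemma opLWeak_mul (α b c : ℝ) (η : E N → ℂ) (H G : Fin N → E N → ℂ) (U : E N → ℂ) (x : E N) :
    opLWeak α b c (fun i y => η y * H i y) (fun i y => η y * G i y) (fun y => η y * U y) x =
      η x * opLWeak α b c H G U x := by
  simp only [opLWeak, mul_add, mul_sub, Finset.mul_sum]
  congr 1
  · congr 1 <;> exact Finset.sum_congr rfl fun i _ => by ring
  · ring

/-- The commutator of `L` with a cutoff is controlled by the boundary layer kernel. -/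
lemma exists_norm_commutator_le (hp1 : 1 < p) (hp : p ≠ ⊤) (hε : 0 < ε) (hε1 : ε < 1)
    (α b c : ℝ) : ∃ D, 0 ≤ D ∧ ∀ τ : ℝ, 0 < τ → τ ≤ 1 → ∀ η : E N → ℂ,
      η = (fun y => (annCutoff N ε τ y : ℂ)) → ∀ (h g : Fin N → E N → ℂ) (u : E N → ℂ),
      ∀ x ∈ OmegaEps N ε,
      ‖opLWeak α b c
          (fun i x => (η x * h i x + partialD i η x * g i x) +
            (partialD i η x * g i x + partialD i (partialD i η) x * u x))
          (fun i x => η x * g i x + partialD i η x * u x) (fun x => η x * u x) x -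
        η x * opLWeak α b c h g u x‖ * ‖u x‖ ^ (p.toReal - 1) ≤
      D * (τ ^ 2)⁻¹ * (layerKernel ε τ (‖x‖ ^ 2) *
        (τ ^ p.toReal * (∑ i, ‖g i x‖) ^ p.toReal + 2 * ‖u x‖ ^ p.toReal)) := by
  have hp' := one_lt_toReal hp1 hp
  obtain ⟨C, hC0, hC⟩ := exists_partialD_annCutoff_le N hε
  obtain ⟨M, hM0, hM⟩ := exists_weight_bound (N := N) α b c
    (isCompact_logAnnulus (Real.log ε) (Real.log ε⁻¹)) fun x hx => hx.1.1
  set B := Real.exp (4 / ((ε⁻¹) ^ 2 - ε ^ 2)) with hB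
  have hB0 : 0 < B := Real.exp_pos _
  refine ⟨M * (2 * C * (N + 1)) * B, by positivity, fun τ hτ hτ1 η hη h g u x hx => ?_⟩
  have hMx := hM x (OmegaEps_subset_logAnnulus hε hx)
  set L := layerKernel ε τ (‖x‖ ^ 2) with hL
  have hL0 : 0 < L := add_pos (bdryKernel_pos _ _ _ _) (bdryKernel_pos _ _ _ _)
  have hd : ∀ i, ‖partialD i η x‖ ≤ C / τ * (B * L) ∧
      ‖partialD i (partialD i η) x‖ ≤ C / τ ^ 2 * (B * L) := fun i => by
    obtain ⟨h1, h2, h3⟩ := hC τ hτ hτ1 x hx i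
    rw [← hη] at h1 h2 h3
    rcases lt_or_ge (2 * τ) (bdryFun ε (‖x‖ ^ 2)) with h4 | h4
    · rw [(h3 h4).1, (h3 h4).2, norm_zero]
      constructor <;> positivity
    · have h5 := one_le_layerKernel hε hε1 hτ hx h4
      exact ⟨h1.trans (le_mul_of_one_le_right (by positivity) h5),
        h2.trans (le_mul_of_one_le_right (by positivity) h5)⟩
  set κ := B * L with hκ
  have hκ0 : 0 < κ := by positivity
  set Γ := ∑ i, ‖g i x‖ with hΓ
  have hΓ0 : 0 ≤ Γ := Finset.sum_nonneg fun i _ => norm_nonneg _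
  rw [← opLWeak_mul]
  have s1 := norm_opLWeak_sub_le hMx.1 hMx.2.1 hMx.2.2
    (fun i x => (η x * h i x + partialD i η x * g i x) +
      (partialD i η x * g i x + partialD i (partialD i η) x * u x))
    (fun i x => η x * g i x + partialD i η x * u x) (fun i y => η y * h i y)
    (fun i y => η y * g i y) (fun x => η x * u x) (fun x => η x * u x)
  have s2 : ∀ i, ‖(η x * h i x + partialD i η x * g i x) +
      (partialD i η x * g i x + partialD i (partialD i η) x * u x) - η x * h i x‖ ≤
      2 * (C / τ * κ) * ‖g i x‖ + C / τ ^ 2 * κ * ‖u x‖ := fun i => by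
    have e : (η x * h i x + partialD i η x * g i x) +
      (partialD i η x * g i x + partialD i (partialD i η) x * u x) - η x * h i x =
      2 * partialD i η x * g i x + partialD i (partialD i η) x * u x := by ring
    rw [e]
    refine (norm_add_le _ _).trans ?_
    rw [norm_mul, norm_mul, norm_mul, Complex.norm_ofNat]
    have := (hd i).1
    have := (hd i).2
    gcongr
  have s3 : ∀ i, ‖η x * g i x + partialD i η x * u x - η x * g i x‖ ≤ C / τ * κ * ‖u x‖ :=
    fun i => by
      rw [add_sub_cancel_left, norm_mul]
      exact mul_le_mul_of_nonneg_right (hd i).1 (norm_nonneg _)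
  have s4 : ∑ i, (2 * (C / τ * κ) * ‖g i x‖ + C / τ ^ 2 * κ * ‖u x‖) +
      ∑ i : Fin N, C / τ * κ * ‖u x‖ ≤ 2 * C * (N + 1) * κ * (τ ^ 2)⁻¹ * (τ * Γ + ‖u x‖) := by
    rw [Finset.sum_add_distrib, ← Finset.mul_sum, Finset.sum_const, Finset.sum_const,
      Finset.card_univ, Fintype.card_fin, nsmul_eq_mul, nsmul_eq_mul]
    have e1 : C / τ = C * (τ ^ 2)⁻¹ * τ := by field_simp
    have e2 : C / τ ^ 2 = C * (τ ^ 2)⁻¹ := by rw [div_eq_mul_inv]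
    rw [e1, e2, ← hΓ]
    have hn : (0 : ℝ) ≤ N := by positivity
    have q0 : 0 ≤ C * (τ ^ 2)⁻¹ * κ := by positivity
    have q1 : 0 ≤ N * (C * (τ ^ 2)⁻¹ * κ) * (τ * Γ) := by positivity
    have q2 : 0 ≤ C * (τ ^ 2)⁻¹ * κ * ‖u x‖ := by positivity
    have q3 : N * (C * (τ ^ 2)⁻¹ * κ * ‖u x‖) * τ ≤ N * (C * (τ ^ 2)⁻¹ * κ * ‖u x‖) * 1 := by
      gcongr
    linarith
  have s5 : ‖opLWeak α b c
          (fun i x => (η x * h i x + partialD i η x * g i x) +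
            (partialD i η x * g i x + partialD i (partialD i η) x * u x))
          (fun i x => η x * g i x + partialD i η x * u x) (fun x => η x * u x) x -
        opLWeak α b c (fun i y => η y * h i y) (fun i y => η y * g i y) (fun y => η y * u y) x‖ ≤
      M * (2 * C * (N + 1) * κ * (τ ^ 2)⁻¹ * (τ * Γ + ‖u x‖)) := by
    refine s1.trans (mul_le_mul_of_nonneg_left ?_ hM0)
    rw [sub_self, norm_zero, add_zero]
    exact (add_le_add (Finset.sum_le_sum fun i _ => s2 i)
      (Finset.sum_le_sum fun i _ => s3 i)).trans s4
  -- Young's inequality is applied to τΓ rather than Γ, so that the gradient carries the factor τ^p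
  -- that matches the Hardy scaling of u.
  have s6 : (τ * Γ + ‖u x‖) * ‖u x‖ ^ (p.toReal - 1) ≤
      τ ^ p.toReal * Γ ^ p.toReal + 2 * ‖u x‖ ^ p.toReal := by
    have y1 := mul_rpow_le hp' (norm_nonneg (u x)) (b := τ * Γ) (by positivity)
    have y2 : ‖u x‖ ^ (p.toReal - 1) * ‖u x‖ = ‖u x‖ ^ p.toReal := by
      rw [← Real.rpow_add_one' (norm_nonneg _) (by linarith)]
      congr 1; ring
    rw [Real.mul_rpow hτ.le hΓ0] at y1
    linarith
  calc _ ≤ M * (2 * C * (N + 1) * κ * (τ ^ 2)⁻¹ * (τ * Γ + ‖u x‖)) * ‖u x‖ ^ (p.toReal - 1) :=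
        mul_le_mul_of_nonneg_right s5 (by positivity)
    _ = (M * (2 * C * (N + 1)) * κ * (τ ^ 2)⁻¹) * ((τ * Γ + ‖u x‖) * ‖u x‖ ^ (p.toReal - 1)) := by
        ring
    _ ≤ (M * (2 * C * (N + 1)) * κ * (τ ^ 2)⁻¹) *
        (τ ^ p.toReal * Γ ^ p.toReal + 2 * ‖u x‖ ^ p.toReal) := by gcongr
    _ = _ := by rw [hκ]; ring

lemma tendsto_annCutoff {x : E N} (hε : 0 < ε) (hx : x ∈ OmegaEps N ε) :
    Tendsto (fun n : ℕ => annCutoff N ε (1 / ((n : ℝ) + 1)) x) atTop (𝓝 1) := by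
  refine tendsto_const_nhds.congr' ?_
  have hD := bdryFun_pos hε hx
  filter_upwards [(tendsto_natCast_atTop_atTop (R := ℝ)).eventually_ge_atTop
    (2 / bdryFun ε (‖x‖ ^ 2))] with n hn
  rw [annCutoff_eq hx.1, cutProfile_of_two_le]
  rw [div_div_eq_mul_div, div_one]
  rw [div_le_iff₀ hD] at hn
  nlinarith

/-- The functions η_τ u satisfy the sector condition with the same l. Their pairing equals ∫ η w
times the dual function of ηu, which tends to the pairing of u and w, plus a commutator integral
that tends to zero. -/
lemma neg_dualPairing_Leps_mem_sector [Fact (1 ≤ p)] (hp1 : 1 < p) (hp : p ≠ ⊤)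
    {α b c l s : ℝ} (hs : s * p.toReal = N - 2 + α) (hf : 0 ≤ quadF N b c s) (hl : 0 ≤ l)
    (hl1 : |p.toReal - 2| + |2 - N + 2 * s - c| / 2 ≤ l * min 1 (p.toReal - 1))
    (hl2 : |2 - N + 2 * s - c| / 2 ≤ l * quadF N b c s) (hε : 0 < ε) (hε1 : ε < 1)
    {u w : LpOn p (OmegaEps N ε)} (huw : (u, w) ∈ Leps N p α b c ε) :
    -dualPairing u w ∈ sector l := by
  have hp' := one_lt_toReal hp1 hp
  have hfin := isFiniteMeasure_OmegaEps (N := N) hε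
  have hVm : MeasurableSet (OmegaEps N ε) := measurableSet_OmegaEps
  obtain ⟨g, h, ⟨hug, hgh⟩, ⟨g', hg', happ⟩, hw⟩ := huw
  dsimp only at hug hg' happ hw
  obtain rfl : g' = g := funext fun i => (hg' i).unique (isOpen_OmegaEps N ε) hp1 (hug i)
  obtain ⟨C, hC0, hC⟩ := exists_integral_layerKernel_le hp1 hp hε hε1 hgh happ
  obtain ⟨D, hD0, hD⟩ := exists_norm_commutator_le (N := N) hp1 hp hε hε1 α b c
  set τ : ℕ → ℝ := fun n => 1 / ((n : ℝ) + 1) with hτd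
  have hτ : ∀ n, 0 < τ n := fun n => by positivity
  have hτ1 : ∀ n, τ n ≤ 1 := fun n => by
    rw [hτd]
    simp only []
    rw [div_le_one (by positivity)]
    have : (0 : ℝ) ≤ n := by positivity
    linarith
  set η : ℕ → E N → ℂ := fun n y => (annCutoff N ε (τ n) y : ℂ) with hηd
  have hη : ∀ n, IsTest (OmegaEps N ε) (η n) := fun n => isTest_annCutoff hε hε1 (hτ n)
  have hη1 : ∀ n x, ‖η n x‖ ≤ 1 := fun n x => by
    rw [hηd, Complex.norm_real, Real.norm_of_nonneg (annCutoff_nonneg _ _)]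
    exact annCutoff_le_one _ _
  set U : ℕ → E N → ℂ := fun n x => η n x * u x with hU
  set G : ℕ → Fin N → E N → ℂ := fun n i x => η n x * g' i x + partialD i (η n) x * u x with hG
  set H : ℕ → Fin N → E N → ℂ := fun n i x => (η n x * h i i x + partialD i (η n) x * g' i x) +
    (partialD i (η n) x * g' i x + partialD i (partialD i (η n)) x * u x) with hH
  have mU : ∀ n, MemLp (U n) p volume := fun n => (hη n).memLp_mul_Lp hVm u
  have mD : ∀ n i, MemLp (fun x => partialD i (η n) x * u x) p volume := fun n i =>
    ((hη n).partialD i).memLp_mul_Lp hVm u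
  have mg : ∀ n i, MemLp (fun x => η n x * g' i x) p volume := fun n i =>
    (hη n).memLp_mul_Lp hVm (g' i)
  have mG : ∀ n i, MemLp (G n i) p volume := fun n i => (mg n i).add (mD n i)
  have m1 : ∀ n i, MemLp (fun x => η n x * h i i x + partialD i (η n) x * g' i x) p volume :=
    fun n i => ((hη n).memLp_mul_Lp hVm (h i i)).add (((hη n).partialD i).memLp_mul_Lp hVm (g' i))
  have m2 : ∀ n i, MemLp (fun x => partialD i (η n) x * g' i x +
      partialD i (partialD i (η n)) x * u x) p volume := fun n i =>
    (((hη n).partialD i).memLp_mul_Lp hVm (g' i)).add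
      ((((hη n).partialD i).partialD i).memLp_mul_Lp hVm u)
  have mH : ∀ n i, MemLp (H n i) p volume := fun n i => (m1 n i).add (m2 n i)
  have hsec : ∀ n, -∫ x, opLWeak α b c (H n) (G n) (U n) x * dualFun p.toReal (U n x) ∈ sector l :=
    fun n => by
      have z0 : ∀ x ∉ tsupport (η n), η n x = 0 := fun x hx => image_eq_zero_of_notMem_tsupport hx
      have z1 : ∀ i, ∀ x ∉ tsupport (η n), partialD i (η n) x = 0 := fun i x hx =>
        image_eq_zero_of_notMem_tsupport fun h => hx (tsupport_partialD_subset i _ h)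
      have z2 : ∀ i, ∀ x ∉ tsupport (η n), partialD i (partialD i (η n)) x = 0 := fun i x hx =>
        image_eq_zero_of_notMem_tsupport fun h =>
          hx (tsupport_partialD_subset i _ (tsupport_partialD_subset i _ h))
      refine neg_integral_opLWeak_mem_sector hp1 hp hs hf hl hl1 hl2 (hη n).2.1
        ((hη n).2.2.trans OmegaEps_subset_Omega) (mU n) (mG n) (mH n)
        (fun x hx => by simp [hU, z0 x hx]) (fun i x hx => by simp [hG, z0 x hx, z1 i x hx])
        (fun i x hx => by simp [hH, z0 x hx, z1 i x hx, z2 i x hx])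
        (fun i => (hug i).cutoff hp1 (hη n)) fun i => ?_
      exact ((hgh i i).cutoff hp1 (hη n)).add ((hug i).cutoff hp1 ((hη n).partialD i))
        ((mg n i).locallyIntegrable hp1.le) ((mD n i).locallyIntegrable hp1.le)
        ((m1 n i).locallyIntegrable hp1.le) ((m2 n i).locallyIntegrable hp1.le)
  set A : ℕ → E N → ℂ := fun n x => η n x * w x * dualFun p.toReal (U n x) with hA
  set R : ℕ → E N → ℂ := fun n x => (opLWeak α b c (H n) (G n) (U n) x -
    η n x * opLWeak α b c (fun i => ⇑(h i i)) (fun i => ⇑(g' i)) u x) * dualFun p.toReal (U n x)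
    with hR
  have hdm : ∀ n, AEStronglyMeasurable (fun x => dualFun p.toReal (U n x))
      (volume.restrict (OmegaEps N ε)) := fun n =>
    ((measurable_dualFun _).comp_aemeasurable (mU n).1.restrict.aemeasurable).aestronglyMeasurable
  have hdb : ∀ n x, ‖dualFun p.toReal (U n x)‖ ≤ ‖u x‖ ^ (p.toReal - 1) := fun n x => by
    rw [norm_dualFun hp']
    refine Real.rpow_le_rpow (norm_nonneg _) ?_ (by linarith)
    rw [hU, norm_mul]
    exact mul_le_of_le_one_left (norm_nonneg _) (hη1 n x)
  have hum := Lp.memLp u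
  have hwm := Lp.memLp w
  have hwu := integrable_mul_dualFun hp1 hp hum hwm
  have hAb : ∀ n x, ‖A n x‖ ≤ ‖w x * dualFun p.toReal (u x)‖ := fun n x => by
    rw [hA, norm_mul, norm_mul, norm_mul, norm_dualFun hp' (u x), mul_assoc]
    exact (mul_le_of_le_one_left (by positivity) (hη1 n x)).trans
      (mul_le_mul_of_nonneg_left (hdb n x) (norm_nonneg _))
  have hAm : ∀ n, AEStronglyMeasurable (A n) (volume.restrict (OmegaEps N ε)) := fun n =>
    ((hη n).1.continuous.aestronglyMeasurable.mul hwm.1).mul (hdm n)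
  have hAi : ∀ n, Integrable (A n) (volume.restrict (OmegaEps N ε)) := fun n =>
    hwu.norm.mono' (hAm n) (Eventually.of_forall (hAb n))
  have hRb : ∀ n, ∀ x ∈ OmegaEps N ε, ‖R n x‖ ≤ D * (τ n ^ 2)⁻¹ * (layerKernel ε (τ n) (‖x‖ ^ 2) *
        (τ n ^ p.toReal * (∑ i, ‖g' i x‖) ^ p.toReal + 2 * ‖u x‖ ^ p.toReal)) := fun n x hx => by
    refine le_trans ?_ (hD (τ n) (hτ n) (hτ1 n) (η n) rfl (fun i => ⇑(h i i)) (fun i => ⇑(g' i)) u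
      x hx)
    rw [hR, norm_mul]
    exact mul_le_mul_of_nonneg_left (hdb n x) (norm_nonneg _)
  have hRb' : ∀ n, ∀ᵐ x ∂(volume.restrict (OmegaEps N ε)), ‖R n x‖ ≤
      D * (τ n ^ 2)⁻¹ * (layerKernel ε (τ n) (‖x‖ ^ 2) *
        (τ n ^ p.toReal * (∑ i, ‖g' i x‖) ^ p.toReal + 2 * ‖u x‖ ^ p.toReal)) := fun n => by
    filter_upwards [ae_restrict_mem hVm] with x hx using hRb n x hx
  have hRi : ∀ n, Integrable (R n) (volume.restrict (OmegaEps N ε)) := fun n => by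
    refine ((hC (τ n) (hτ n)).1.const_mul (D * (τ n ^ 2)⁻¹)).mono' ?_ (hRb' n)
    refine AEStronglyMeasurable.mul (AEStronglyMeasurable.sub ?_ (AEStronglyMeasurable.mul
      (hη n).1.continuous.aestronglyMeasurable ?_)) (hdm n)
    · exact aestronglyMeasurable_opLWeak α b c (fun i => (mH n i).1.restrict)
        (fun i => (mG n i).1.restrict) (mU n).1.restrict
    · exact aestronglyMeasurable_opLWeak α b c (fun i => (Lp.memLp (h i i)).1)
        (fun i => (Lp.memLp (g' i)).1) hum.1
  -- The factor τ^(-2) of the commutator against τ^(p+1) for the layer integral leaves τ^(p-1),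
  -- which tends to zero exactly because p > 1.
  have hRle : ∀ n, ‖∫ x in OmegaEps N ε, R n x‖ ≤ D * C * τ n ^ (p.toReal - 1) := fun n => by
    refine (norm_integral_le_of_norm_le ((hC (τ n) (hτ n)).1.const_mul _) (hRb' n)).trans ?_
    rw [integral_const_mul]
    refine (mul_le_mul_of_nonneg_left (hC (τ n) (hτ n)).2
      (mul_nonneg hD0 (by have := hτ n; positivity))).trans (le_of_eq ?_)
    rw [show p.toReal + 1 = (p.toReal - 1) + (2 : ℕ) by push_cast; ring,
      Real.rpow_add_natCast (hτ n).ne']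
    have := (hτ n).ne'
    field_simp
  have hsplit : ∀ n, ∫ x, opLWeak α b c (H n) (G n) (U n) x * dualFun p.toReal (U n x) =
      (∫ x in OmegaEps N ε, A n x) + ∫ x in OmegaEps N ε, R n x := fun n => by
    rw [← integral_add (hAi n) (hRi n), ← setIntegral_eq_integral_of_forall_compl_eq_zero
      (s := OmegaEps N ε) (f := fun x => opLWeak α b c (H n) (G n) (U n) x *
        dualFun p.toReal (U n x)) fun x hx => by
        have : U n x = 0 := by simp [hU, (hη n).eq_zero hx]
        rw [this]; simp [dualFun]]
    refine integral_congr_ae ?_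
    filter_upwards [hw] with x hx
    have hx' : w x = opLWeak α b c (fun i => ⇑(h i i)) (fun i => ⇑(g' i)) u x := hx
    simp only [hA, hR]
    rw [hx']
    ring
  have tA : Tendsto (fun n => ∫ x in OmegaEps N ε, A n x) atTop (𝓝 (dualPairing u w)) := by
    refine tendsto_integral_of_dominated_convergence _ hAm hwu.norm
      (fun n => Eventually.of_forall (hAb n)) ?_
    filter_upwards [ae_restrict_mem hVm] with x hx
    have t1 : Tendsto (fun n => annCutoff N ε (τ n) x) atTop (𝓝 1) := tendsto_annCutoff hε hx
    have t2 : Tendsto (fun n => η n x * w x) atTop (𝓝 (w x)) := by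
      have := ((Complex.continuous_ofReal.tendsto 1).comp t1).mul_const (w x)
      rwa [Complex.ofReal_one, one_mul] at this
    have t3 : Tendsto (fun n => dualFun p.toReal (U n x)) atTop (𝓝 (dualFun p.toReal (u x))) := by
      have e : ∀ n, dualFun p.toReal (U n x) =
          ((annCutoff N ε (τ n) x ^ (p.toReal - 1) : ℝ) : ℂ) * dualFun p.toReal (u x) := fun n =>
        dualFun_real_smul hp' (annCutoff_nonneg _ _) _
      simp_rw [e]
      have t4 : Tendsto (fun n => annCutoff N ε (τ n) x ^ (p.toReal - 1)) atTop (𝓝 1) := by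
        have := t1.rpow_const (p := p.toReal - 1) (Or.inl one_ne_zero)
        rwa [Real.one_rpow] at this
      have := ((Complex.continuous_ofReal.tendsto 1).comp t4).mul_const (dualFun p.toReal (u x))
      rwa [Complex.ofReal_one, one_mul] at this
    exact t2.mul t3
  have tR : Tendsto (fun n => ∫ x in OmegaEps N ε, R n x) atTop (𝓝 0) := by
    refine squeeze_zero_norm hRle ?_
    have t1 : Tendsto τ atTop (𝓝 0) := tendsto_one_div_add_atTop_nhds_zero_nat
    have t2 := t1.rpow_const (p := p.toReal - 1) (Or.inr (by linarith))
    rw [Real.zero_rpow (by linarith)] at t2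
    simpa using t2.const_mul (D * C)
  have tT := (tA.add tR).neg
  simp_rw [← hsplit, add_zero] at tT
  exact (isClosed_sector l).mem_of_tendsto tT (Eventually.of_forall hsec)

end AnnulusSector

/-! ### The quadratic function -/

lemma quadF_eq_sectQuantity (N : ℕ) {p : ℝ} (hp : p ≠ 0) (α b c : ℝ) :
    quadF N b c (((N : ℝ) - 2 + α) / p) = sectQuantity N p α b c := by
  rw [quadF, sectQuantity, Real.conjExponent]
  field_simp
  ring

/-- Completing the square. For a negative radicand the convention √ = 0 makes the two roots
coincide, so the interval is empty, and f is then negative everywhere. -/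
lemma quadF_pos_iff (N : ℕ) (b c s : ℝ) :
    0 < quadF N b c s ↔ rootOne N b c < s ∧ s < rootTwo N b c := by
  have e : quadF N b c s = b + (((N : ℝ) - 2 + c) / 2) ^ 2 - (s - ((N : ℝ) - 2 + c) / 2) ^ 2 := by
    rw [quadF]; ring
  rw [e, sub_pos, ← sq_abs (s - _), ← Real.lt_sqrt (abs_nonneg _), abs_lt, rootOne, rootTwo]
  constructor <;> rintro ⟨h1, h2⟩ <;> constructor <;> linarith

lemma exists_sector_constant {p : ℝ} (hp : 1 < p) (k : ℝ) {f : ℝ} (hf : 0 < f) :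
    ∃ l, 0 ≤ l ∧ |p - 2| + |k| / 2 ≤ l * min 1 (p - 1) ∧ |k| / 2 ≤ l * f := by
  have hm : 0 < min 1 (p - 1) := lt_min one_pos (by linarith)
  refine ⟨(|p - 2| + |k| / 2) / min 1 (p - 1) + |k| / 2 / f, by positivity, ?_, ?_⟩
  · rw [add_mul, div_mul_cancel₀ _ hm.ne']
    exact le_add_of_nonneg_right (by positivity)
  · rw [add_mul, div_mul_cancel₀ _ hf.ne']
    exact le_add_of_nonneg_left (by positivity)

end ScaleInvariant

end

/-! ### Assembly of the five statements -/

theorem mainTheorem6 (N : ℕ) (hN : 1 ≤ N) (p : ℝ≥0∞) [Fact (1 ≤ p)] (hp1 : 1 < p) (hp : p ≠ ⊤)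
    (α b c : ℝ) :
    quadF N b c (((N : ℝ) - 2 + α) / p.toReal) = sectQuantity N p.toReal α b c ∧
    (0 < quadF N b c (((N : ℝ) - 2 + α) / p.toReal) ↔
      rootOne N b c + (2 - α) / p.toReal < (N : ℝ) / p.toReal ∧
        (N : ℝ) / p.toReal < rootTwo N b c + (2 - α) / p.toReal) ∧
    (0 < quadF N b c (((N : ℝ) - 2 + α) / p.toReal) →
      ∃ l : ℝ, IsSectorialWith (Lmin N p α b c) l ∧
        ∀ ε : ℝ, 0 < ε → ε < 1 → IsSectorialWith (Leps N p α b c ε) l) ∧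
    (IsDissipative (Lmin N p α b c) ↔ 0 ≤ sectQuantity N p.toReal α b c) ∧
    (quadF N b c (((N : ℝ) - 2 + α) / p.toReal) = 0 →
      ((N : ℝ) - 2 + α) / p.toReal = ((N : ℝ) - 2 + c) / 2 →
      ∃ l : ℝ, IsSectorialWith (Lmin N p α b c) l ∧
        ∀ ε : ℝ, 0 < ε → ε < 1 → IsSectorialWith (Leps N p α b c ε) l) := by
  have hp' := one_lt_toReal hp1 hp
  have hs : ((N : ℝ) - 2 + α) / p.toReal * p.toReal = N - 2 + α :=
    div_mul_cancel₀ _ (by linarith)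
  have hq := quadF_eq_sectQuantity N (by linarith : p.toReal ≠ 0) α b c
  refine ⟨hq, ?_, fun hf => ?_, ⟨fun h => ?_, fun h => ?_⟩, fun hf hk => ?_⟩
  · rw [quadF_pos_iff, sub_add_eq_add_sub, sub_div, sub_div, add_div]
    constructor <;> rintro ⟨h1, h2⟩ <;> constructor <;> linarith
  · obtain ⟨l, hl, hl1, hl2⟩ := exists_sector_constant hp' (2 - N + 2 *
      (((N : ℝ) - 2 + α) / p.toReal) - c) hf
    exact ⟨l, isSectorialWith_of_dualPairing hp1 hp hl fun u w h =>
      neg_dualPairing_Lmin_mem_sector hp1 hp hs hf.le hl hl1 hl2 h, fun ε hε hε1 =>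
      isSectorialWith_of_dualPairing hp1 hp hl fun u w h =>
        neg_dualPairing_Leps_mem_sector hp1 hp hs hf.le hl hl1 hl2 hε hε1 h⟩
  · rw [← hq]
    exact quadF_nonneg_of_isDissipative hN hp1 hp hs h
  · rw [← hq] at h
    exact isDissipative_Lmin hp1 hp hs h
  -- The condition on s is exactly k = 0: the imaginary first order term disappears, and the
  -- vanishing of f no longer obstructs the sector estimate.
  · have hk0 : 2 - (N : ℝ) + 2 * (((N : ℝ) - 2 + α) / p.toReal) - c = 0 := by rw [hk]; ring
    obtain ⟨l, hl, hl1, -⟩ := exists_sector_constant hp' 0 one_pos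
    rw [← hk0] at hl1
    have hl2 : |2 - (N : ℝ) + 2 * (((N : ℝ) - 2 + α) / p.toReal) - c| / 2 ≤
        l * quadF N b c (((N : ℝ) - 2 + α) / p.toReal) := by rw [hk0, hf]; simp
    exact ⟨l, isSectorialWith_of_dualPairing hp1 hp hl fun u w h =>
      neg_dualPairing_Lmin_mem_sector hp1 hp hs hf.ge hl hl1 hl2 h, fun ε hε hε1 =>
      isSectorialWith_of_dualPairing hp1 hp hl fun u w h =>
        neg_dualPairing_Leps_mem_sector hp1 hp hs hf.ge hl hl1 hl2 hε hε1 h⟩
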